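/- Let $P\subset\mathbb R^3$ be a convex polytope that tiles $\mathbb R^3$ with multiplicity by translations: there are an integer $k\ge 1$ and a discrete multiset $\Lambda\subset\mathbb R^3$ (finitely many points, counted with multiplicity, in each ball) such that $\sum_{\lambda\in\Lambda}\mathbf 1_{P+\lambda}(x)=k$ for almost every $x\in\mathbb R^3$. A 4-legged frame $(e,\tau_1,\tau_2)$ of $P$ consists of four distinct edges of $P$ of the form $[v,v+e]$, $[v,v+e]+\tau_1$, $[v,v+e]+\tau_2$, $[v,v+e]+\tau_1+\tau_2$, of which the first two lie on a facet of $P$ and the last two lie on the opposite facet, i.e. its image under the central symmetry of $P$. Suppose that some line $l$ through the origin satisfies $$l\subseteq\bigcap_{(e,\tau_1,\tau_2)}\left(e^\perp\cup\tau_1^\perp\cup\tau_2^\perp\right),$$ the intersection being over all 4-legged frames of $P$. Then $P$ is a two-flat zonotope, that is, a Minkowski sum of finitely many line segments each of which lies in one of two different two-dimensional linear subspaces $H_1,H_2$. More precisely, let $F$ be the face of $P$ cut out by either of the two supporting planes of $P$ orthogonal to $l$. Then there are a facet $G$ of $P$ and a convex polytope $G'$ such that $F\cap G$ is a vertex or an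 edge of $P$, $G=G'+(F\cap G)$, and $P=F+G'$. (Thus $P=F+G$ up to translation when $F$ and $G$ share only a vertex; when they share an edge, that edge has to be removed from $G$ as a Minkowski summand.) -/

import Mathlib

open scoped Pointwise ENNReal RealInnerProductSpace

/-- Euclidean three-space. -/
abbrev E3 : Type := EuclideanSpace ℝ (Fin 3)

/-- A (convex) polytope: the convex hull of a finite nonempty set of points. -/
def IsPolytope (P : Set E3) : Prop :=
  ∃ S : Set E3, S.Finite ∧ S.Nonempty ∧ P = convexHull ℝ S

/-- `P` tiles space at level `k` when translated by the discrete multiset `Λ`, given by its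
multiplicity function: only finitely many points of `Λ` lie in each ball, and almost every point
is covered exactly `k` times, counting multiplicity, by the translates `v + P`. -/
def IsMultipleTiling (k : ℕ) (P : Set E3) (Λ : E3 → ℕ) : Prop :=
  (∀ R : ℝ, (Function.support Λ ∩ Metric.closedBall 0 R).Finite) ∧
    ∀ᵐ x : E3, ∑' v : E3, (Λ v : ℝ≥0∞) * (v +ᵥ P).indicator 1 x = (k : ℝ≥0∞)

/-- `F` is a `d`-dimensional face of `P`: the nonempty intersection of `P` with a supporting
hyperplane (or `P` itself), whose affine hull has dimension `d`.
Thus `d = 0, 1, 2` gives vertices, edges and facets. -/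
def IsFaceOfDim (d : ℕ) (P F : Set E3) : Prop :=
  IsExposed ℝ P F ∧ F.Nonempty ∧ Module.finrank ℝ (vectorSpan ℝ F) = d

/-- The face of `P` on its supporting plane with outer normal vector `u`. -/
def supportFace (P : Set E3) (u : E3) : Set E3 :=
  {x ∈ P | ∀ y ∈ P, ⟪u, y⟫ ≤ ⟪u, x⟫}

/-- A 4-legged frame of `P`: four distinct parallel edges
`[v, v + e]`, `[v, v + e] + τ₁`, `[v, v + e] + τ₂`, `[v, v + e] + τ₁ + τ₂` of `P`, the first two
on a facet `G` and the last two on the opposite facet, which is the mirror image of `G` in the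
centre of symmetry `c` of `P`. (Opposite facets are disjoint, so that `τ₁ ≠ 0` makes the four
edges distinct.) -/
def IsFourLeggedFrame (P : Set E3) (v e τ₁ τ₂ : E3) : Prop :=
  τ₁ ≠ 0 ∧
  IsFaceOfDim 1 P (segment ℝ v (v + e)) ∧
  IsFaceOfDim 1 P (segment ℝ (v + τ₁) (v + e + τ₁)) ∧
  IsFaceOfDim 1 P (segment ℝ (v + τ₂) (v + e + τ₂)) ∧
  IsFaceOfDim 1 P (segment ℝ (v + τ₁ + τ₂) (v + e + τ₁ + τ₂)) ∧
  ∃ (c : E3) (G : Set E3),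
    Equiv.pointReflection c '' P = P ∧ IsFaceOfDim 2 P G ∧
    segment ℝ v (v + e) ⊆ G ∧
    segment ℝ (v + τ₁) (v + e + τ₁) ⊆ G ∧
    segment ℝ (v + τ₂) (v + e + τ₂) ⊆ Equiv.pointReflection c '' G ∧
    segment ℝ (v + τ₁ + τ₂) (v + e + τ₁ + τ₂) ⊆ Equiv.pointReflection c '' G

/-- A two-flat zonotope: the Minkowski sum of `n + m` line segments, `n` of them in a
two-dimensional subspace `H₁` and `m` of them in a different two-dimensional subspace `H₂`. -/
def IsTwoFlatZonotope (P : Set E3) : Prop :=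
  ∃ H₁ H₂ : Submodule ℝ E3,
    Module.finrank ℝ H₁ = 2 ∧ Module.finrank ℝ H₂ = 2 ∧ H₁ ≠ H₂ ∧
    ∃ (n m : ℕ) (a b : Fin n → E3) (a' b' : Fin m → E3),
      (∀ i, a i ∈ H₁ ∧ b i ∈ H₁ ∧ a i ≠ b i) ∧
      (∀ j, a' j ∈ H₂ ∧ b' j ∈ H₂ ∧ a' j ≠ b' j) ∧
      P = (∑ i, segment ℝ (a i) (b i)) + ∑ j, segment ℝ (a' j) (b' j)

/-!
Central symmetry of `P` is not assumed: it is proved first that a polytope which tiles with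
multiplicity is a zonotope, and then the condition on frames is read off from the generators.

*A multiple tiling forces a zonotope.* Let `h` be the support function of `P`. Displacing all points
infinitesimally in a generic direction turns the covering, which has multiplicity `k` almost
everywhere, into one that has multiplicity `k` at every point (`cov_ev_eq`). Comparing displacements
to the two sides of a plane shows that the translates of two opposite facets cover the same points
equally often (`cov_facet`). Going down one more dimension, the four edges in a direction `e` that
lie on the two facets orthogonal to `n` satisfy an analogous relation (`cov_edge`). Averaging over
space (`lintegral_eq_of_cov_eq`) turns these relations into equalities of volumes: opposite facets
have equal areas (`volume_facet`), and the signed lengths of the four edges add up to zero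
(`volume_edge`).

The relation between lengths makes the total length of two edges in direction `e` on opposite sides
of `P` a constant depending on `e` alone (`exists_len_const`). They are the kinks of the width
function `h x + h (-x)` across the planes `e^⊥`, so that this function is a sum of functions
`|⟪g i, x⟫|` (`exists_width_eq_sum`). It remains to show that the asymmetry `a x = h x - h (-x)` is linear. The
area of a facet is a quadratic expression in the kinks of its support function
(`volume_thick_eq_knotEnergy`), so equality of the areas of the facets with normals `n` and `-n` is
a relation, linear once the width is known, between the kinks of `a` at `n`
(`sum_kink_asym₁_eq_zero`). Multiply it by `a n`, sum over all `n`, and collect the terms of each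
plane orthogonal to a `g i`. On such a plane the terms add up to the energy of `a`, that is, after
partial integration, to minus the integral of a square (`plane_energy`). All energies are
nonpositive and have sum zero, so all of them vanish, and `a` is linear on each of these planes.
The linear functions fit together (`exists_asym_eq_inner_planes`), and off the planes `a` has no
kinks, so it is linear (`asym_eq_inner`). Thus `h` is the support function of a zonotope
(`exists_supp_eq_sum_abs`).

*The condition on frames.* Let `u` span `l`, and orient the generators so that `⟪u, g i⟫ ≥ 0`. Let
`V` be the set of the generators not orthogonal to `u`. If `V` contains two nonparallel ones, some
plane `n^⊥` through two such generators has all of `V` on one side (`exists_supporting_plane`). The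
facet with normal `n` has an edge in a direction that is extreme among its generators in `V`; the
frame that it spans (`isFourLeggedFrame_zono`) has legs with `⟪u, e⟫ ≠ 0` and `⟪u, τ₁⟫ ≠ 0`, so the
hypothesis gives `⟪u, τ₂⟫ = 0`. As `τ₂` is a signed sum of all generators off the plane, with equal
signs for those in `V`, there are no generators of `V` off the plane (`exists_facet_normal`). If all
generators in `V` are parallel, take for `n^⊥` a plane through them and another generator. In both
cases every generator is orthogonal to `u` or to `n`, which makes `P` a two-flat zonotope
(`isTwoFlatZonotope_zono`). The face `F` is generated by the generators orthogonal to `u`, and the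
facet `G` with normal `n` by those orthogonal to `n`, among them all of `V`. With `G'` generated by
`V`, the intersection of `F` and `G` is generated by the generators orthogonal to both `u` and `n`,
all of which are parallel (`exists_facet_decomposition`).
-/

namespace MultipleTiling

open Filter Topology MeasureTheory

/-! ### Support functions and faces of finite point sets -/

/-- The support function of a finite set of points, `x ↦ max_{s ∈ S} ⟪x, s⟫`; it is meaningful
for nonempty `S` only. -/
noncomputable def supp (S : Finset E3) (x : E3) : ℝ := sSup ((fun s => ⟪x, s⟫) '' (S : Set E3))

open Classical in
/-- The points of `S` at which the linear functional `⟪x, ·⟫` attains its maximum over `S`. -/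
noncomputable def face (S : Finset E3) (x : E3) : Finset E3 := S.filter fun s => ⟪x, s⟫ = supp S x

lemma le_supp {S : Finset E3} {s : E3} (hs : s ∈ S) (x : E3) : ⟪x, s⟫ ≤ supp S x :=
  le_csSup (S.finite_toSet.image _).bddAbove ⟨s, hs, rfl⟩

lemma exists_eq_supp {S : Finset E3} (hS : S.Nonempty) (x : E3) : ∃ s ∈ S, ⟪x, s⟫ = supp S x := by
  have h : ((fun s => ⟪x, s⟫) '' (S : Set E3)).Nonempty := (Finset.coe_nonempty.2 hS).image _
  obtain ⟨s, hs, h⟩ := h.csSup_mem (S.finite_toSet.image _)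
  exact ⟨s, hs, h⟩

lemma supp_le {S : Finset E3} (hS : S.Nonempty) {x : E3} {c : ℝ} (h : ∀ s ∈ S, ⟪x, s⟫ ≤ c) :
    supp S x ≤ c := by
  obtain ⟨s, hs, e⟩ := exists_eq_supp hS x
  exact e ▸ h s hs

lemma mem_face {S : Finset E3} {x s : E3} : s ∈ face S x ↔ s ∈ S ∧ ⟪x, s⟫ = supp S x := by
  simp [face]

lemma face_subset (S : Finset E3) (x : E3) : face S x ⊆ S := fun _ h => (mem_face.1 h).1

lemma face_nonempty {S : Finset E3} (hS : S.Nonempty) (x : E3) : (face S x).Nonempty := by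
  obtain ⟨s, hs, e⟩ := exists_eq_supp hS x
  exact ⟨s, mem_face.2 ⟨hs, e⟩⟩

lemma supp_smul {S : Finset E3} (hS : S.Nonempty) {r : ℝ} (hr : 0 ≤ r) (x : E3) :
    supp S (r • x) = r * supp S x := by
  apply le_antisymm
  · refine supp_le hS fun s hs => ?_
    rw [real_inner_smul_left]
    exact mul_le_mul_of_nonneg_left (le_supp hs x) hr
  · obtain ⟨s, hs, e⟩ := exists_eq_supp hS x
    rw [← e, ← real_inner_smul_left]
    exact le_supp hs _

lemma supp_zero {S : Finset E3} (hS : S.Nonempty) : supp S 0 = 0 := by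
  simpa using supp_smul hS le_rfl 0

lemma face_smul {S : Finset E3} (hS : S.Nonempty) {r : ℝ} (hr : 0 < r) (x : E3) :
    face S (r • x) = face S x := by
  ext s
  rw [mem_face, mem_face, supp_smul hS hr.le, real_inner_smul_left]
  simp [hr.ne']

lemma supp_add_of_const {S : Finset E3} (hS : S.Nonempty) {x : E3} {c : ℝ}
    (h : ∀ s ∈ S, ⟪x, s⟫ = c) (y : E3) : supp S (y + x) = supp S y + c := by
  apply le_antisymm
  · refine supp_le hS fun s hs => ?_
    rw [inner_add_left, h s hs]
    linarith [le_supp hs y]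
  · obtain ⟨s, hs, e⟩ := exists_eq_supp hS y
    rw [← e, ← h s hs, ← inner_add_left]
    exact le_supp hs _

/-- On a face cut out by `x` the functional `⟪x, ·⟫` is constant. -/
lemma supp_face_add_smul {S : Finset E3} (hS : S.Nonempty) (x y : E3) (r : ℝ) :
    supp (face S x) (y + r • x) = supp (face S x) y + r * supp S x := by
  refine supp_add_of_const (face_nonempty hS x) (fun s hs => ?_) y
  rw [real_inner_smul_left, (mem_face.1 hs).2]

lemma supp_neg_le {S : Finset E3} (hS : S.Nonempty) (x : E3) : 0 ≤ supp S x + supp S (-x) := by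
  obtain ⟨s, hs⟩ := hS
  have h1 := le_supp hs x
  have h2 := le_supp hs (-x)
  rw [inner_neg_left] at h2
  linarith

lemma continuous_supp (S : Finset E3) : Continuous (supp S) := by
  rcases S.eq_empty_or_nonempty with rfl | hS
  · have : supp ∅ = fun _ => (0 : ℝ) := by ext x; simp [supp]
    rw [this]; exact continuous_const
  have : supp S = fun x => S.sup' hS fun s => ⟪x, s⟫ := by
    ext x
    apply le_antisymm
    · exact supp_le hS fun s hs => Finset.le_sup' (fun s => ⟪x, s⟫) hs
    · exact Finset.sup'_le _ _ fun s hs => le_supp hs x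
  rw [this]
  exact Continuous.finset_sup'_apply hS fun s _ => by fun_prop

lemma mem_convexHull_iff_supp {S : Finset E3} (hS : S.Nonempty) {z : E3} :
    z ∈ convexHull ℝ (S : Set E3) ↔ ∀ y, ⟪y, z⟫ ≤ supp S y := by
  constructor
  · intro hz y
    have : convexHull ℝ (S : Set E3) ⊆ {w | ⟪y, w⟫ ≤ supp S y} :=
      convexHull_min (fun s hs => le_supp hs y) (convex_halfSpace_le (innerₗ E3 y).isLinear _)
    exact this hz
  · intro h
    by_contra hz
    obtain ⟨f, u, h1, h2⟩ := geometric_hahn_banach_closed_point (convex_convexHull ℝ (S : Set E3))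
      (S.finite_toSet.isClosed_convexHull ℝ) hz
    set y := (InnerProductSpace.toDual ℝ E3).symm f
    have hy : ∀ w, f w = ⟪y, w⟫ := fun w => by simp [y]
    obtain ⟨s, hs, e⟩ := exists_eq_supp hS y
    have := h1 s (subset_convexHull ℝ _ hs)
    have := h y
    rw [hy] at *
    linarith

lemma supportFace_convexHull {S : Finset E3} (hS : S.Nonempty) (x : E3) :
    supportFace (convexHull ℝ (S : Set E3)) x = convexHull ℝ (face S x : Set E3) := by
  have hF := face_nonempty hS x
  ext z
  simp only [supportFace, Set.mem_ofPred_eq]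
  constructor
  · rintro ⟨hz, hmax⟩
    rw [mem_convexHull_iff_supp hS] at hz
    have hzx : ⟪x, z⟫ = supp S x := by
      obtain ⟨s, hs, e⟩ := exists_eq_supp hS x
      exact le_antisymm (hz x) (e ▸ hmax s (subset_convexHull ℝ _ hs))
    rw [mem_convexHull_iff_supp hF]
    intro y
    -- for large `r` the maximum of `y + r • x` over `S` is attained on the face of `x`
    by_contra! hlt
    obtain ⟨r, hr⟩ : ∃ r : ℝ, ∀ s ∈ S, s ∉ face S x → ⟪y, s⟫ - ⟪y, z⟫ < r * (supp S x - ⟪x, s⟫) := by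
      obtain ⟨r, hr⟩ := (S.finite_toSet.image
        fun s => (⟪y, s⟫ - ⟪y, z⟫) / (supp S x - ⟪x, s⟫)).bddAbove
      refine ⟨r + 1, fun s hs hsF => ?_⟩
      have h1 : 0 < supp S x - ⟪x, s⟫ :=
        sub_pos.2 (lt_of_le_of_ne (le_supp hs x) fun e => hsF (mem_face.2 ⟨hs, e⟩))
      rw [← div_lt_iff₀ h1]
      have := hr ⟨s, hs, rfl⟩
      simp only at this
      linarith
    obtain ⟨s, hs, e⟩ := exists_eq_supp hS (y + r • x)
    have h1 := hz (y + r • x)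
    rw [← e, inner_add_left, inner_add_left, real_inner_smul_left, real_inner_smul_left, hzx] at h1
    by_cases hsF : s ∈ face S x
    · have := le_supp hsF y
      rw [(mem_face.1 hsF).2] at h1
      linarith
    · have := hr s hs hsF
      linarith
  · intro hz
    have hz' : z ∈ convexHull ℝ (S : Set E3) :=
      convexHull_mono (by exact_mod_cast face_subset S x) hz
    refine ⟨hz', fun w hw => ?_⟩
    rw [mem_convexHull_iff_supp hF] at hz
    rw [mem_convexHull_iff_supp hS] at hw
    have h1 := hz (-x)
    obtain ⟨s, hs, e⟩ := exists_eq_supp hF (-x)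
    rw [← e, inner_neg_left, inner_neg_left, (mem_face.1 hs).2] at h1
    linarith [hw x]

/-! ### Germs of piecewise linear functions -/

lemma eventually_pos_lt {δ : ℝ} (hδ : 0 < δ) : ∀ᶠ ε in 𝓝[>] (0 : ℝ), 0 < ε ∧ ε < δ :=
  Ioo_mem_nhdsGT hδ

/-- Near `x` in direction `y` the face is the face of the face, and the support function is
affine. -/
lemma eventually_face_add {S : Finset E3} (hS : S.Nonempty) (x y : E3) :
    ∀ᶠ ε in 𝓝[>] (0 : ℝ), face S (x + ε • y) = face (face S x) y ∧
      supp S (x + ε • y) = supp S x + ε * supp (face S x) y := by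
  have hF := face_nonempty hS x
  have key : ∀ s ∈ S, s ∉ face S x →
      ∀ᶠ ε in 𝓝[>] (0 : ℝ), ⟪x + ε • y, s⟫ < supp S x + ε * supp (face S x) y := by
    intro s hs hsF
    have h1 : ⟪x, s⟫ < supp S x :=
      lt_of_le_of_ne (le_supp hs x) fun e => hsF (mem_face.2 ⟨hs, e⟩)
    have h2 : Tendsto (fun ε : ℝ => supp S x + ε * supp (face S x) y - ⟪x + ε • y, s⟫) (𝓝[>] 0)
        (𝓝 (supp S x + 0 * supp (face S x) y - ⟪x + (0 : ℝ) • y, s⟫)) := by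
      apply Tendsto.mono_left _ nhdsWithin_le_nhds
      apply Continuous.tendsto
      fun_prop
    filter_upwards [h2.eventually (lt_mem_nhds (by simpa using h1) :
      ∀ᶠ z in 𝓝 (supp S x + 0 * supp (face S x) y - ⟪x + (0 : ℝ) • y, s⟫), 0 < z)] with ε hε
    linarith
  have key2 : ∀ᶠ ε in 𝓝[>] (0 : ℝ), ∀ s ∈ S, s ∉ face S x →
      ⟪x + ε • y, s⟫ < supp S x + ε * supp (face S x) y := by
    have := (Finset.eventually_all (l := 𝓝[>] (0 : ℝ)) S
      (p := fun s ε => s ∉ face S x → ⟪x + ε • y, s⟫ < supp S x + ε * supp (face S x) y)).2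
      fun s hs => by
        by_cases h : s ∈ face S x
        · simp [h]
        · filter_upwards [key s hs h] with ε h _ using h
    exact this
  filter_upwards [key2, self_mem_nhdsWithin] with ε hε (hpos : 0 < ε)
  have hin : ∀ s ∈ face S x, ⟪x + ε • y, s⟫ = supp S x + ε * ⟪y, s⟫ := fun s hs => by
    rw [inner_add_left, real_inner_smul_left, (mem_face.1 hs).2]
  have hval : supp S (x + ε • y) = supp S x + ε * supp (face S x) y := by
    apply le_antisymm
    · refine supp_le hS fun s hs => ?_
      by_cases h : s ∈ face S x
      · rw [hin s h]
        gcongr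
        exact le_supp h y
      · exact (hε s hs h).le
    · obtain ⟨s, hs, e⟩ := exists_eq_supp hF y
      rw [← e, ← hin s hs]
      exact le_supp (face_subset S x hs) _
  refine ⟨?_, hval⟩
  ext s
  rw [mem_face, hval, mem_face]
  constructor
  · rintro ⟨hs, e⟩
    have h : s ∈ face S x := by
      by_contra h
      exact (hε s hs h).ne e
    rw [hin s h] at e
    exact ⟨h, by nlinarith⟩
  · rintro ⟨h, e⟩
    exact ⟨face_subset S x h, by rw [hin s h, e]⟩

/-- `f' x y` is the slope of `f` at `x` in the direction `y`, and `f` is affine on a short initial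
piece of each ray. -/
def HasGerm (f : E3 → ℝ) (f' : E3 → E3 → ℝ) : Prop :=
  ∀ x y, ∀ᶠ ε in 𝓝[>] (0 : ℝ), f (x + ε • y) = f x + ε * f' x y

lemma hasGerm_supp {S : Finset E3} (hS : S.Nonempty) : HasGerm (supp S) fun x => supp (face S x) :=
  fun x y => (eventually_face_add hS x y).mono fun _ h => h.2

lemma HasGerm.add {f g : E3 → ℝ} {f' g' : E3 → E3 → ℝ} (hf : HasGerm f f') (hg : HasGerm g g') :
    HasGerm (fun x => f x + g x) fun x y => f' x y + g' x y := by
  intro x y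
  filter_upwards [hf x y, hg x y] with ε h1 h2
  rw [h1, h2]; ring

lemma HasGerm.sub {f g : E3 → ℝ} {f' g' : E3 → E3 → ℝ} (hf : HasGerm f f') (hg : HasGerm g g') :
    HasGerm (fun x => f x - g x) fun x y => f' x y - g' x y := by
  intro x y
  filter_upwards [hf x y, hg x y] with ε h1 h2
  rw [h1, h2]; ring

lemma HasGerm.const_mul {f : E3 → ℝ} {f' : E3 → E3 → ℝ} (hf : HasGerm f f') (c : ℝ) :
    HasGerm (fun x => c * f x) fun x y => c * f' x y := by
  intro x y
  filter_upwards [hf x y] with ε h1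
  rw [h1]; ring

lemma HasGerm.sum {ι : Type*} (s : Finset ι) {f : ι → E3 → ℝ} {f' : ι → E3 → E3 → ℝ}
    (hf : ∀ i ∈ s, HasGerm (f i) (f' i)) :
    HasGerm (fun x => ∑ i ∈ s, f i x) fun x y => ∑ i ∈ s, f' i x y := by
  intro x y
  filter_upwards [(Finset.eventually_all s).2 fun i hi => hf i hi x y] with ε h
  rw [Finset.sum_congr rfl h, Finset.sum_add_distrib, Finset.mul_sum]

lemma HasGerm.comp_neg {f : E3 → ℝ} {f' : E3 → E3 → ℝ} (hf : HasGerm f f') :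
    HasGerm (fun x => f (-x)) fun x y => f' (-x) (-y) := by
  intro x y
  filter_upwards [hf (-x) (-y)] with ε h
  rw [← h]; congr 1; module

lemma hasGerm_inner (c : E3) : HasGerm (fun x => ⟪c, x⟫) fun _ y => ⟪c, y⟫ := by
  intro x y
  refine Eventually.of_forall fun ε => ?_
  simp only [inner_add_right, real_inner_smul_right]

lemma HasGerm.unique {f : E3 → ℝ} {f' g' : E3 → E3 → ℝ} (hf : HasGerm f f') (hg : HasGerm f g')
    (x y : E3) : f' x y = g' x y := by
  obtain ⟨ε, h, hpos⟩ := ((hf x y).and (hg x y) |>.and self_mem_nhdsWithin).exists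
  have : ε * f' x y = ε * g' x y := by linarith [h.1, h.2]
  exact mul_left_cancel₀ (ne_of_gt hpos) this

/-- The change of slope across `x` in the direction `w`. -/
def kink (f' : E3 → E3 → ℝ) (x w : E3) : ℝ := f' x w + f' x (-w)

open Classical in
/-- The slope of `|⟪g, ·⟫|` at `x` in direction `y`. -/
noncomputable def absGerm (g x y : E3) : ℝ :=
  if ⟪g, x⟫ = 0 then |⟪g, y⟫| else if 0 < ⟪g, x⟫ then ⟪g, y⟫ else -⟪g, y⟫

lemma hasGerm_abs (g : E3) : HasGerm (fun x => |⟪g, x⟫|) (absGerm g) := by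
  intro x y
  by_cases h : ⟪g, x⟫ = 0
  · filter_upwards [self_mem_nhdsWithin] with ε (hε : 0 < ε)
    simp [absGerm, h, inner_add_right, real_inner_smul_right, abs_mul, abs_of_pos hε]
  · have hc : Tendsto (fun ε : ℝ => ⟪g, x + ε • y⟫) (𝓝[>] 0) (𝓝 ⟪g, x + (0 : ℝ) • y⟫) := by
      apply Tendsto.mono_left _ nhdsWithin_le_nhds
      apply Continuous.tendsto
      fun_prop
    simp only [zero_smul, add_zero] at hc
    rcases lt_or_gt_of_ne h with h' | h'
    · filter_upwards [hc.eventually (gt_mem_nhds h')] with ε hε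
      rw [abs_of_neg hε, abs_of_neg h', absGerm, if_neg h, if_neg h'.not_gt, inner_add_right,
        real_inner_smul_right]
      ring
    · filter_upwards [hc.eventually (lt_mem_nhds h')] with ε hε
      rw [abs_of_pos hε, abs_of_pos h', absGerm, if_neg h, if_pos h', inner_add_right,
        real_inner_smul_right]

lemma kink_absGerm (g x w : E3) :
    kink (absGerm g) x w = if ⟪g, x⟫ = 0 then 2 * |⟪g, w⟫| else 0 := by
  unfold kink absGerm
  split_ifs <;> simp only [inner_neg_right, abs_neg] <;> ring

/-! ### Piecewise linear functions of one variable -/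

/-- `f` is affine on short intervals to the right and to the left of each point; `r t` is the slope
to the right of `t`, and `l t` is the slope seen when moving to the left from `t`. -/
def HasGerm1 (f r l : ℝ → ℝ) : Prop :=
  ∀ t, (∀ᶠ ε in 𝓝[>] (0 : ℝ), f (t + ε) = f t + ε * r t) ∧
    ∀ᶠ ε in 𝓝[>] (0 : ℝ), f (t - ε) = f t + ε * l t

lemma HasGerm.hasGerm1 {f : E3 → ℝ} {f' : E3 → E3 → ℝ} (hf : HasGerm f f') (x y : E3) :
    HasGerm1 (fun t => f (x + t • y)) (fun t => f' (x + t • y) y) fun t => f' (x + t • y) (-y) := by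
  intro t
  constructor
  · filter_upwards [hf (x + t • y) y] with ε h
    rw [← h]; congr 1; module
  · filter_upwards [hf (x + t • y) (-y)] with ε h
    rw [← h]; congr 1; module

lemma HasGerm1.sub {f r l f₂ r₂ l₂ : ℝ → ℝ} (h : HasGerm1 f r l) (h₂ : HasGerm1 f₂ r₂ l₂) :
    HasGerm1 (fun t => f t - f₂ t) (fun t => r t - r₂ t) fun t => l t - l₂ t := by
  intro t
  constructor
  · filter_upwards [(h t).1, (h₂ t).1] with ε h1 h2
    rw [h1, h2]; ring
  · filter_upwards [(h t).2, (h₂ t).2] with ε h1 h2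
    rw [h1, h2]; ring

lemma hasGerm1_sum_abs (T : Finset ℝ) (c : ℝ → ℝ) :
    HasGerm1 (fun t => ∑ τ ∈ T, c τ * |t - τ|) (fun t => ∑ τ ∈ T, c τ * if t < τ then -1 else 1)
      fun t => ∑ τ ∈ T, c τ * if τ < t then -1 else 1 := by
  have hb : ∀ t τ : ℝ, ∀ᶠ ε in 𝓝[>] (0 : ℝ), 0 < ε ∧ (t ≠ τ → ε < |t - τ|) := by
    intro t τ
    by_cases h : t = τ
    · filter_upwards [self_mem_nhdsWithin] with ε hε using ⟨hε, fun h' => absurd h h'⟩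
    · filter_upwards [eventually_pos_lt (abs_pos.2 (sub_ne_zero.2 h))] with ε hε
        using ⟨hε.1, fun _ => hε.2⟩
  intro t
  have hev := (Finset.eventually_all T).2 fun τ _ => hb t τ
  constructor
  · filter_upwards [hev] with ε h
    rw [Finset.mul_sum, ← Finset.sum_add_distrib]
    refine Finset.sum_congr rfl fun τ hτ => ?_
    obtain ⟨h0, h1⟩ := h τ hτ
    split_ifs with hlt
    · have := h1 hlt.ne
      rw [abs_of_neg (sub_neg.2 hlt)] at this ⊢
      rw [abs_of_neg (by linarith)]; ring
    · rw [abs_of_nonneg (by linarith : 0 ≤ t - τ), abs_of_nonneg (by linarith)]; ring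
  · filter_upwards [hev] with ε h
    rw [Finset.mul_sum, ← Finset.sum_add_distrib]
    refine Finset.sum_congr rfl fun τ hτ => ?_
    obtain ⟨h0, h1⟩ := h τ hτ
    split_ifs with hlt
    · have := h1 hlt.ne'
      rw [abs_of_pos (sub_pos.2 hlt)] at this ⊢
      rw [abs_of_pos (by linarith)]; ring
    · rw [abs_of_nonpos (by linarith : t - τ ≤ 0), abs_of_nonpos (by linarith)]; ring

/-- A function which is locally affine on both sides of each point, with the same slope, is
affine. -/
lemma HasGerm1.exists_affine {f r l : ℝ → ℝ} (h : HasGerm1 f r l) (h0 : ∀ t, r t + l t = 0) :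
    ∃ α β : ℝ, ∀ t, f t = α + β * t := by
  have hloc : ∀ t, ∃ δ > 0, ∀ s, |s - t| < δ → f s = f t + (s - t) * r t := by
    intro t
    obtain ⟨δ₁, hδ₁, h1⟩ := mem_nhdsGT_iff_exists_Ioo_subset.1 (h t).1
    obtain ⟨δ₂, hδ₂, h2⟩ := mem_nhdsGT_iff_exists_Ioo_subset.1 (h t).2
    have e : l t = -r t := by linarith [h0 t]
    refine ⟨min δ₁ δ₂, lt_min hδ₁ hδ₂, fun s hs => ?_⟩
    rcases lt_trichotomy s t with hst | rfl | hst
    · rw [abs_of_neg (sub_neg.2 hst)] at hs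
      have := h2 (a := t - s) ⟨by linarith, by linarith [min_le_right δ₁ δ₂]⟩
      simp only [Set.mem_ofPred_eq, sub_sub_cancel, e] at this
      rw [this]; ring
    · simp
    · rw [abs_of_pos (sub_pos.2 hst)] at hs
      have := h1 (a := s - t) ⟨by linarith, by linarith [min_le_left δ₁ δ₂]⟩
      simpa using this
  have hder' : ∀ t, ∀ᶠ s in 𝓝 t, HasDerivAt f (r t) s := by
    intro t
    obtain ⟨δ, hδ, hf⟩ := hloc t
    filter_upwards [Metric.ball_mem_nhds t hδ] with s hs
    have hlin : HasDerivAt (fun s => f t + (s - t) * r t) (r t) s := by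
      simpa using (((hasDerivAt_id s).sub_const t).mul_const (r t)).const_add (f t)
    refine hlin.congr_of_eventuallyEq ?_
    filter_upwards [Metric.isOpen_ball.mem_nhds hs] with u hu
    exact hf u (by simpa [Real.dist_eq] using hu)
  have hder : ∀ t, HasDerivAt f (r t) t := fun t => (hder' t).self_of_nhds
  have hlc : IsLocallyConstant r := by
    rw [IsLocallyConstant.iff_eventually_eq]
    intro t
    filter_upwards [hder' t] with s hs using (hder s).unique hs
  have hconst : ∀ t, r t = r 0 := fun t => hlc.apply_eq_of_preconnectedSpace t 0
  have hg : ∀ t, HasDerivAt (fun t => f t - r 0 * t) 0 t := by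
    intro t
    have := (hder t).sub ((hasDerivAt_id' t).const_mul (r 0))
    rw [hconst t, mul_one, sub_self] at this
    exact this
  have := is_const_of_deriv_eq_zero (fun t => (hg t).differentiableAt) fun t => (hg t).deriv
  refine ⟨f 0, r 0, fun t => ?_⟩
  have := this t 0
  simp only [mul_zero, sub_zero] at this
  linarith

/-- A piecewise affine function is determined by its kinks up to an affine function. -/
lemma HasGerm1.exists_eq_sum_abs {f r l : ℝ → ℝ} (h : HasGerm1 f r l) (T : Finset ℝ)
    (hT : ∀ t, t ∉ T → r t + l t = 0) :
    ∃ α β : ℝ, ∀ t, f t = α + β * t + ∑ τ ∈ T, (r τ + l τ) / 2 * |t - τ| := by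
  obtain ⟨α, β, hab⟩ := (h.sub (hasGerm1_sum_abs T fun τ => (r τ + l τ) / 2)).exists_affine (by
    intro t
    have : ∀ τ ∈ T, (r τ + l τ) / 2 * (if t < τ then -1 else 1 : ℝ) +
        (r τ + l τ) / 2 * (if τ < t then -1 else 1) = if t = τ then r τ + l τ else 0 := by
      intro τ _
      rcases lt_trichotomy t τ with h | rfl | h
      · simp [h, h.not_gt, h.ne]
      · simp
      · simp [h, h.not_gt, h.ne']
    have hs := Finset.sum_congr rfl this
    rw [Finset.sum_add_distrib, Finset.sum_ite_eq] at hs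
    by_cases ht : t ∈ T
    · rw [if_pos ht] at hs; linarith
    · rw [if_neg ht] at hs; linarith [hT t ht])
  exact ⟨α, β, fun t => by linarith [hab t]⟩

/-- The kernel `min (τ - a) (σ - a)` is positive definite on `(a, ∞)`. -/
lemma sum_mul_min_nonneg (c : ℝ → ℝ) (T : Finset ℝ) : ∀ a : ℝ, (∀ τ ∈ T, a < τ) →
    0 ≤ ∑ τ ∈ T, ∑ σ ∈ T, c τ * c σ * min (τ - a) (σ - a) ∧
    (∑ τ ∈ T, ∑ σ ∈ T, c τ * c σ * min (τ - a) (σ - a) = 0 → ∀ τ ∈ T, c τ = 0) := by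
  induction T using Finset.induction_on_min with
  | empty => simp
  | insert b T hb ih =>
    intro a ha
    have hbT : b ∉ T := fun h => lt_irrefl _ (hb b h)
    have hab : 0 < b - a := by linarith [ha b (Finset.mem_insert_self _ _)]
    obtain ⟨ih1, ih2⟩ := ih b hb
    -- the kernel based at `a` is the kernel based at the least point plus a square
    have key : ∑ τ ∈ insert b T, ∑ σ ∈ insert b T, c τ * c σ * min (τ - a) (σ - a) =
        (b - a) * (∑ τ ∈ insert b T, c τ) ^ 2 +
          ∑ τ ∈ T, ∑ σ ∈ T, c τ * c σ * min (τ - b) (σ - b) := by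
      have e1 : ∀ τ ∈ insert b T, ∀ σ ∈ insert b T, c τ * c σ * min (τ - a) (σ - a) =
          (b - a) * (c τ * c σ) + c τ * c σ * min (τ - b) (σ - b) := by
        intro τ _ σ _
        have : min (τ - a) (σ - a) = (b - a) + min (τ - b) (σ - b) := by
          rw [← min_add_add_left]; congr 1 <;> ring
        rw [this]; ring
      rw [Finset.sum_congr rfl fun τ hτ => Finset.sum_congr rfl (e1 τ hτ)]
      simp_rw [Finset.sum_add_distrib, ← Finset.mul_sum, ← Finset.sum_mul]
      rw [sq]
      congr 1
      have hz : ∀ τ ∈ insert b T, min (τ - b) (b - b) = 0 ∧ min (b - b) (τ - b) = 0 := by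
        intro τ hτ
        rcases Finset.mem_insert.1 hτ with rfl | h
        · simp
        · have := hb τ h
          constructor <;> simp [this.le]
      rw [Finset.sum_insert hbT, Finset.sum_eq_zero (fun σ hσ => by rw [(hz σ hσ).2, mul_zero]),
        zero_add]
      refine Finset.sum_congr rfl fun τ hτ => ?_
      rw [Finset.sum_insert hbT, (hz τ (Finset.mem_insert_of_mem hτ)).1, mul_zero, zero_add]
    rw [key]
    have hsq : 0 ≤ (b - a) * (∑ τ ∈ insert b T, c τ) ^ 2 := by positivity
    refine ⟨by linarith, fun h0 => ?_⟩
    have hT := ih2 (by linarith)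
    have hs : (∑ τ ∈ insert b T, c τ) ^ 2 = 0 := by
      have : (b - a) * (∑ τ ∈ insert b T, c τ) ^ 2 = 0 := by linarith
      exact (mul_eq_zero.1 this).resolve_left hab.ne'
    rw [Finset.sum_insert hbT, Finset.sum_eq_zero hT, add_zero] at hs
    intro τ hτ
    rcases Finset.mem_insert.1 hτ with rfl | h
    · exact pow_eq_zero_iff two_ne_zero |>.1 hs
    · exact hT τ h

/-- The kernel `|τ - σ|` is strictly conditionally negative definite. -/
lemma sum_mul_abs_nonpos (c : ℝ → ℝ) (T : Finset ℝ) (hc : ∑ τ ∈ T, c τ = 0) :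
    ∑ τ ∈ T, ∑ σ ∈ T, c τ * c σ * |τ - σ| ≤ 0 ∧
    (∑ τ ∈ T, ∑ σ ∈ T, c τ * c σ * |τ - σ| = 0 → ∀ τ ∈ T, c τ = 0) := by
  obtain ⟨a, ha⟩ : ∃ a, ∀ τ ∈ T, a < τ := by
    obtain ⟨a, ha⟩ := T.finite_toSet.bddBelow
    exact ⟨a - 1, fun τ hτ => by linarith [ha hτ]⟩
  have key : ∑ τ ∈ T, ∑ σ ∈ T, c τ * c σ * |τ - σ| =
      -2 * ∑ τ ∈ T, ∑ σ ∈ T, c τ * c σ * min (τ - a) (σ - a) := by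
    have e1 : ∀ τ ∈ T, ∀ σ ∈ T, c τ * c σ * |τ - σ| =
        c τ * (τ - a) * c σ + c τ * (c σ * (σ - a)) +
          -2 * (c τ * c σ * min (τ - a) (σ - a)) := by
      intro τ _ σ _
      rcases le_total τ σ with h | h
      · rw [abs_of_nonpos (by linarith), min_eq_left (by linarith)]; ring
      · rw [abs_of_nonneg (by linarith), min_eq_right (by linarith)]; ring
    rw [Finset.sum_congr rfl fun τ hτ => Finset.sum_congr rfl (e1 τ hτ)]
    simp_rw [Finset.sum_add_distrib, ← Finset.mul_sum, hc, mul_zero, ← Finset.sum_mul, hc]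
    simp
  obtain ⟨h1, h2⟩ := sum_mul_min_nonneg c T a ha
  rw [key]
  exact ⟨by linarith, fun h => h2 (by linarith)⟩

/-- A piecewise affine function that is constant near `±∞` satisfies `∑ f(τ) κ(τ) ≤ 0`, where
`κ(τ)` is the change of slope at `τ` (the sum is `-∫ f'²`), with equality only for constants. -/
lemma HasGerm1.energy {f r l : ℝ → ℝ} (h : HasGerm1 f r l) (T : Finset ℝ)
    (hT : ∀ t, t ∉ T → r t + l t = 0) {c₁ c₂ : ℝ} (h₁ : ∀ᶠ t in atTop, f t = c₁)
    (h₂ : ∀ᶠ t in atTop, f (-t) = c₂) :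
    ∑ τ ∈ T, f τ * (r τ + l τ) ≤ 0 ∧
      (∑ τ ∈ T, f τ * (r τ + l τ) = 0 → ∃ α, ∀ t, f t = α) := by
  obtain ⟨α, β, hf⟩ := h.exists_eq_sum_abs T hT
  obtain ⟨M, hM⟩ : ∃ M, ∀ τ ∈ T, |τ| ≤ M := by
    obtain ⟨M, hM⟩ := (T.finite_toSet.image fun τ => |τ|).bddAbove
    exact ⟨M, fun τ hτ => hM ⟨τ, hτ, rfl⟩⟩
  set A := ∑ τ ∈ T, (r τ + l τ) / 2 with hA
  set B := ∑ τ ∈ T, (r τ + l τ) / 2 * τ with hB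
  have hp : ∀ t, M ≤ t → f t = (α - B) + (β + A) * t := by
    intro t ht
    rw [hf t]
    have : ∀ τ ∈ T, (r τ + l τ) / 2 * |t - τ| = (r τ + l τ) / 2 * t - (r τ + l τ) / 2 * τ := by
      intro τ hτ
      rw [abs_of_nonneg (by linarith [hM τ hτ, le_abs_self τ])]; ring
    rw [Finset.sum_congr rfl this, Finset.sum_sub_distrib, ← Finset.sum_mul]; ring
  have hm : ∀ t, M ≤ t → f (-t) = (α + B) + (-β + A) * t := by
    intro t ht
    rw [hf (-t)]
    have : ∀ τ ∈ T, (r τ + l τ) / 2 * |-t - τ| = (r τ + l τ) / 2 * t + (r τ + l τ) / 2 * τ := by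
      intro τ hτ
      rw [abs_of_nonpos (by linarith [hM τ hτ, neg_abs_le τ])]; ring
    rw [Finset.sum_congr rfl this, Finset.sum_add_distrib, ← Finset.sum_mul]; ring
  have slope : ∀ {g : ℝ → ℝ} {c u v : ℝ}, (∀ᶠ t in atTop, g t = c) →
      (∀ t, M ≤ t → g t = u + v * t) → v = 0 := by
    intro g c u v h1 h2
    obtain ⟨N, hN⟩ := eventually_atTop.1 h1
    have e1 := hN (max N M) (le_max_left _ _)
    have e2 := hN (max N M + 1) (by linarith [le_max_left N M])
    rw [h2 _ (le_max_right _ _)] at e1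
    rw [h2 _ (by linarith [le_max_right N M])] at e2
    linarith
  have s1 := slope h₁ hp
  have s2 := slope (g := fun t => f (-t)) h₂ hm
  have hβ : β = 0 := by linarith
  have hA0 : A = 0 := by linarith
  obtain ⟨e1, e2⟩ := sum_mul_abs_nonpos (fun τ => (r τ + l τ) / 2) T hA0
  have key : ∑ τ ∈ T, f τ * (r τ + l τ) =
      2 * ∑ τ ∈ T, ∑ σ ∈ T, (r τ + l τ) / 2 * ((r σ + l σ) / 2) * |τ - σ| := by
    have : ∀ τ ∈ T, f τ * (r τ + l τ) = (2 * α) * ((r τ + l τ) / 2) +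
        2 * ∑ σ ∈ T, (r τ + l τ) / 2 * ((r σ + l σ) / 2) * |τ - σ| := by
      intro τ _
      rw [hf τ, hβ]
      simp_rw [mul_assoc ((r τ + l τ) / 2), ← Finset.mul_sum]
      ring
    rw [Finset.sum_congr rfl this, Finset.sum_add_distrib, ← Finset.mul_sum, ← hA, hA0,
      ← Finset.mul_sum]
    ring
  rw [key]
  refine ⟨by linarith, fun h0 => ⟨α, fun t => ?_⟩⟩
  have hc := e2 (by linarith)
  rw [hf t, hβ, Finset.sum_eq_zero fun τ hτ => by rw [hc τ hτ, zero_mul]]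
  ring

/-- A positively homogeneous piecewise linear function without kinks along the line `w + ℝ w'` is
odd at `w'`: it is affine on the lines parallel to `w'` in a half plane. -/
lemma HasGerm.odd_of_no_kink {f : E3 → ℝ} {f' : E3 → E3 → ℝ} (hf : HasGerm f f')
    (hom : ∀ r : ℝ, 0 < r → ∀ x, f (r • x) = r * f x) {w w' : E3}
    (h : ∀ t : ℝ, kink f' (w + t • w') w' = 0) : f (-w') = -f w' := by
  obtain ⟨α, β, hab⟩ := (hf.hasGerm1 w w').exists_affine h
  have lim : ∀ (c : ℝ) (z : E3), (∀ᶠ ε in 𝓝[>] (0 : ℝ), f (z + ε • w) = ε * α + c) → f z = c := by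
    intro c z hz
    have h1 : Tendsto (fun ε : ℝ => f z + ε * f' z w) (𝓝[>] 0) (𝓝 (f z + 0 * f' z w)) :=
      (Continuous.tendsto (by fun_prop) 0).mono_left nhdsWithin_le_nhds
    have h2 : Tendsto (fun ε : ℝ => ε * α + c) (𝓝[>] 0) (𝓝 (0 * α + c)) :=
      (Continuous.tendsto (by fun_prop) 0).mono_left nhdsWithin_le_nhds
    have h3 := tendsto_nhds_unique (h1.congr' ?_) h2
    · simpa using h3
    · filter_upwards [hz, hf z w] with ε e1 e2
      rw [← e1, e2]
  have h1 : f w' = β := by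
    refine lim β w' ?_
    filter_upwards [self_mem_nhdsWithin] with ε (hε : 0 < ε)
    have : w' + ε • w = ε • (w + ε⁻¹ • w') := by
      rw [smul_add, smul_smul, mul_inv_cancel₀ hε.ne', one_smul, add_comm]
    rw [this, hom ε hε, hab]
    field_simp
  have h2 : f (-w') = -β := by
    refine lim (-β) (-w') ?_
    filter_upwards [self_mem_nhdsWithin] with ε (hε : 0 < ε)
    have : -w' + ε • w = ε • (w + (-ε⁻¹) • w') := by
      rw [smul_add, smul_smul, mul_neg, mul_inv_cancel₀ hε.ne', neg_smul, one_smul, add_comm]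
    rw [this, hom ε hε, hab]
    field_simp
  rw [h1, h2]

/-! ### Orthonormal triples -/

/-- `u`, `v`, `w` form an orthonormal basis of space. -/
structure ON3 (u v w : E3) : Prop where
  hu : ⟪u, u⟫ = 1
  hv : ⟪v, v⟫ = 1
  hw : ⟪w, w⟫ = 1
  huv : ⟪u, v⟫ = 0
  huw : ⟪u, w⟫ = 0
  hvw : ⟪v, w⟫ = 0

namespace ON3
variable {u v w : E3}

lemma hvu (h : ON3 u v w) : ⟪v, u⟫ = 0 := by rw [real_inner_comm]; exact h.huv
lemma hwu (h : ON3 u v w) : ⟪w, u⟫ = 0 := by rw [real_inner_comm]; exact h.huw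
lemma hwv (h : ON3 u v w) : ⟪w, v⟫ = 0 := by rw [real_inner_comm]; exact h.hvw

lemma rot (h : ON3 u v w) : ON3 v w u := ⟨h.hv, h.hw, h.hu, h.hvw, h.hvu, h.hwu⟩
lemma neg (h : ON3 u v w) : ON3 (-u) v w :=
  ⟨by rw [inner_neg_neg, h.hu], h.hv, h.hw, by simp [h.huv], by simp [h.huw], h.hvw⟩

lemma orthonormal (h : ON3 u v w) : Orthonormal ℝ ![u, v, w] := by
  rw [orthonormal_iff_ite]
  intro i j
  fin_cases i <;> fin_cases j <;>
    simp [h.hu, h.hv, h.hw, h.huv, h.huw, h.hvw, h.hvu, h.hwu, h.hwv,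
      -inner_self_eq_norm_sq_to_K]

/-- The orthonormal basis of a triple. -/
noncomputable def basis (h : ON3 u v w) : OrthonormalBasis (Fin 3) ℝ E3 :=
  OrthonormalBasis.mk h.orthonormal
    (h.orthonormal.linearIndependent.span_eq_top_of_card_eq_finrank' (by simp)).ge

lemma expand (h : ON3 u v w) (x : E3) : x = ⟪u, x⟫ • u + ⟪v, x⟫ • v + ⟪w, x⟫ • w := by
  have := h.basis.sum_repr' x
  simp only [basis, OrthonormalBasis.coe_mk, Fin.sum_univ_three] at this
  exact this.symm

end ON3

lemma exists_ON3 (u : E3) (hu : ⟪u, u⟫ = 1) : ∃ v w, ON3 u v w := by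
  have hu' : ‖u‖ = 1 := by
    rw [real_inner_self_eq_norm_sq] at hu
    nlinarith [norm_nonneg u]
  have hne : u ≠ 0 := by
    intro h
    simp [h] at hu'
  have : Fact (Module.finrank ℝ E3 = 2 + 1) := ⟨by simp⟩
  let b := stdOrthonormalBasis ℝ (ℝ ∙ u)ᗮ
  have hd : Module.finrank ℝ (ℝ ∙ u)ᗮ = 2 := Submodule.finrank_orthogonal_span_singleton hne
  have hb := orthonormal_iff_ite.1 b.orthonormal
  have hp : ∀ z : (ℝ ∙ u)ᗮ, ⟪u, (z : E3)⟫ = 0 := fun z => Submodule.mem_orthogonal_singleton_iff_inner_right.1 z.2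
  let i : Fin (Module.finrank ℝ (ℝ ∙ u)ᗮ) := ⟨0, by omega⟩
  let j : Fin (Module.finrank ℝ (ℝ ∙ u)ᗮ) := ⟨1, by omega⟩
  refine ⟨b i, b j, hu, ?_, ?_, hp _, hp _, ?_⟩
  · exact (hb i i).trans (if_pos rfl)
  · exact (hb j j).trans (if_pos rfl)
  · have := hb i j
    rw [if_neg (by simp [i, j])] at this
    exact this

/-! ### Polytopes as intersections of half-spaces -/

/-- A polytope with interior points is a finite intersection of half-spaces: the polar body has
finitely many extreme points, as each is determined by the constraints active at it, and is
generated by them. -/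
lemma exists_halfSpaces (S : Finset E3) (hint : (interior (convexHull ℝ (S : Set E3))).Nonempty) :
    ∃ N : Finset (E3 × ℝ), (∀ q ∈ N, q.1 ≠ 0) ∧
      ∀ z, z ∈ convexHull ℝ (S : Set E3) ↔ ∀ q ∈ N, ⟪q.1, z⟫ ≤ q.2 := by
  classical
  obtain ⟨o, ho⟩ := hint
  set P := convexHull ℝ (S : Set E3) with hP
  have hoP : o ∈ P := interior_subset ho
  have hS : S.Nonempty := by
    by_contra h
    rw [Finset.not_nonempty_iff_eq_empty] at h
    simp [hP, h] at hoP
  obtain ⟨r, hr, hball⟩ := Metric.isOpen_iff.1 isOpen_interior o ho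
  -- the polar body
  let Q : Set E3 := {y | ∀ s ∈ S, ⟪s - o, y⟫ ≤ 1}
  have hQconv : Convex ℝ Q := by
    have : Q = ⋂ s ∈ S, {y | ⟪s - o, y⟫ ≤ 1} := by ext; simp [Q]
    rw [this]
    exact convex_iInter₂ fun s _ => convex_halfSpace_le (innerₗ E3 (s - o)).isLinear _
  have hQclosed : IsClosed Q := by
    have : Q = ⋂ s ∈ S, {y | ⟪s - o, y⟫ ≤ 1} := by ext; simp [Q]
    rw [this]
    exact isClosed_biInter fun s _ => isClosed_le (by fun_prop) continuous_const
  have hQP : ∀ y ∈ Q, ∀ z ∈ P, ⟪z - o, y⟫ ≤ 1 := by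
    intro y hy z hz
    have h1 := (mem_convexHull_iff_supp hS).1 hz y
    have h2 : supp S y ≤ 1 + ⟪y, o⟫ := supp_le hS fun s hs => by
      have := hy s hs
      rw [inner_sub_left, real_inner_comm, real_inner_comm y o] at this
      linarith
    rw [inner_sub_left, real_inner_comm, real_inner_comm y o]
    linarith
  have hQbdd : Bornology.IsBounded Q := by
    rw [isBounded_iff_forall_norm_le]
    refine ⟨2 / r, fun y hy => ?_⟩
    by_cases hy0 : y = 0
    · simp [hy0]; positivity
    have hn : 0 < ‖y‖ := norm_pos_iff.2 hy0
    have hz : o + (r / 2 / ‖y‖) • y ∈ P := by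
      apply interior_subset (hball _)
      rw [Metric.mem_ball, dist_eq_norm, add_sub_cancel_left, norm_smul, Real.norm_eq_abs,
        abs_of_pos (by positivity)]
      field_simp
      linarith
    have := hQP y hy _ hz
    rw [add_sub_cancel_left, real_inner_smul_left, real_inner_self_eq_norm_sq] at this
    rw [le_div_iff₀ hr]
    field_simp at this
    nlinarith
  have hQcomp : IsCompact Q := Metric.isCompact_of_isClosed_isBounded hQclosed hQbdd
  have hKM := closure_convexHull_extremePoints hQcomp hQconv
  -- an extreme point is determined by its active constraints
  have hinj : Set.InjOn (fun y => S.filter fun s => ⟪s - o, y⟫ = 1) (Q.extremePoints ℝ) := by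
    intro y hy y' hy' hyy
    by_contra hne
    have hact : ∀ s ∈ S, ⟪s - o, y⟫ = 1 → ⟪s - o, y' - y⟫ = 0 := by
      intro s hs h1
      have : s ∈ S.filter fun s => ⟪s - o, y'⟫ = 1 := by
        rw [← show _ = S.filter fun s => ⟪s - o, y'⟫ = 1 from hyy]; simp [hs, h1]
      rw [inner_sub_right, h1, (Finset.mem_filter.1 this).2, sub_self]
    have hev : ∀ c : ℝ, ∀ᶠ ε in 𝓝[>] (0 : ℝ), y + (ε * c) • (y' - y) ∈ Q := by
      intro c
      refine (Finset.eventually_all S).2 fun s hs => ?_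
      by_cases h1 : ⟪s - o, y⟫ = 1
      · refine Eventually.of_forall fun ε => ?_
        rw [inner_add_right, inner_smul_right, hact s hs h1, h1]; simp
      · have h2 : ⟪s - o, y⟫ < 1 := lt_of_le_of_ne (hy.1 s hs) h1
        have hc : Tendsto (fun ε : ℝ => ⟪s - o, y + (ε * c) • (y' - y)⟫) (𝓝[>] 0)
            (𝓝 ⟪s - o, y + ((0 : ℝ) * c) • (y' - y)⟫) :=
          (Continuous.tendsto (by fun_prop) 0).mono_left nhdsWithin_le_nhds
        rw [zero_mul, zero_smul, add_zero] at hc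
        exact (hc.eventually (gt_mem_nhds h2)).mono fun _ h => h.le
    obtain ⟨ε, ⟨h1, h2⟩, hε⟩ := ((hev 1).and (hev (-1)) |>.and self_mem_nhdsWithin).exists
    have hε : 0 < ε := hε
    have hmem : y ∈ openSegment ℝ (y + (ε * 1) • (y' - y)) (y + (ε * -1) • (y' - y)) :=
      ⟨1 / 2, 1 / 2, by norm_num, by norm_num, by norm_num, by module⟩
    have := hy.2 h1 h2 hmem
    rw [add_eq_left, smul_eq_zero, sub_eq_zero] at this
    rcases this with h | h
    · linarith
    · exact hne h.symm
  have hfin : (Q.extremePoints ℝ).Finite := by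
    refine Set.Finite.of_finite_image (Set.Finite.subset (S.powerset.finite_toSet) ?_) hinj
    rintro _ ⟨y, _, rfl⟩
    exact Finset.mem_coe.2 (Finset.mem_powerset.2 (Finset.filter_subset _ _))
  refine ⟨(hfin.toFinset.image fun y => (y, 1 + ⟪y, o⟫)).filter fun q => q.1 ≠ 0,
    fun q hq => (Finset.mem_filter.1 hq).2, fun z => ⟨fun hz q hq => ?_, fun h => ?_⟩⟩
  · obtain ⟨y, hy, rfl⟩ := Finset.mem_image.1 (Finset.mem_filter.1 hq).1
    have := hQP y (extremePoints_subset ((Set.Finite.mem_toFinset _).1 hy)) z hz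
    rw [inner_sub_left, real_inner_comm, real_inner_comm y o] at this
    simp only
    linarith
  · by_contra hz
    have hext : ∀ y ∈ Q.extremePoints ℝ, ⟪z - o, y⟫ ≤ 1 := by
      intro y hy
      by_cases hy0 : y = 0
      · simp [hy0]
      have := h (y, 1 + ⟪y, o⟫) (Finset.mem_filter.2
        ⟨Finset.mem_image.2 ⟨y, (Set.Finite.mem_toFinset _).2 hy, rfl⟩, hy0⟩)
      rw [inner_sub_left, real_inner_comm, real_inner_comm y o]
      simp only at this
      linarith
    have hQz : Q ⊆ {y | ⟪z - o, y⟫ ≤ 1} := by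
      rw [← hKM]
      exact closure_minimal (convexHull_min hext
        (convex_halfSpace_le (innerₗ E3 (z - o)).isLinear _))
        (isClosed_le (by fun_prop) continuous_const)
    rw [hP, mem_convexHull_iff_supp hS] at hz
    push Not at hz
    obtain ⟨y, hy⟩ := hz
    set d := supp S y - ⟪y, o⟫ with hd
    have hd0 : 0 ≤ d := by linarith [(mem_convexHull_iff_supp hS).1 hoP y]
    -- a functional separating `z` from `P`, scaled into the polar body
    have hd' : 0 < ⟪y, z⟫ - ⟪y, o⟫ := by linarith
    obtain ⟨c, hc0, hc1, hc2⟩ : ∃ c : ℝ, 0 < c ∧ c * d ≤ 1 ∧ 1 < c * (⟪y, z⟫ - ⟪y, o⟫) := by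
      have hlt : d < ⟪y, z⟫ - ⟪y, o⟫ := by linarith
      set D := ⟪y, z⟫ - ⟪y, o⟫
      refine ⟨2 / (d + D), by positivity, ?_, ?_⟩
      · rw [div_mul_eq_mul_div, div_le_one (by positivity)]; linarith
      · rw [div_mul_eq_mul_div, lt_div_iff₀ (by positivity)]; linarith
    have hyQ : c • y ∈ Q := by
      intro s hs
      rw [inner_sub_left, real_inner_smul_right, real_inner_smul_right, real_inner_comm,
        real_inner_comm y o]
      nlinarith [le_supp hs y]
    have := hQz hyQ
    simp only [Set.mem_ofPred_eq] at this
    rw [inner_sub_left, real_inner_smul_right, real_inner_smul_right, real_inner_comm,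
        real_inner_comm y o] at this
    linarith

/-! ### Infinitesimal perturbations -/

/-- The points from which the curve `γ` starts into `K`. -/
def Ev (K : Set E3) (γ : ℝ → E3) : Set E3 := {x | ∀ᶠ ε in 𝓝[>] (0 : ℝ), x + γ ε ∈ K}

lemma mem_Ev {K : Set E3} {γ : ℝ → E3} {x : E3} :
    x ∈ Ev K γ ↔ ∀ᶠ ε in 𝓝[>] (0 : ℝ), x + γ ε ∈ K := Iff.rfl

lemma poly_neg {A B C D : ℝ}
    (h : A < 0 ∨ A = 0 ∧ (B < 0 ∨ B = 0 ∧ (C < 0 ∨ C = 0 ∧ D < 0))) :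
    ∀ᶠ ε in 𝓝[>] (0 : ℝ), A + ε * B + ε ^ 2 * C + ε ^ 3 * D < 0 := by
  have lead : ∀ {a : ℝ} {g : ℝ → ℝ}, Continuous g → g 0 = a → a < 0 →
      ∀ᶠ ε in 𝓝[>] (0 : ℝ), g ε < 0 := by
    intro a g hg h0 ha
    have := (hg.tendsto 0).mono_left (nhdsWithin_le_nhds (s := Set.Ioi 0))
    exact this.eventually (gt_mem_nhds (h0 ▸ ha))
  rcases h with h | ⟨rfl, h | ⟨rfl, h | ⟨rfl, h⟩⟩⟩
  · exact lead (by fun_prop) (by simp) h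
  · filter_upwards [lead (a := B) (g := fun ε => B + ε * C + ε ^ 2 * D) (by fun_prop) (by simp) h,
      self_mem_nhdsWithin] with ε h1 (h2 : 0 < ε)
    have := mul_neg_of_pos_of_neg h2 h1
    linarith
  · filter_upwards [lead (a := C) (g := fun ε => C + ε * D) (by fun_prop) (by simp) h,
      self_mem_nhdsWithin] with ε h1 (h2 : 0 < ε)
    have := mul_neg_of_pos_of_neg (pow_pos h2 2) h1
    linarith
  · filter_upwards [self_mem_nhdsWithin] with ε (h2 : 0 < ε)
    have := mul_neg_of_pos_of_neg (pow_pos h2 3) h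
    linarith

lemma poly_pos {A B C D : ℝ}
    (h : 0 < A ∨ A = 0 ∧ (0 < B ∨ B = 0 ∧ (0 < C ∨ C = 0 ∧ 0 < D))) :
    ∀ᶠ ε in 𝓝[>] (0 : ℝ), 0 < A + ε * B + ε ^ 2 * C + ε ^ 3 * D := by
  have := poly_neg (A := -A) (B := -B) (C := -C) (D := -D) (by simpa using h)
  filter_upwards [this] with ε h
  linarith

/-- A polynomial curve from the origin, moving first in direction `u₁`, then `u₂`, then `u₃`. -/
def curve (u₁ u₂ u₃ : E3) (ε : ℝ) : E3 := ε • u₁ + ε ^ 2 • u₂ + ε ^ 3 • u₃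

lemma inner_curve (y u₁ u₂ u₃ : E3) (ε : ℝ) :
    ⟪y, curve u₁ u₂ u₃ ε⟫ = ε * ⟪y, u₁⟫ + ε ^ 2 * ⟪y, u₂⟫ + ε ^ 3 * ⟪y, u₃⟫ := by
  simp [curve, inner_add_right, inner_smul_right]

/-- Let the curve `γ` run in a hyperplane orthogonal to `n`, and perturb it by a smaller
displacement against `n`. The perturbed curve runs in the polyhedron `K` exactly if `γ` does so
without running in the face of `K` that is lowest in direction `n`. -/
lemma ev_perturb_iff {N : Finset (E3 × ℝ)} {K : Set E3} (hK : ∀ z, z ∈ K ↔ ∀ q ∈ N, ⟪q.1, z⟫ ≤ q.2)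
    {x n : E3} {γ : ℝ → E3} {ρ : ℝ → ℝ} (hn : ⟪n, n⟫ = 1) (hnγ : ∀ ε, ⟪n, γ ε⟫ = 0)
    (hρ : ∀ ε, 0 < ε → 0 < ρ ε)
    (htri : ∀ (y : E3) (b : ℝ),
      (∀ᶠ ε in 𝓝[>] (0 : ℝ), ⟪y, x + γ ε⟫ < b ∧ ⟪y, x + (γ ε - ρ ε • n)⟫ < b) ∨
      (∀ᶠ ε in 𝓝[>] (0 : ℝ), b < ⟪y, x + γ ε⟫ ∧ b < ⟪y, x + (γ ε - ρ ε • n)⟫) ∨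
      ((∀ ε, ⟪y, γ ε⟫ = 0) ∧ ⟪y, x⟫ = b ∧ ∀ w ∈ K, ⟪y, w - x⟫ = ⟪n, w - x⟫ * ⟪y, n⟫)) :
    x ∈ Ev K (fun ε => γ ε - ρ ε • n) ↔ x ∈ Ev K γ ∧ x ∉ Ev (supportFace K (-n)) γ := by
  simp only [mem_Ev]
  constructor
  · intro h
    refine ⟨?_, fun hF => ?_⟩
    · have : ∀ᶠ ε in 𝓝[>] (0 : ℝ), ∀ q ∈ N, ⟪q.1, x + γ ε⟫ ≤ q.2 := by
        refine (Finset.eventually_all N).2 fun q hq => ?_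
        rcases htri q.1 q.2 with h1 | h1 | ⟨h1, h2, -⟩
        · exact h1.mono fun ε h => h.1.le
        · obtain ⟨ε, e1, e2⟩ := (h1.and h).exists
          exact absurd ((hK _).1 e2 q hq) (not_le.2 e1.2)
        · exact Eventually.of_forall fun ε => by rw [inner_add_right, h1, h2, add_zero]
      exact this.mono fun ε h => (hK _).2 h
    · obtain ⟨ε, ⟨e1, e2⟩, hε⟩ := (h.and hF |>.and self_mem_nhdsWithin).exists
      have := e2.2 _ e1
      rw [inner_add_right, inner_add_right, inner_sub_right, inner_smul_right, inner_neg_left n n,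
        hn] at this
      linarith [hρ ε hε]
  · rintro ⟨h, hF⟩
    have hw : ∃ w ∈ K, ⟪n, w⟫ < ⟪n, x⟫ := by
      by_contra! hw
      apply hF
      refine Eventually.mono h fun ε hε => ⟨hε, fun w hwK => ?_⟩
      rw [inner_neg_left, inner_neg_left, inner_add_right, hnγ]
      linarith [hw w hwK]
    obtain ⟨w, hwK, hw⟩ := hw
    have : ∀ᶠ ε in 𝓝[>] (0 : ℝ), ∀ q ∈ N, ⟪q.1, x + (γ ε - ρ ε • n)⟫ ≤ q.2 := by
      refine (Finset.eventually_all N).2 fun q hq => ?_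
      rcases htri q.1 q.2 with h1 | h1 | ⟨h1, h2, h3⟩
      · exact h1.mono fun ε h => h.2.le
      · obtain ⟨ε, e1, e2⟩ := (h1.and h).exists
        exact absurd ((hK _).1 e2 q hq) (not_le.2 e1.1)
      · filter_upwards [self_mem_nhdsWithin] with ε hε
        have e1 := (hK w).1 hwK q hq
        have e2 := h3 w hwK
        rw [inner_sub_right, inner_sub_right] at e2
        have e3 : 0 ≤ ⟪q.1, n⟫ := by nlinarith
        rw [inner_add_right, inner_sub_right, h1, h2, inner_smul_right]
        nlinarith [hρ ε hε]
    exact this.mono fun ε h => (hK _).2 h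

open Classical in
lemma indicator_perturb {K F : Set E3} {γ η : ℝ → E3} {x : E3} (hFK : F ⊆ K)
    (h : x ∈ Ev K η ↔ x ∈ Ev K γ ∧ x ∉ Ev F γ) :
    (Ev K η).indicator (1 : E3 → ℝ≥0∞) x + (Ev F γ).indicator 1 x = (Ev K γ).indicator 1 x := by
  have hFK' : x ∈ Ev F γ → x ∈ Ev K γ := fun h => (mem_Ev.1 h).mono fun _ h => hFK h
  simp only [Set.indicator_apply, h, Pi.one_apply]
  by_cases h1 : x ∈ Ev F γ
  · simp [h1, hFK' h1]
  · simp [h1]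

lemma supportFace_subset (K : Set E3) (n : E3) : supportFace K n ⊆ K := fun _ h => h.1

/-- Changing the direction of the last displacement exchanges a face for the opposite one. -/
lemma indicator_facet {N : Finset (E3 × ℝ)} {K : Set E3}
    (hK : ∀ z, z ∈ K ↔ ∀ q ∈ N, ⟪q.1, z⟫ ≤ q.2) {u₁ u₂ n : E3} (h : ON3 u₁ u₂ n) (x : E3) :
    (Ev K (curve u₁ u₂ (-n))).indicator (1 : E3 → ℝ≥0∞) x +
      (Ev (supportFace K (-n)) (curve u₁ u₂ 0)).indicator 1 x =
        (Ev K (curve u₁ u₂ 0)).indicator 1 x := by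
  have e : curve u₁ u₂ (-n) = fun ε => curve u₁ u₂ 0 ε - ε ^ 3 • n := by
    ext1 ε; simp [curve, sub_eq_add_neg]
  apply indicator_perturb (supportFace_subset _ _)
  rw [e]
  refine ev_perturb_iff hK h.hw (fun ε => by rw [inner_curve, h.hwu, h.hwv]; simp)
    (fun ε hε => pow_pos hε 3) fun y b => ?_
  have i1 : ∀ ε, ⟪y, x + curve u₁ u₂ 0 ε⟫ = ⟪y, x⟫ + ε * ⟪y, u₁⟫ + ε ^ 2 * ⟪y, u₂⟫ + ε ^ 3 * 0 := by
    intro ε; rw [inner_add_right, inner_curve, inner_zero_right]; ring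
  have i2 : ∀ ε : ℝ, ⟪y, x + (curve u₁ u₂ 0 ε - ε ^ 3 • n)⟫ =
      ⟪y, x⟫ + ε * ⟪y, u₁⟫ + ε ^ 2 * ⟪y, u₂⟫ + ε ^ 3 * (-⟪y, n⟫) := by
    intro ε; rw [← add_sub_assoc, inner_sub_right, i1, inner_smul_right]; ring
  by_cases h0 : ⟪y, x⟫ - b = 0 ∧ ⟪y, u₁⟫ = 0 ∧ ⟪y, u₂⟫ = 0
  · obtain ⟨h0, h1, h2⟩ := h0
    refine Or.inr (Or.inr ⟨fun ε => by rw [inner_curve, h1, h2]; simp, by linarith, fun w _ => ?_⟩)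
    conv_lhs => rw [h.expand (w - x)]
    rw [inner_add_right, inner_add_right, inner_smul_right, inner_smul_right, inner_smul_right,
      h1, h2]
    ring
  · by_cases hneg : ⟪y, x⟫ - b < 0 ∨ ⟪y, x⟫ - b = 0 ∧ (⟪y, u₁⟫ < 0 ∨ ⟪y, u₁⟫ = 0 ∧ ⟪y, u₂⟫ < 0)
    · refine Or.inl ?_
      filter_upwards [poly_neg (A := ⟪y, x⟫ - b) (B := ⟪y, u₁⟫) (C := ⟪y, u₂⟫) (D := 0) (by tauto),
        poly_neg (A := ⟪y, x⟫ - b) (B := ⟪y, u₁⟫) (C := ⟪y, u₂⟫) (D := -⟪y, n⟫) (by tauto)]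
        with ε e1 e2
      rw [i1, i2]
      constructor <;> linarith
    · have hpos : 0 < ⟪y, x⟫ - b ∨ ⟪y, x⟫ - b = 0 ∧
          (0 < ⟪y, u₁⟫ ∨ ⟪y, u₁⟫ = 0 ∧ 0 < ⟪y, u₂⟫) := by
        rcases lt_trichotomy (⟪y, x⟫ - b) 0 with a | a | a <;>
        rcases lt_trichotomy ⟪y, u₁⟫ 0 with a' | a' | a' <;>
        rcases lt_trichotomy ⟪y, u₂⟫ 0 with a'' | a'' | a'' <;> tauto
      refine Or.inr (Or.inl ?_)
      filter_upwards [poly_pos (A := ⟪y, x⟫ - b) (B := ⟪y, u₁⟫) (C := ⟪y, u₂⟫) (D := 0) (by tauto),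
        poly_pos (A := ⟪y, x⟫ - b) (B := ⟪y, u₁⟫) (C := ⟪y, u₂⟫) (D := -⟪y, n⟫) (by tauto)]
        with ε e1 e2
      rw [i1, i2]
      constructor <;> linarith

/-- The analogue of `indicator_facet` for a polyhedron in a plane orthogonal to `n`. -/
lemma indicator_edge {N : Finset (E3 × ℝ)} {K : Set E3}
    (hK : ∀ z, z ∈ K ↔ ∀ q ∈ N, ⟪q.1, z⟫ ≤ q.2) {e m n : E3} (h : ON3 e m n) {c : ℝ}
    (hKn : ∀ z ∈ K, ⟪n, z⟫ = c) (x : E3) :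
    (Ev K (curve e (-m) 0)).indicator (1 : E3 → ℝ≥0∞) x +
      (Ev (supportFace K (-m)) (curve e 0 0)).indicator 1 x =
        (Ev K (curve e 0 0)).indicator 1 x := by
  have e' : curve e (-m) 0 = fun ε => curve e 0 0 ε - ε ^ 2 • m := by
    ext1 ε; simp [curve, sub_eq_add_neg]
  apply indicator_perturb (supportFace_subset _ _)
  rw [e']
  by_cases hx : ⟪n, x⟫ = c
  · refine ev_perturb_iff hK h.hv (fun ε => by rw [inner_curve, h.hvu]; simp)
      (fun ε hε => pow_pos hε 2) fun y b => ?_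
    have i1 : ∀ ε, ⟪y, x + curve e 0 0 ε⟫ = ⟪y, x⟫ + ε * ⟪y, e⟫ + ε ^ 2 * 0 + ε ^ 3 * 0 := by
      intro ε; rw [inner_add_right, inner_curve, inner_zero_right]; ring
    have i2 : ∀ ε : ℝ, ⟪y, x + (curve e 0 0 ε - ε ^ 2 • m)⟫ =
        ⟪y, x⟫ + ε * ⟪y, e⟫ + ε ^ 2 * (-⟪y, m⟫) + ε ^ 3 * 0 := by
      intro ε; rw [← add_sub_assoc, inner_sub_right, i1, inner_smul_right]; ring
    by_cases h0 : ⟪y, x⟫ - b = 0 ∧ ⟪y, e⟫ = 0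
    · obtain ⟨h0, h1⟩ := h0
      refine Or.inr (Or.inr ⟨fun ε => by rw [inner_curve, h1]; simp, by linarith, fun w hw => ?_⟩)
      conv_lhs => rw [h.expand (w - x)]
      rw [inner_add_right, inner_add_right, inner_smul_right, inner_smul_right, inner_smul_right,
        h1, inner_sub_right n, hKn w hw, hx]
      ring
    · by_cases hneg : ⟪y, x⟫ - b < 0 ∨ ⟪y, x⟫ - b = 0 ∧ ⟪y, e⟫ < 0
      · refine Or.inl ?_
        filter_upwards [poly_neg (A := ⟪y, x⟫ - b) (B := ⟪y, e⟫) (C := 0) (D := 0) (by tauto),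
          poly_neg (A := ⟪y, x⟫ - b) (B := ⟪y, e⟫) (C := -⟪y, m⟫) (D := 0) (by tauto)]
          with ε e1 e2
        rw [i1, i2]
        constructor <;> linarith
      · have hpos : 0 < ⟪y, x⟫ - b ∨ ⟪y, x⟫ - b = 0 ∧ 0 < ⟪y, e⟫ := by
          rcases lt_trichotomy (⟪y, x⟫ - b) 0 with a | a | a <;>
          rcases lt_trichotomy ⟪y, e⟫ 0 with a' | a' | a' <;> tauto
        refine Or.inr (Or.inl ?_)
        filter_upwards [poly_pos (A := ⟪y, x⟫ - b) (B := ⟪y, e⟫) (C := 0) (D := 0) (by tauto),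
          poly_pos (A := ⟪y, x⟫ - b) (B := ⟪y, e⟫) (C := -⟪y, m⟫) (D := 0) (by tauto)]
          with ε e1 e2
        rw [i1, i2]
        constructor <;> linarith
  · -- off the plane of `K` neither curve meets `K`
    have hno : ∀ γ : ℝ → E3, (∀ ε, ⟪n, γ ε⟫ = 0) → x ∉ Ev K γ := by
      intro γ hγ hev
      obtain ⟨ε, hε⟩ := (mem_Ev.1 hev).exists
      apply hx
      rw [← hKn _ hε, inner_add_right, hγ, add_zero]
    have h1 := hno (curve e 0 0) fun ε => by rw [inner_curve, h.hwu]; simp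
    have h2 := hno (fun ε => curve e 0 0 ε - ε ^ 2 • m) fun ε => by
      rw [inner_sub_right, inner_curve, h.hwu, inner_smul_right, h.hwv]; simp
    tauto

/-! ### Multiple tilings -/

/-- The sum of the translates `g (· - v)`, weighted by the multiplicities `Λ v`. -/
noncomputable def cov (Λ : E3 → ℕ) (g : E3 → ℝ≥0∞) (x : E3) : ℝ≥0∞ := ∑' v, (Λ v : ℝ≥0∞) * g (x - v)

lemma cov_add (Λ : E3 → ℕ) (g h : E3 → ℝ≥0∞) (x : E3) :
    cov Λ (fun y => g y + h y) x = cov Λ g x + cov Λ h x := by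
  simp only [cov, mul_add, ENNReal.tsum_add]

/-- The part of the definition of a multiple tiling that says that `Λ` is locally finite. -/
def LocFin (Λ : E3 → ℕ) : Prop :=
  ∀ R : ℝ, (Function.support Λ ∩ Metric.closedBall 0 R).Finite

lemma LocFin.near {Λ : E3 → ℕ} (h : LocFin Λ) (x : E3) (R : ℝ) :
    {v | Λ v ≠ 0 ∧ ‖x - v‖ ≤ R}.Finite := by
  refine (h (‖x‖ + R)).subset fun v hv => ⟨hv.1, ?_⟩
  rw [mem_closedBall_zero_iff]
  have := norm_sub_norm_le v x
  rw [norm_sub_rev] at this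
  linarith [hv.2]

lemma LocFin.countable {Λ : E3 → ℕ} (h : LocFin Λ) : (Function.support Λ).Countable := by
  have : Function.support Λ = ⋃ n : ℕ, Function.support Λ ∩ Metric.closedBall 0 n := by
    ext v
    simp only [Set.mem_iUnion, Set.mem_inter_iff, mem_closedBall_zero_iff]
    exact ⟨fun hv => ⟨⌈‖v‖⌉₊, hv, Nat.le_ceil _⟩, fun ⟨_, hv, _⟩ => hv⟩
  rw [this]
  exact Set.countable_iUnion fun n => (h n).countable

lemma LocFin.cov_eq_sum {Λ : E3 → ℕ} (h : LocFin Λ) {B : Set E3} {R : ℝ}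
    (hB : ∀ y ∈ B, ‖y‖ ≤ R) {x : E3} {R' : ℝ} {w : E3} (hw : ‖w - x‖ + R ≤ R') :
    cov Λ (B.indicator 1) w =
      ∑ v ∈ (h.near x R').toFinset, (Λ v : ℝ≥0∞) * B.indicator 1 (w - v) := by
  refine tsum_eq_sum fun v hv => ?_
  rw [Set.Finite.mem_toFinset, Set.mem_ofPred_eq] at hv
  by_cases h0 : Λ v = 0
  · simp [h0]
  · rw [Set.indicator_of_notMem, mul_zero]
    intro hmem
    apply hv
    refine ⟨h0, ?_⟩
    have h1 := hB _ hmem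
    have : x - v = (w - v) - (w - x) := by abel
    rw [this]
    linarith [norm_sub_le (w - v) (w - x)]

lemma LocFin.cov_ne_top {Λ : E3 → ℕ} (h : LocFin Λ) {B : Set E3} {R : ℝ}
    (hB : ∀ y ∈ B, ‖y‖ ≤ R) (x : E3) : cov Λ (B.indicator 1) x ≠ ⊤ := by
  rw [h.cov_eq_sum hB (x := x) (R' := R) (by simp)]
  refine ENNReal.sum_ne_top.2 fun v _ => ENNReal.mul_ne_top (by simp) ?_
  classical
  rw [Set.indicator_apply]
  split_ifs <;> simp

lemma ae_cov_eq {k : ℕ} {P : Set E3} {Λ : E3 → ℕ} (h : IsMultipleTiling k P Λ) :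
    ∀ᵐ x : E3, cov Λ (P.indicator 1) x = k := by
  filter_upwards [h.2] with x hx
  rw [← hx]
  refine tsum_congr fun v => ?_
  congr 1
  classical
  simp only [Set.indicator_apply, Set.mem_vadd_set_iff_neg_vadd_mem, vadd_eq_add, neg_add_eq_sub,
    Pi.one_apply]

lemma volume_ne_zero_of_tiling {k : ℕ} (hk : 0 < k) {P : Set E3} {Λ : E3 → ℕ}
    (h : IsMultipleTiling k P Λ) : volume P ≠ 0 := by
  intro h0
  have hc := LocFin.countable h.1
  have h1 : ∀ᵐ x : E3, ∀ v ∈ Function.support Λ, x - v ∉ P := by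
    rw [ae_ball_iff hc]
    intro v _
    have : volume ((fun x : E3 => x - v) ⁻¹' P) = 0 := by
      rw [(measurePreserving_sub_right volume v).measure_preimage (NullMeasurableSet.of_null h0), h0]
    exact measure_eq_zero_iff_ae_notMem.1 this
  obtain ⟨x, hx1, hx2⟩ := (h1.and (ae_cov_eq h)).exists
  rw [cov, ENNReal.tsum_eq_zero.2] at hx2
  · exact hk.ne (by exact_mod_cast hx2)
  · intro v
    by_cases hv : v ∈ Function.support Λ
    · simp [hx1 v hv]
    · rw [Function.notMem_support] at hv
      simp [hv]

lemma tendsto_curve (u₁ u₂ u₃ : E3) : Tendsto (curve u₁ u₂ u₃) (𝓝[>] 0) (𝓝 0) := by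
  have : Continuous (curve u₁ u₂ u₃) := by unfold curve; fun_prop
  have h := (this.tendsto 0).mono_left (nhdsWithin_le_nhds (s := Set.Ioi 0))
  simpa [curve] using h

lemma ev_interior_or {N : Finset (E3 × ℝ)} {P : Set E3} (hN : ∀ q ∈ N, q.1 ≠ 0)
    (hP : ∀ z, z ∈ P ↔ ∀ q ∈ N, ⟪q.1, z⟫ ≤ q.2) {u₁ u₂ u₃ : E3} (h : ON3 u₁ u₂ u₃) (x : E3) :
    (∀ᶠ ε in 𝓝[>] (0 : ℝ), x + curve u₁ u₂ u₃ ε ∈ interior P) ∨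
      ∀ᶠ ε in 𝓝[>] (0 : ℝ), x + curve u₁ u₂ u₃ ε ∉ P := by
  have key : ∀ q ∈ N, (∀ᶠ ε in 𝓝[>] (0 : ℝ), ⟪q.1, x + curve u₁ u₂ u₃ ε⟫ < q.2) ∨
      ∀ᶠ ε in 𝓝[>] (0 : ℝ), q.2 < ⟪q.1, x + curve u₁ u₂ u₃ ε⟫ := by
    intro q hq
    have hne : ¬ (⟪q.1, u₁⟫ = 0 ∧ ⟪q.1, u₂⟫ = 0 ∧ ⟪q.1, u₃⟫ = 0) := by
      rintro ⟨h1, h2, h3⟩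
      apply hN q hq
      rw [h.expand q.1, real_inner_comm, h1, real_inner_comm, h2, real_inner_comm, h3]
      simp
    by_cases hneg : ⟪q.1, x⟫ - q.2 < 0 ∨ ⟪q.1, x⟫ - q.2 = 0 ∧ (⟪q.1, u₁⟫ < 0 ∨ ⟪q.1, u₁⟫ = 0 ∧
        (⟪q.1, u₂⟫ < 0 ∨ ⟪q.1, u₂⟫ = 0 ∧ ⟪q.1, u₃⟫ < 0))
    · refine Or.inl ((poly_neg hneg).mono fun ε e => ?_)
      rw [inner_add_right, inner_curve]
      linarith
    · refine Or.inr ((poly_pos (A := ⟪q.1, x⟫ - q.2) (B := ⟪q.1, u₁⟫) (C := ⟪q.1, u₂⟫)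
        (D := ⟪q.1, u₃⟫) ?_).mono fun ε e => ?_)
      · rcases lt_trichotomy (⟪q.1, x⟫ - q.2) 0 with a | a | a <;>
        rcases lt_trichotomy ⟪q.1, u₁⟫ 0 with a' | a' | a' <;>
        rcases lt_trichotomy ⟪q.1, u₂⟫ 0 with a'' | a'' | a'' <;>
        rcases lt_trichotomy ⟪q.1, u₃⟫ 0 with a3 | a3 | a3 <;> tauto
      · rw [inner_add_right, inner_curve]
        linarith
  by_cases hall : ∀ q ∈ N, ∀ᶠ ε in 𝓝[>] (0 : ℝ), ⟪q.1, x + curve u₁ u₂ u₃ ε⟫ < q.2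
  · refine Or.inl (((Finset.eventually_all N).2 hall).mono fun ε hε => ?_)
    have hopen : IsOpen (⋂ q ∈ N, {z : E3 | ⟪q.1, z⟫ < q.2}) :=
      isOpen_biInter_finset fun q _ => isOpen_lt (by fun_prop) continuous_const
    refine interior_maximal (t := ⋂ q ∈ N, {z : E3 | ⟪q.1, z⟫ < q.2}) ?_ hopen ?_
    · intro z hz
      simp only [Set.mem_iInter] at hz
      exact (hP z).2 fun q hq => (hz q hq).le
    · simpa using hε
  · simp only [not_forall] at hall
    obtain ⟨q, hq, hn⟩ := hall
    refine Or.inr (((key q hq).resolve_left hn).mono fun ε hε hmem => ?_)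
    exact absurd ((hP _).1 hmem q hq) (not_le.2 hε)

/-- Along a generic infinitesimal displacement the covering number of a multiple tiling is defined
at every point, and equals the multiplicity. -/
lemma cov_ev_eq {N : Finset (E3 × ℝ)} {P : Set E3} (hN : ∀ q ∈ N, q.1 ≠ 0)
    (hP : ∀ z, z ∈ P ↔ ∀ q ∈ N, ⟪q.1, z⟫ ≤ q.2) (hc : IsClosed P) {R : ℝ} (hR : ∀ y ∈ P, ‖y‖ ≤ R)
    {k : ℕ} {Λ : E3 → ℕ} (ht : IsMultipleTiling k P Λ) {u₁ u₂ u₃ : E3} (h : ON3 u₁ u₂ u₃) (x : E3) :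
    cov Λ ((Ev P (curve u₁ u₂ u₃)).indicator 1) x = k := by
  have hΛ : LocFin Λ := ht.1
  set γ := curve u₁ u₂ u₃
  have hγ := tendsto_curve u₁ u₂ u₃
  have hER : ∀ y ∈ Ev P γ, ‖y‖ ≤ R + 1 := by
    intro y hy
    obtain ⟨ε, h1, h2⟩ := ((mem_Ev.1 hy).and
      (hγ.eventually (Metric.ball_mem_nhds 0 one_pos))).exists
    have h3 : ‖γ ε‖ < 1 := by simpa using h2
    have := norm_sub_le (y + γ ε) (γ ε)
    rw [add_sub_cancel_right] at this
    linarith [hR _ h1]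
  set F := (hΛ.near x (R + 1)).toFinset
  have hdec : ∀ᶠ ε in 𝓝[>] (0 : ℝ), ∀ v ∈ F, (x - v ∈ Ev P γ → x - v + γ ε ∈ interior P) ∧
      (x - v ∉ Ev P γ → x - v + γ ε ∉ P) := by
    refine (Finset.eventually_all F).2 fun v _ => ?_
    rcases ev_interior_or hN hP h (x - v) with h1 | h1
    · have h2 : x - v ∈ Ev P γ := mem_Ev.2 (h1.mono fun ε h => interior_subset h)
      exact h1.mono fun ε h => ⟨fun _ => h, fun h' => absurd h2 h'⟩
    · have h2 : x - v ∉ Ev P γ := fun h' => by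
        obtain ⟨ε, e1, e2⟩ := (h1.and (mem_Ev.1 h')).exists
        exact e1 e2
      exact h1.mono fun ε h => ⟨fun h' => absurd h' h2, fun _ => h⟩
  obtain ⟨ε, hε, hε1⟩ := (hdec.and (hγ.eventually (Metric.ball_mem_nhds 0 one_pos))).exists
  have hU : ∀ᶠ w in 𝓝 (x + γ ε), ‖w - x‖ ≤ 1 ∧
      ∀ v ∈ F, (w - v ∈ P ↔ x - v ∈ Ev P γ) := by
    apply Eventually.and
    · have : Tendsto (fun w : E3 => ‖w - x‖) (𝓝 (x + γ ε)) (𝓝 ‖x + γ ε - x‖) :=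
        Continuous.tendsto (by fun_prop) _
      rw [add_sub_cancel_left] at this
      exact (this.eventually (gt_mem_nhds (by simpa using hε1))).mono fun _ h => h.le
    · refine (Finset.eventually_all F).2 fun v hv => ?_
      have hcont : Tendsto (fun w : E3 => w - v) (𝓝 (x + γ ε)) (𝓝 (x - v + γ ε)) := by
        have : x - v + γ ε = x + γ ε - v := by abel
        rw [this]
        exact Continuous.tendsto (by fun_prop) _
      by_cases hv' : x - v ∈ Ev P γ
      · filter_upwards [hcont.eventually (isOpen_interior.mem_nhds ((hε v hv).1 hv'))] with w hw
        simp [hv', interior_subset hw]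
      · filter_upwards [hcont.eventually (hc.isOpen_compl.mem_nhds ((hε v hv).2 hv'))] with w hw
        simpa [hv'] using hw
  obtain ⟨U, hU1, hU2, hU3⟩ := eventually_nhds_iff.1 hU
  have hpos : volume U ≠ 0 := (hU2.measure_pos volume ⟨_, hU3⟩).ne'
  obtain ⟨w, hwU, hw⟩ : ∃ w ∈ U, cov Λ (P.indicator 1) w = k := by
    by_contra! hno
    apply hpos
    refine measure_mono_null ?_ (ae_iff.1 (ae_cov_eq ht))
    exact fun w hw => hno w hw
  obtain ⟨h1, h2⟩ := hU1 w hwU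
  rw [← hw, hΛ.cov_eq_sum hER (x := x) (R' := R + 1) (by simp),
    hΛ.cov_eq_sum hR (x := x) (w := w) (R' := R + 1) (by linarith)]
  refine Finset.sum_congr rfl fun v hv => ?_
  classical
  simp only [Set.indicator_apply, h2 v hv, Pi.one_apply]

/-! ### Averaging -/

/-- A slowly decaying integrable weight. -/
noncomputable def wt (δ : ℝ) (x : E3) : ℝ≥0∞ := ENNReal.ofReal (((1 + δ * ‖x‖) ^ 4)⁻¹)

lemma measurable_wt (δ : ℝ) : Measurable (wt δ) := by unfold wt; fun_prop

lemma wt_le {δ R : ℝ} (hδ : 0 < δ) {v w : E3} (h : ‖v - w‖ ≤ R) :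
    wt δ v ≤ ENNReal.ofReal ((1 + δ * R) ^ 4) * wt δ w := by
  have hR : 0 ≤ R := (norm_nonneg _).trans h
  rw [wt, wt, ← ENNReal.ofReal_mul (by positivity)]
  apply ENNReal.ofReal_le_ofReal
  rw [← div_eq_mul_inv, le_div_iff₀ (by positivity), inv_mul_le_iff₀ (by positivity), ← mul_pow]
  gcongr
  have : ‖w‖ ≤ ‖v‖ + R := by
    have := norm_sub_norm_le w v
    rw [norm_sub_rev] at this
    linarith
  have h1 : δ * ‖w‖ ≤ δ * ‖v‖ + δ * R := by nlinarith
  have h2 : 0 ≤ (δ * ‖v‖) * (δ * R) := by positivity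
  nlinarith

lemma lintegral_wt_lt_top {δ : ℝ} (hδ : 0 < δ) : ∫⁻ x, wt δ x < ⊤ := by
  have h := finite_integral_one_add_norm (E := E3) (μ := volume) (r := 4) (by simp; norm_num)
  have h2 : ∀ x, wt δ x ≤ ENNReal.ofReal ((max 1 δ⁻¹) ^ 4) *
      ENNReal.ofReal ((1 + ‖x‖) ^ (-4 : ℝ)) := by
    intro x
    rw [wt, ← ENNReal.ofReal_mul (by positivity)]
    apply ENNReal.ofReal_le_ofReal
    rw [Real.rpow_neg (by positivity), show (4 : ℝ) = ((4 : ℕ) : ℝ) by norm_num,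
      Real.rpow_natCast, ← div_eq_mul_inv, le_div_iff₀ (by positivity),
      inv_mul_le_iff₀ (by positivity), ← mul_pow]
    gcongr
    have h1 : (1 : ℝ) ≤ max 1 δ⁻¹ := le_max_left _ _
    have h2 : 1 ≤ δ * max 1 δ⁻¹ := by
      rw [← mul_inv_cancel₀ hδ.ne']
      exact mul_le_mul_of_nonneg_left (le_max_right _ _) hδ.le
    nlinarith [norm_nonneg x]
  calc ∫⁻ x, wt δ x ≤ ∫⁻ x : E3, ENNReal.ofReal ((max 1 δ⁻¹) ^ 4) *
        ENNReal.ofReal ((1 + ‖x‖) ^ (-4 : ℝ)) := lintegral_mono h2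
    _ = ENNReal.ofReal ((max 1 δ⁻¹) ^ 4) * ∫⁻ x : E3, ENNReal.ofReal ((1 + ‖x‖) ^ (-4 : ℝ)) :=
        lintegral_const_mul' _ _ ENNReal.ofReal_ne_top
    _ < ⊤ := ENNReal.mul_lt_top ENNReal.ofReal_lt_top h

lemma lintegral_wt_cov {Λ : E3 → ℕ} (hΛ : LocFin Λ) {g : E3 → ℝ≥0∞} (hg : AEMeasurable g) (δ : ℝ) :
    ∫⁻ x, wt δ x * cov Λ g x = ∑' v, (Λ v : ℝ≥0∞) * ∫⁻ y, wt δ (y + v) * g y := by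
  have : Countable (Function.support Λ) := hΛ.countable.to_subtype
  have sub : ∀ f : E3 → ℝ≥0∞, (∑' v : Function.support Λ, (Λ v : ℝ≥0∞) * f v) =
      ∑' v, (Λ v : ℝ≥0∞) * f v := by
    intro f
    refine tsum_subtype_eq_of_support_subset (f := fun v => (Λ v : ℝ≥0∞) * f v) fun v hv h => ?_
    simp only [Function.mem_support, ne_eq, mul_eq_zero, not_or] at hv
    simp [h] at hv
  have hgv : ∀ v : E3, AEMeasurable fun x => g (x - v) := fun v =>
    hg.comp_quasiMeasurePreserving (measurePreserving_sub_right volume v).quasiMeasurePreserving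
  rw [← sub]
  calc ∫⁻ x, wt δ x * cov Λ g x
      = ∫⁻ x, ∑' v : Function.support Λ, (Λ v : ℝ≥0∞) * (wt δ x * g (x - v)) := by
        refine lintegral_congr fun x => ?_
        rw [cov, ← sub fun v => g (x - v), ← ENNReal.tsum_mul_left]
        exact tsum_congr fun v => by ring
    _ = ∑' v : Function.support Λ, ∫⁻ x, (Λ v : ℝ≥0∞) * (wt δ x * g (x - v)) :=
        lintegral_tsum fun v => ((measurable_wt δ).aemeasurable.mul (hgv v)).const_mul _
    _ = _ := by
        refine tsum_congr fun v => ?_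
        rw [lintegral_const_mul' _ _ (by simp)]
        congr 1
        rw [← lintegral_add_right_eq_self _ (v : E3)]
        simp

/-- Two functions of bounded support whose periodizations by `Λ` agree have the same integral:
compare averages with respect to weights varying ever more slowly. -/
lemma lintegral_eq_of_cov_eq {k : ℕ} (hk : 0 < k) {P : Set E3} {Λ : E3 → ℕ}
    (ht : IsMultipleTiling k P Λ) (hPm : MeasurableSet P) {R₀ : ℝ} (hR₀ : ∀ y ∈ P, ‖y‖ ≤ R₀)
    {g₁ g₂ : E3 → ℝ≥0∞} (hg₁ : AEMeasurable g₁) (hg₂ : AEMeasurable g₂) {R : ℝ}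
    (hR₁ : ∀ y, g₁ y ≠ 0 → ‖y‖ ≤ R) (hR₂ : ∀ y, g₂ y ≠ 0 → ‖y‖ ≤ R)
    (h : ∀ᵐ x, cov Λ g₁ x = cov Λ g₂ x) : ∫⁻ y, g₁ y = ∫⁻ y, g₂ y := by
  have hΛ : LocFin Λ := ht.1
  set W : ℝ → ℝ≥0∞ := fun δ => ∑' v, (Λ v : ℝ≥0∞) * wt δ v with hW
  have hC : ∀ δ R : ℝ, ENNReal.ofReal ((1 + δ * R) ^ 4) ≠ ⊤ := fun _ _ => ENNReal.ofReal_ne_top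
  have lower : ∀ {g : E3 → ℝ≥0∞} {R δ : ℝ}, AEMeasurable g → 0 < δ → (∀ y, g y ≠ 0 → ‖y‖ ≤ R) →
      W δ * ∫⁻ y, g y ≤ ENNReal.ofReal ((1 + δ * R) ^ 4) * ∫⁻ x, wt δ x * cov Λ g x := by
    intro g R δ hg hδ hR
    rw [lintegral_wt_cov hΛ hg, hW, ← ENNReal.tsum_mul_left, ← ENNReal.tsum_mul_right]
    refine ENNReal.tsum_le_tsum fun v => ?_
    rw [mul_assoc, mul_left_comm (ENNReal.ofReal _)]
    gcongr (Λ v : ℝ≥0∞) * ?_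
    rw [← lintegral_const_mul' _ _ (by simp [wt]), ← lintegral_const_mul' _ _ (hC _ _)]
    refine lintegral_mono fun y => ?_
    by_cases h0 : g y = 0
    · simp [h0]
    · rw [← mul_assoc]
      gcongr
      exact wt_le hδ (by simpa using hR y h0)
  have upper : ∀ {g : E3 → ℝ≥0∞} {R δ : ℝ}, AEMeasurable g → 0 < δ → (∀ y, g y ≠ 0 → ‖y‖ ≤ R) →
      ∫⁻ x, wt δ x * cov Λ g x ≤ ENNReal.ofReal ((1 + δ * R) ^ 4) * (W δ * ∫⁻ y, g y) := by
    intro g R δ hg hδ hR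
    rw [lintegral_wt_cov hΛ hg, hW, ← ENNReal.tsum_mul_right, ← ENNReal.tsum_mul_left]
    refine ENNReal.tsum_le_tsum fun v => ?_
    rw [mul_assoc, mul_left_comm (ENNReal.ofReal _)]
    gcongr (Λ v : ℝ≥0∞) * ?_
    rw [← lintegral_const_mul' _ _ (by simp [wt]), ← lintegral_const_mul' _ _ (hC _ _)]
    refine lintegral_mono fun y => ?_
    by_cases h0 : g y = 0
    · simp [h0]
    · rw [← mul_assoc]
      gcongr
      exact wt_le hδ (by simpa using hR y h0)
  have hWtop : ∀ δ, 0 < δ → W δ ≠ ⊤ := by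
    intro δ hδ htop
    have h1 := lower (g := P.indicator 1) (R := R₀)
      ((measurable_one.indicator hPm).aemeasurable) hδ fun y hy => hR₀ y (by
        by_contra hn; exact hy (Set.indicator_of_notMem hn _))
    rw [htop, lintegral_indicator_one hPm, ENNReal.top_mul (volume_ne_zero_of_tiling hk ht),
      top_le_iff] at h1
    have h2 : ∫⁻ x, wt δ x * cov Λ (P.indicator 1) x = ∫⁻ x, wt δ x * k :=
      lintegral_congr_ae ((ae_cov_eq ht).mono fun x hx => by simp only [hx])
    rw [h2, lintegral_mul_const' _ _ (by simp)] at h1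
    exact ENNReal.mul_ne_top (hC _ _)
      (ENNReal.mul_ne_top (lintegral_wt_lt_top hδ).ne (by simp)) h1
  have hW0 : ∀ δ, 0 < δ → W δ ≠ 0 := by
    intro δ hδ h0
    obtain ⟨x, hx⟩ := (ae_cov_eq ht).exists
    rw [hW, ENNReal.tsum_eq_zero] at h0
    have hz : ∀ v, Λ v = 0 := fun v => by
      have := h0 v
      rw [mul_eq_zero] at this
      rcases this with h | h
      · exact_mod_cast h
      · rw [wt, ENNReal.ofReal_eq_zero, ← not_lt] at h
        exact absurd (by positivity) h
    simp only [cov, hz, Nat.cast_zero, zero_mul, tsum_zero] at hx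
    exact hk.ne (by exact_mod_cast hx)
  have key : ∀ {g₁ g₂ : E3 → ℝ≥0∞}, AEMeasurable g₁ → AEMeasurable g₂ →
      (∀ y, g₁ y ≠ 0 → ‖y‖ ≤ R) → (∀ y, g₂ y ≠ 0 → ‖y‖ ≤ R) →
      (∀ᵐ x, cov Λ g₁ x = cov Λ g₂ x) → ∫⁻ y, g₁ y ≤ ∫⁻ y, g₂ y := by
    intro g₁ g₂ hg₁ hg₂ hR₁ hR₂ h
    have hle : ∀ᶠ δ in 𝓝[>] (0 : ℝ), ∫⁻ y, g₁ y ≤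
        ENNReal.ofReal ((1 + δ * R) ^ 4 * (1 + δ * R) ^ 4) * ∫⁻ y, g₂ y := by
      filter_upwards [self_mem_nhdsWithin] with δ (hδ : 0 < δ)
      have h2 : ∫⁻ x, wt δ x * cov Λ g₁ x = ∫⁻ x, wt δ x * cov Λ g₂ x :=
        lintegral_congr_ae (h.mono fun x hx => by simp only [hx])
      have h3 := (lower hg₁ hδ hR₁).trans ((mul_le_mul_right (h2.le.trans (upper hg₂ hδ hR₂)) _))
      rw [ENNReal.ofReal_mul (by positivity)]
      refine (ENNReal.mul_le_mul_iff_right (hW0 δ hδ) (hWtop δ hδ)).1 (h3.trans (le_of_eq ?_))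
      ring
    have hlim : Tendsto (fun δ : ℝ => ENNReal.ofReal ((1 + δ * R) ^ 4 * (1 + δ * R) ^ 4) *
        ∫⁻ y, g₂ y) (𝓝[>] 0) (𝓝 (1 * ∫⁻ y, g₂ y)) := by
      refine ENNReal.Tendsto.mul_const ?_ (Or.inl one_ne_zero)
      have : Continuous fun δ : ℝ => ENNReal.ofReal ((1 + δ * R) ^ 4 * (1 + δ * R) ^ 4) :=
        ENNReal.continuous_ofReal.comp (by fun_prop)
      simpa using (this.tendsto 0).mono_left (nhdsWithin_le_nhds (s := Set.Ioi 0))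
    rw [one_mul] at hlim
    exact ge_of_tendsto hlim hle
  exact le_antisymm (key hg₁ hg₂ hR₁ hR₂ h) (key hg₂ hg₁ hR₂ hR₁ (h.mono fun _ h => h.symm))

/-! ### Thickened faces -/

/-- The Minkowski sum of `B` and the segment from `0` to `n`. -/
def thick (B : Set E3) (n : E3) : Set E3 := {y | ∃ s ∈ Set.Icc (0 : ℝ) 1, y - s • n ∈ B}

/-- The Minkowski sum of `B` and the half-open segment from `0` to `n`. -/
def thickO (B : Set E3) (n : E3) : Set E3 := {y | ∃ s ∈ Set.Ico (0 : ℝ) 1, y - s • n ∈ B}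

lemma mem_thick {B : Set E3} {n y : E3} :
    y ∈ thick B n ↔ ∃ s ∈ Set.Icc (0 : ℝ) 1, y - s • n ∈ B := Iff.rfl

lemma mem_thickO {B : Set E3} {n y : E3} :
    y ∈ thickO B n ↔ ∃ s ∈ Set.Ico (0 : ℝ) 1, y - s • n ∈ B := Iff.rfl

lemma thickO_mono {A B : Set E3} (h : A ⊆ B) (n : E3) : thickO A n ⊆ thickO B n :=
  fun _ ⟨s, hs, hy⟩ => ⟨s, hs, h hy⟩

lemma thickO_subset_thick (B : Set E3) (n : E3) : thickO B n ⊆ thick B n :=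
  fun _ ⟨s, hs, hy⟩ => ⟨s, Set.Ico_subset_Icc_self hs, hy⟩

lemma norm_le_of_mem_thick {B : Set E3} {n : E3} (hn : ⟪n, n⟫ = 1) {R : ℝ} (h : ∀ y ∈ B, ‖y‖ ≤ R) :
    ∀ y ∈ thick B n, ‖y‖ ≤ R + 1 := by
  rintro y ⟨s, hs, hy⟩
  have h1 := h _ hy
  have hn' : ‖n‖ = 1 := by
    rw [real_inner_self_eq_norm_sq] at hn
    nlinarith [norm_nonneg n]
  have h2 : ‖s • n‖ ≤ 1 := by
    rw [norm_smul, hn', mul_one, Real.norm_eq_abs, abs_of_nonneg hs.1]; exact hs.2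
  have := norm_add_le (y - s • n) (s • n)
  rw [sub_add_cancel] at this
  linarith

lemma convex_thick {B : Set E3} (h : Convex ℝ B) (n : E3) : Convex ℝ (thick B n) := by
  rintro x ⟨s, hs, hx⟩ y ⟨t, ht, hy⟩ a b ha hb hab
  refine ⟨a * s + b * t, convex_Icc (0 : ℝ) 1 hs ht ha hb hab, ?_⟩
  have := h hx hy ha hb hab
  convert this using 1
  module

lemma cov_thickO {Λ : E3 → ℕ} {B : Set E3} {n : E3} (hn : ⟪n, n⟫ = 1) {c : ℝ}
    (hB : ∀ z ∈ B, ⟪n, z⟫ = c) (x : E3) :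
    cov Λ ((thickO B n).indicator 1) x =
      ∑' s : Set.Ico (0 : ℝ) 1, cov Λ (B.indicator 1) (x - (s : ℝ) • n) := by
  classical
  have key : ∀ y, (thickO B n).indicator (1 : E3 → ℝ≥0∞) y =
      ∑' s : Set.Ico (0 : ℝ) 1, B.indicator 1 (y - (s : ℝ) • n) := by
    intro y
    by_cases hy : y ∈ thickO B n
    · obtain ⟨s, hs, hys⟩ := hy
      rw [Set.indicator_of_mem (mem_thickO.2 ⟨s, hs, hys⟩), tsum_eq_single ⟨s, hs⟩]
      · rw [Set.indicator_of_mem hys, Pi.one_apply, Pi.one_apply]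
      · rintro ⟨t, ht⟩ hne
        refine Set.indicator_of_notMem (fun hyt => hne ?_) _
        have e1 := hB _ hys
        have e2 := hB _ hyt
        rw [inner_sub_right, inner_smul_right, hn] at e1 e2
        exact Subtype.ext (by simp only; linarith)
    · rw [Set.indicator_of_notMem hy, eq_comm, ENNReal.tsum_eq_zero]
      rintro ⟨s, hs⟩
      exact Set.indicator_of_notMem (fun h => hy ⟨s, hs, h⟩) _
  simp only [cov, key, ← ENNReal.tsum_mul_left]
  rw [ENNReal.tsum_comm]
  refine tsum_congr fun s => tsum_congr fun v => ?_
  rw [sub_right_comm]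

lemma ev_subset {K : Set E3} (hK : IsClosed K) {γ : ℝ → E3} (hγ : Tendsto γ (𝓝[>] 0) (𝓝 0)) :
    Ev K γ ⊆ K := by
  intro x hx
  have h := (tendsto_const_nhds (x := x)).add hγ
  rw [add_zero] at h
  exact hK.mem_of_tendsto h hx

lemma interior_subset_ev {K : Set E3} {γ : ℝ → E3} (hγ : Tendsto γ (𝓝[>] 0) (𝓝 0)) :
    interior K ⊆ Ev K γ := by
  intro x hx
  have h := (tendsto_const_nhds (x := x)).add hγ
  rw [add_zero] at h
  exact (h.eventually (isOpen_interior.mem_nhds hx)).mono fun _ h => interior_subset h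

lemma ev_thick_subset {F : Set E3} {n : E3} (hn : ⟪n, n⟫ = 1) {c : ℝ} (hF : ∀ z ∈ F, ⟪n, z⟫ = c)
    {γ : ℝ → E3} (hγ : ∀ ε, ⟪n, γ ε⟫ = 0) {j : ℕ} (hj : j ≠ 0) :
    Ev (thick F n) (fun ε => γ ε + ε ^ j • n) ⊆ thickO (Ev F γ) n := by
  intro x hx
  have key : ∀ᶠ ε in 𝓝[>] (0 : ℝ), (0 ≤ ⟪n, x⟫ - c + ε ^ j ∧ ⟪n, x⟫ - c + ε ^ j ≤ 1) ∧
      x - (⟪n, x⟫ - c) • n + γ ε ∈ F := by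
    refine (mem_Ev.1 hx).mono fun ε => ?_
    rintro ⟨s, hs, hy⟩
    have e := hF _ hy
    rw [inner_sub_right, inner_add_right, inner_add_right, hγ, inner_smul_right, inner_smul_right,
      hn] at e
    have es : s = ⟪n, x⟫ - c + ε ^ j := by linarith
    rw [← es]
    refine ⟨hs, ?_⟩
    convert hy using 1
    rw [es]
    module
  refine ⟨⟪n, x⟫ - c, ⟨?_, ?_⟩, mem_Ev.2 (key.mono fun ε h => h.2)⟩
  · have hc : Continuous fun ε : ℝ => ⟪n, x⟫ - c + ε ^ j := by fun_prop
    have h1 : Tendsto (fun ε : ℝ => ⟪n, x⟫ - c + ε ^ j) (𝓝[>] 0) (𝓝 (⟪n, x⟫ - c + 0 ^ j)) :=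
      (hc.tendsto 0).mono_left nhdsWithin_le_nhds
    rw [zero_pow hj, add_zero] at h1
    exact ge_of_tendsto h1 (key.mono fun ε h => h.1.1)
  · obtain ⟨ε, h1, h2⟩ := (key.and self_mem_nhdsWithin).exists
    have : 0 < ε ^ j := pow_pos h2 j
    linarith [h1.1.2]

lemma ae_eq_of_interior_subset {A C : Set E3} (hC : Convex ℝ C) (h1 : interior C ⊆ A) (h2 : A ⊆ C) :
    A =ᵐ[volume] C := by
  have h := hC.addHaar_frontier volume
  refine (LE.le.eventuallyLE h2).antisymm ?_
  rw [ae_le_set]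
  refine measure_mono_null (fun x hx => ?_) h
  exact ⟨subset_closure hx.1, fun hi => hx.2 (h1 hi)⟩

/-! ### Volume relations between opposite faces -/

lemma mem_supportFace_iff {S : Finset E3} (hS : S.Nonempty) {n z : E3} :
    z ∈ supportFace (convexHull ℝ (S : Set E3)) n ↔
      z ∈ convexHull ℝ (S : Set E3) ∧ ⟪n, z⟫ = supp S n := by
  constructor
  · rintro ⟨h1, h2⟩
    refine ⟨h1, le_antisymm ((mem_convexHull_iff_supp hS).1 h1 n) ?_⟩
    exact supp_le hS fun s hs => h2 s (subset_convexHull ℝ _ hs)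
  · rintro ⟨h1, h2⟩
    exact ⟨h1, fun y hy => h2 ▸ (mem_convexHull_iff_supp hS).1 hy n⟩

section

variable {S : Finset E3} {k : ℕ} {Λ : E3 → ℕ}

lemma nonempty_of_tiling (hk : 0 < k) (ht : IsMultipleTiling k (convexHull ℝ (S : Set E3)) Λ) :
    S.Nonempty := by
  by_contra h
  rw [Finset.not_nonempty_iff_eq_empty] at h
  apply volume_ne_zero_of_tiling hk ht
  simp [h]

lemma interior_nonempty_of_tiling (hk : 0 < k)
    (ht : IsMultipleTiling k (convexHull ℝ (S : Set E3)) Λ) :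
    (interior (convexHull ℝ (S : Set E3))).Nonempty := by
  by_contra h
  rw [Set.not_nonempty_iff_eq_empty] at h
  apply volume_ne_zero_of_tiling hk ht
  have := (convex_convexHull ℝ (S : Set E3)).addHaar_frontier volume
  rwa [frontier, h, Set.sdiff_empty, (S.finite_toSet.isClosed_convexHull ℝ).closure_eq] at this

lemma exists_norm_le_convexHull (S : Finset E3) :
    ∃ R, ∀ y ∈ convexHull ℝ (S : Set E3), ‖y‖ ≤ R :=
  isBounded_iff_forall_norm_le.1 (S.finite_toSet.isCompact_convexHull ℝ).isBounded

/-- Opposite facets are covered equally often, at every point. -/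
lemma cov_facet (hk : 0 < k) (ht : IsMultipleTiling k (convexHull ℝ (S : Set E3)) Λ)
    {u₁ u₂ n : E3} (h : ON3 u₁ u₂ n) (x : E3) :
    cov Λ ((Ev (supportFace (convexHull ℝ (S : Set E3)) n) (curve u₁ u₂ 0)).indicator 1) x =
    cov Λ ((Ev (supportFace (convexHull ℝ (S : Set E3)) (-n)) (curve u₁ u₂ 0)).indicator 1) x := by
  obtain ⟨N, hN, hP⟩ := exists_halfSpaces S (interior_nonempty_of_tiling hk ht)
  obtain ⟨R, hR⟩ := exists_norm_le_convexHull S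
  have hc : IsClosed (convexHull ℝ (S : Set E3)) := S.finite_toSet.isClosed_convexHull ℝ
  have h' : ON3 u₁ u₂ (-n) := h.rot.rot.neg.rot
  have e1 := cov_add Λ _ _ x ▸ congrArg (fun g => cov Λ g x) (funext (indicator_facet hP h))
  have e2 := cov_add Λ _ _ x ▸ congrArg (fun g => cov Λ g x) (funext (indicator_facet hP h'))
  simp only [neg_neg] at e1 e2
  rw [cov_ev_eq hN hP hc hR ht h'] at e1
  rw [cov_ev_eq hN hP hc hR ht h, ← e1] at e2
  exact (ENNReal.add_right_inj (by simp)).1 e2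

/-- The covering numbers of the four edges parallel to `e` on the facets orthogonal to `n`. -/
lemma cov_edge (hk : 0 < k) (ht : IsMultipleTiling k (convexHull ℝ (S : Set E3)) Λ)
    {e m n : E3} (h : ON3 e m n) (x : E3) :
    cov Λ ((Ev (supportFace (supportFace (convexHull ℝ (S : Set E3)) n) m)
        (curve e 0 0)).indicator 1) x +
      cov Λ ((Ev (supportFace (supportFace (convexHull ℝ (S : Set E3)) (-n)) (-m))
        (curve e 0 0)).indicator 1) x =
    cov Λ ((Ev (supportFace (supportFace (convexHull ℝ (S : Set E3)) n) (-m))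
        (curve e 0 0)).indicator 1) x +
      cov Λ ((Ev (supportFace (supportFace (convexHull ℝ (S : Set E3)) (-n)) m)
        (curve e 0 0)).indicator 1) x := by
  classical
  have hS := nonempty_of_tiling hk ht
  obtain ⟨N, hN, hP⟩ := exists_halfSpaces S (interior_nonempty_of_tiling hk ht)
  obtain ⟨R, hR⟩ := exists_norm_le_convexHull S
  have hc : IsClosed (convexHull ℝ (S : Set E3)) := S.finite_toSet.isClosed_convexHull ℝ
  have hF : ∀ (n z : E3), z ∈ supportFace (convexHull ℝ (S : Set E3)) n ↔
      ∀ q ∈ insert (-n, -supp S n) N, ⟪q.1, z⟫ ≤ q.2 := by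
    intro n z
    rw [mem_supportFace_iff hS, Finset.forall_mem_insert, hP z, inner_neg_left, neg_le_neg_iff,
      and_comm]
    refine and_congr_left fun hz => ⟨fun e => e.ge, fun e => le_antisymm ?_ e⟩
    exact (mem_convexHull_iff_supp hS).1 ((hP z).2 hz) n
  have hFn : ∀ n : E3, ∀ z ∈ supportFace (convexHull ℝ (S : Set E3)) n, ⟪n, z⟫ = supp S n :=
    fun n z hz => ((mem_supportFace_iff hS).1 hz).2
  have hFn' : ∀ n : E3, ∀ z ∈ supportFace (convexHull ℝ (S : Set E3)) (-n),
      ⟪n, z⟫ = -supp S (-n) := fun n z hz => by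
    have := hFn _ z hz
    rw [inner_neg_left] at this
    linarith
  have hm : ON3 e (-m) n := h.rot.neg.rot.rot
  have c1 := cov_facet hk ht h x
  have c2 := cov_facet hk ht hm x
  have e1 := cov_add Λ _ _ x ▸
    congrArg (fun g => cov Λ g x) (funext (indicator_edge (hF n) h (hFn n)))
  have e2 := cov_add Λ _ _ x ▸
    congrArg (fun g => cov Λ g x) (funext (indicator_edge (hF n) hm (hFn n)))
  have e3 := cov_add Λ _ _ x ▸
    congrArg (fun g => cov Λ g x) (funext (indicator_edge (hF (-n)) h (hFn' n)))
  have e4 := cov_add Λ _ _ x ▸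
    congrArg (fun g => cov Λ g x) (funext (indicator_edge (hF (-n)) hm (hFn' n)))
  simp only [neg_neg] at e1 e2 e3 e4
  rw [← c1] at e4
  rw [← c2] at e3
  have hfin : ∀ m, cov Λ ((Ev (supportFace (convexHull ℝ (S : Set E3)) n)
      (curve e m 0)).indicator 1) x ≠ ⊤ := by
    intro m
    refine LocFin.cov_ne_top ht.1 (R := R) (fun y hy => hR y ?_) x
    refine supportFace_subset _ _ (ev_subset ?_ (tendsto_curve _ _ _) hy)
    rw [supportFace_convexHull hS]
    exact (face S n).finite_toSet.isClosed_convexHull ℝ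
  have e5 := e1.trans e2.symm
  have e6 := e3.trans e4.symm
  refine (ENNReal.add_right_inj (ENNReal.add_ne_top.2 ⟨hfin (-m), hfin m⟩)).1 ?_
  calc _ = (cov Λ ((Ev (supportFace (convexHull ℝ (S : Set E3)) n) (curve e m 0)).indicator 1) x
          + cov Λ ((Ev (supportFace (supportFace (convexHull ℝ (S : Set E3)) n) m)
            (curve e 0 0)).indicator 1) x) +
        (cov Λ ((Ev (supportFace (convexHull ℝ (S : Set E3)) n) (curve e (-m) 0)).indicator 1) x
          + cov Λ ((Ev (supportFace (supportFace (convexHull ℝ (S : Set E3)) (-n)) (-m))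
            (curve e 0 0)).indicator 1) x) := by ring
    _ = _ := by rw [← e5, e6]; ring

lemma lintegral_indicator_of_ae_eq {A C : Set E3} (h : A =ᵐ[volume] C) (hC : MeasurableSet C) :
    AEMeasurable (A.indicator (1 : E3 → ℝ≥0∞)) ∧ ∫⁻ y, A.indicator 1 y = volume C := by
  have hA := indicator_ae_eq_of_ae_eq_set (f := (1 : E3 → ℝ≥0∞)) h
  refine ⟨((measurable_one.indicator hC).aemeasurable).congr hA.symm, ?_⟩
  rw [lintegral_congr_ae hA, lintegral_indicator_one hC]

lemma isCompact_thick {B : Set E3} (hB : IsCompact B) (n : E3) : IsCompact (thick B n) := by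
  have : thick B n = (fun p : E3 × ℝ => p.1 + p.2 • n) '' (B ×ˢ Set.Icc (0 : ℝ) 1) := by
    ext y
    constructor
    · rintro ⟨s, hs, hy⟩
      exact ⟨(y - s • n, s), ⟨hy, hs⟩, by simp⟩
    · rintro ⟨⟨z, s⟩, ⟨hz, hs⟩, rfl⟩
      exact ⟨s, hs, by simpa using hz⟩
  rw [this]
  exact (hB.prod isCompact_Icc).image (by fun_prop)

/-- Opposite facets have the same area, expressed through the prisms of height one over them. -/
lemma volume_facet (hk : 0 < k) (ht : IsMultipleTiling k (convexHull ℝ (S : Set E3)) Λ)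
    {u₁ u₂ n : E3} (h : ON3 u₁ u₂ n) :
    volume (thick (convexHull ℝ (face S n : Set E3)) n) =
      volume (thick (convexHull ℝ (face S (-n) : Set E3)) n) := by
  have hS := nonempty_of_tiling hk ht
  obtain ⟨R, hR⟩ := exists_norm_le_convexHull S
  have hPm : MeasurableSet (convexHull ℝ (S : Set E3)) :=
    (S.finite_toSet.isClosed_convexHull ℝ).measurableSet
  rw [← supportFace_convexHull hS, ← supportFace_convexHull hS]
  set P := convexHull ℝ (S : Set E3) with hPdef
  have hcomp : ∀ m, IsCompact (supportFace P m) := fun m => by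
    rw [hPdef, supportFace_convexHull hS]; exact (face S m).finite_toSet.isCompact_convexHull ℝ
  have hconv : ∀ m, Convex ℝ (supportFace P m) := fun m => by
    rw [hPdef, supportFace_convexHull hS]; exact convex_convexHull _ _
  have hγ : ∀ ε, ⟪n, curve u₁ u₂ 0 ε⟫ = 0 := fun ε => by rw [inner_curve, h.hwu, h.hwv]; simp
  have hc : curve u₁ u₂ n = fun ε => curve u₁ u₂ 0 ε + ε ^ 3 • n := by ext1; simp [curve]
  have main : ∀ m c, (∀ z ∈ supportFace P m, ⟪n, z⟫ = c) →
      thickO (Ev (supportFace P m) (curve u₁ u₂ 0)) n =ᵐ[volume] thick (supportFace P m) n := by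
    intro m c hm
    refine ae_eq_of_interior_subset (convex_thick (hconv m) n) ?_ ?_
    · refine (interior_subset_ev (tendsto_curve u₁ u₂ n)).trans ?_
      rw [hc]
      exact ev_thick_subset h.hw hm hγ three_ne_zero
    · exact (thickO_mono (ev_subset (hcomp m).isClosed (tendsto_curve _ _ _)) n).trans
        (thickO_subset_thick _ _)
  have hp : ∀ z ∈ supportFace P n, ⟪n, z⟫ = supp S n := fun z hz =>
    ((mem_supportFace_iff hS).1 hz).2
  have hq : ∀ z ∈ supportFace P (-n), ⟪n, z⟫ = -supp S (-n) := fun z hz => by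
    have := ((mem_supportFace_iff hS).1 hz).2
    rw [inner_neg_left] at this
    linarith
  have hEv : ∀ m, Ev (supportFace P m) (curve u₁ u₂ 0) ⊆ supportFace P m := fun m =>
    ev_subset (hcomp m).isClosed (tendsto_curve _ _ _)
  have hbd : ∀ m, ∀ y, (thickO (Ev (supportFace P m) (curve u₁ u₂ 0)) n).indicator
      (1 : E3 → ℝ≥0∞) y ≠ 0 → ‖y‖ ≤ R + 1 := by
    intro m y hy
    have hy' : y ∈ thickO (Ev (supportFace P m) (curve u₁ u₂ 0)) n := by
      by_contra hn; exact hy (Set.indicator_of_notMem hn _)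
    exact norm_le_of_mem_thick h.hw (fun y hy => hR y (supportFace_subset _ _ hy)) y
      (thickO_subset_thick _ _ (thickO_mono (hEv m) n hy'))
  obtain ⟨a1, a2⟩ := lintegral_indicator_of_ae_eq (main n _ hp)
    (isCompact_thick (hcomp n) n).measurableSet
  obtain ⟨b1, b2⟩ := lintegral_indicator_of_ae_eq (main (-n) _ hq)
    (isCompact_thick (hcomp (-n)) n).measurableSet
  rw [← a2, ← b2]
  refine lintegral_eq_of_cov_eq hk ht hPm hR a1 b1 (hbd n) (hbd (-n)) (Eventually.of_forall ?_)
  intro x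
  rw [cov_thickO h.hw fun z hz => hp z (hEv n hz), cov_thickO h.hw fun z hz => hq z (hEv (-n) hz)]
  exact tsum_congr fun s => cov_facet hk ht h _

/-- The relation between the lengths of the four edges parallel to `e` on the two facets orthogonal
to `n`, expressed through boxes over the edges. -/
lemma volume_edge (hk : 0 < k) (ht : IsMultipleTiling k (convexHull ℝ (S : Set E3)) Λ)
    {e m n : E3} (h : ON3 e m n) :
    volume (thick (thick (convexHull ℝ (face (face S n) m : Set E3)) m) n) +
      volume (thick (thick (convexHull ℝ (face (face S (-n)) (-m) : Set E3)) m) n) =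
    volume (thick (thick (convexHull ℝ (face (face S n) (-m) : Set E3)) m) n) +
      volume (thick (thick (convexHull ℝ (face (face S (-n)) m : Set E3)) m) n) := by
  have hS := nonempty_of_tiling hk ht
  obtain ⟨R, hR⟩ := exists_norm_le_convexHull S
  have hPm : MeasurableSet (convexHull ℝ (S : Set E3)) :=
    (S.finite_toSet.isClosed_convexHull ℝ).measurableSet
  have hEe : ∀ n' m' : E3, convexHull ℝ (face (face S n') m' : Set E3) =
      supportFace (supportFace (convexHull ℝ (S : Set E3)) n') m' := fun n' m' => by
    rw [supportFace_convexHull hS, supportFace_convexHull (face_nonempty hS n')]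
  set P := convexHull ℝ (S : Set E3) with hPdef
  let Ed : E3 → E3 → Set E3 := fun n' m' => convexHull ℝ (face (face S n') m' : Set E3)
  have hcomp : ∀ n' m', IsCompact (Ed n' m') := fun n' m' =>
    (face (face S n') m').finite_toSet.isCompact_convexHull ℝ
  have hEv : ∀ n' m', Ev (Ed n' m') (curve e 0 0) ⊆ Ed n' m' := fun n' m' =>
    ev_subset (hcomp n' m').isClosed (tendsto_curve _ _ _)
  have hEdP : ∀ n' m', Ed n' m' ⊆ P := fun n' m' =>
    convexHull_mono (by exact_mod_cast (face_subset _ _).trans (face_subset _ _))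
  -- the edge lies in a line orthogonal to `m` and `n`
  have hl : ∀ n' m', (n' = n ∨ n' = -n) → (m' = m ∨ m' = -m) →
      ∃ c d, ∀ z ∈ Ed n' m', ⟪n, z⟫ = c ∧ ⟪m, z⟫ = d := by
    intro n' m' hn' hm'
    have h1 : ∀ z ∈ Ed n' m', ⟪n', z⟫ = supp S n' ∧ ⟪m', z⟫ = supp (face S n') m' := by
      intro z hz
      have hz' : z ∈ supportFace (convexHull ℝ (face S n' : Set E3)) m' := by
        rw [supportFace_convexHull (face_nonempty hS n')]; exact hz
      have h2 := (mem_supportFace_iff (face_nonempty hS n')).1 hz'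
      refine ⟨?_, h2.2⟩
      have h3 := h2.1
      rw [← supportFace_convexHull hS] at h3
      exact ((mem_supportFace_iff hS).1 h3).2
    have h2 : ∀ (a b : E3) (f : E3 → ℝ), (a = b ∨ a = -b) →
        ∃ c, ∀ z, ⟪a, z⟫ = f a → ⟪b, z⟫ = c := by
      rintro a b f (rfl | rfl)
      · exact ⟨f a, fun z hz => hz⟩
      · exact ⟨-f (-b), fun z hz => by rw [inner_neg_left] at hz; linarith⟩
    obtain ⟨c, hc⟩ := h2 n' n (fun _ => supp S n') hn'
    obtain ⟨d, hd⟩ := h2 m' m (fun _ => supp (face S n') m') hm'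
    exact ⟨c, d, fun z hz => ⟨hc z (h1 z hz).1, hd z (h1 z hz).2⟩⟩
  have hline : ∀ {A : Set E3} {c : ℝ}, (∀ z ∈ A, ⟪n, z⟫ = c) → ∀ z ∈ thick A m, ⟪n, z⟫ = c := by
    rintro A c hA z ⟨s, _, hz⟩
    have := hA _ hz
    rwa [inner_sub_right, inner_smul_right, h.hwv, mul_zero, sub_zero] at this
  have hγn : ∀ ε, ⟪n, curve e m 0 ε⟫ = 0 := fun ε => by rw [inner_curve, h.hwu, h.hwv]; simp
  have hγm : ∀ ε, ⟪m, curve e 0 0 ε⟫ = 0 := fun ε => by rw [inner_curve, h.hvu]; simp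
  have hc1 : curve e m n = fun ε => curve e m 0 ε + ε ^ 3 • n := by ext1; simp [curve]
  have hc2 : curve e m 0 = fun ε => curve e 0 0 ε + ε ^ 2 • m := by ext1; simp [curve]
  let T : E3 → E3 → Set E3 := fun n' m' => thickO (thickO (Ev (Ed n' m') (curve e 0 0)) m) n
  have hTsub : ∀ n' m', T n' m' ⊆ thick (thick (Ed n' m') m) n := fun n' m' =>
    (thickO_mono ((thickO_mono (hEv n' m') m).trans (thickO_subset_thick _ _)) n).trans
      (thickO_subset_thick _ _)
  have main : ∀ n' m', (n' = n ∨ n' = -n) → (m' = m ∨ m' = -m) →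
      AEMeasurable ((T n' m').indicator (1 : E3 → ℝ≥0∞)) ∧
      (∫⁻ y, (T n' m').indicator 1 y = volume (thick (thick (Ed n' m') m) n)) ∧
      (∀ y, (T n' m').indicator (1 : E3 → ℝ≥0∞) y ≠ 0 → ‖y‖ ≤ R + 1 + 1) ∧
      ∀ x, cov Λ ((T n' m').indicator 1) x = ∑' s : Set.Ico (0 : ℝ) 1, ∑' t : Set.Ico (0 : ℝ) 1,
        cov Λ ((Ev (Ed n' m') (curve e 0 0)).indicator 1) (x - (s : ℝ) • n - (t : ℝ) • m) := by
    intro n' m' hn' hm'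
    obtain ⟨c, d, hcd⟩ := hl n' m' hn' hm'
    have hae : T n' m' =ᵐ[volume] thick (thick (Ed n' m') m) n := by
      refine ae_eq_of_interior_subset (convex_thick (convex_thick (convex_convexHull _ _) m) n) ?_ (hTsub n' m')
      refine (interior_subset_ev (tendsto_curve e m n)).trans ?_
      rw [hc1]
      refine (ev_thick_subset h.hw (hline fun z hz => (hcd z hz).1) hγn three_ne_zero).trans ?_
      rw [hc2]
      exact thickO_mono (ev_thick_subset h.hv (fun z hz => (hcd z hz).2) hγm two_ne_zero) n
    obtain ⟨a1, a2⟩ := lintegral_indicator_of_ae_eq hae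
      (isCompact_thick (isCompact_thick (hcomp n' m') m) n).measurableSet
    refine ⟨a1, a2, fun y hy => ?_, fun x => ?_⟩
    · have hy' : y ∈ T n' m' := by
        by_contra hn; exact hy (Set.indicator_of_notMem hn _)
      exact norm_le_of_mem_thick h.hw (norm_le_of_mem_thick h.hv fun y hy => hR y (hEdP n' m' hy))
        y (hTsub n' m' hy')
    · rw [cov_thickO h.hw fun z hz => hline (fun z hz => (hcd z hz).1) z
        (thickO_subset_thick _ _ (thickO_mono (hEv n' m') m hz))]
      exact tsum_congr fun s => cov_thickO h.hv (fun z hz => (hcd z (hEv n' m' hz)).2) _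
  obtain ⟨a1, b1, c1, d1⟩ := main n m (Or.inl rfl) (Or.inl rfl)
  obtain ⟨a2, b2, c2, d2⟩ := main (-n) (-m) (Or.inr rfl) (Or.inr rfl)
  obtain ⟨a3, b3, c3, d3⟩ := main n (-m) (Or.inl rfl) (Or.inr rfl)
  obtain ⟨a4, b4, c4, d4⟩ := main (-n) m (Or.inr rfl) (Or.inl rfl)
  change volume (thick (thick (Ed n m) m) n) + volume (thick (thick (Ed (-n) (-m)) m) n) =
    volume (thick (thick (Ed n (-m)) m) n) + volume (thick (thick (Ed (-n) m) m) n)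
  rw [← b1, ← b2, ← b3, ← b4, ← lintegral_add_left' a1, ← lintegral_add_left' a3]
  refine lintegral_eq_of_cov_eq hk ht hPm hR (a1.add a2) (a3.add a4) (R := R + 1 + 1)
    (fun y hy => ?_) (fun y hy => ?_) (Eventually.of_forall fun x => ?_)
  · by_cases h0 : (T n m).indicator (1 : E3 → ℝ≥0∞) y = 0
    · exact c2 y fun h1 => hy (by rw [h0, h1, add_zero])
    · exact c1 y h0
  · by_cases h0 : (T n (-m)).indicator (1 : E3 → ℝ≥0∞) y = 0
    · exact c4 y fun h1 => hy (by rw [h0, h1, add_zero])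
    · exact c3 y h0
  · rw [cov_add, cov_add, d1, d2, d3, d4]
    simp only [← ENNReal.tsum_add]
    refine tsum_congr fun s => tsum_congr fun t => ?_
    simp only [Ed, hEe]
    exact cov_edge hk ht h _

end

/-! ### Edge lengths -/

lemma ON3.volume_box {e m n : E3} (h : ON3 e m n) (a b c d p q : ℝ) :
    volume {y : E3 | ⟪e, y⟫ ∈ Set.Icc a b ∧ ⟪m, y⟫ ∈ Set.Icc c d ∧ ⟪n, y⟫ ∈ Set.Icc p q} =
      ENNReal.ofReal (b - a) * ENNReal.ofReal (d - c) * ENNReal.ofReal (q - p) := by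
  have hmp := (PiLp.volume_preserving_ofLp (Fin 3)).comp h.basis.measurePreserving_repr
  have hset : {y : E3 | ⟪e, y⟫ ∈ Set.Icc a b ∧ ⟪m, y⟫ ∈ Set.Icc c d ∧ ⟪n, y⟫ ∈ Set.Icc p q} =
      (WithLp.ofLp ∘ h.basis.repr) ⁻¹' Set.Icc ![a, c, p] ![b, d, q] := by
    ext y
    simp only [Set.mem_ofPred_eq, Set.mem_preimage, Function.comp_apply, Set.mem_Icc, Pi.le_def,
      Fin.forall_fin_succ, OrthonormalBasis.repr_apply_apply, ON3.basis, OrthonormalBasis.coe_mk]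
    simp
    tauto
  rw [hset, hmp.measure_preimage measurableSet_Icc.nullMeasurableSet, Real.volume_Icc_pi,
    Fin.prod_univ_three]
  simp

/-- A point set on which `m` and `n` are constant spans a segment in direction `e`. -/
lemma mem_convexHull_of_const {e m n : E3} (h : ON3 e m n) {T : Finset E3} (hT : T.Nonempty)
    {c d : ℝ} (hm : ∀ t ∈ T, ⟪m, t⟫ = d) (hn : ∀ t ∈ T, ⟪n, t⟫ = c) (z : E3) :
    z ∈ convexHull ℝ (T : Set E3) ↔
      ⟪e, z⟫ ∈ Set.Icc (-supp T (-e)) (supp T e) ∧ ⟪m, z⟫ = d ∧ ⟪n, z⟫ = c := by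
  have hcst : ∀ {x : E3} {r : ℝ}, (∀ t ∈ T, ⟪x, t⟫ = r) → supp T x = r ∧ supp T (-x) = -r := by
    intro x r hx
    have h1 := supp_add_of_const hT hx 0
    have h2 := supp_add_of_const hT (x := -x) (c := -r) (fun t ht => by
      rw [inner_neg_left, hx t ht]) 0
    rw [zero_add, supp_zero hT, zero_add] at h1 h2
    exact ⟨h1, h2⟩
  rw [mem_convexHull_iff_supp hT]
  constructor
  · intro hz
    have h1 := hz e
    have h2 := hz (-e)
    have h3 := hz m
    have h4 := hz (-m)
    have h5 := hz n
    have h6 := hz (-n)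
    rw [(hcst hm).1] at h3
    rw [(hcst hm).2] at h4
    rw [(hcst hn).1] at h5
    rw [(hcst hn).2] at h6
    rw [inner_neg_left] at h2 h4 h6
    exact ⟨⟨by linarith, h1⟩, by linarith, by linarith⟩
  · rintro ⟨⟨h1, h2⟩, h3, h4⟩ y
    have hy : y = ⟪e, y⟫ • e + (⟪m, y⟫ • m + ⟪n, y⟫ • n) := by
      rw [← add_assoc]; exact h.expand y
    have hy' : supp T y = supp T (⟪e, y⟫ • e) + (⟪m, y⟫ * d + ⟪n, y⟫ * c) := by
      conv_lhs => rw [hy]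
      refine supp_add_of_const hT (fun t ht => ?_) _
      rw [inner_add_left, real_inner_smul_left, real_inner_smul_left, hm t ht, hn t ht]
    rw [hy']
    conv_lhs => rw [hy]
    rw [inner_add_left, inner_add_left, real_inner_smul_left, real_inner_smul_left,
      real_inner_smul_left, h3, h4]
    gcongr
    rcases le_total 0 ⟪e, y⟫ with h0 | h0
    · rw [supp_smul hT h0]
      exact mul_le_mul_of_nonneg_left h2 h0
    · have : ⟪e, y⟫ • e = (-⟪e, y⟫) • (-e) := by module
      rw [this, supp_smul hT (by linarith)]
      nlinarith

lemma volume_thick_thick {e m n : E3} (h : ON3 e m n) {T : Finset E3} (hT : T.Nonempty)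
    {c d : ℝ} (hm : ∀ t ∈ T, ⟪m, t⟫ = d) (hn : ∀ t ∈ T, ⟪n, t⟫ = c) :
    volume (thick (thick (convexHull ℝ (T : Set E3)) m) n) =
      ENNReal.ofReal (supp T e + supp T (-e)) := by
  have hset : thick (thick (convexHull ℝ (T : Set E3)) m) n =
      {y : E3 | ⟪e, y⟫ ∈ Set.Icc (-supp T (-e)) (supp T e) ∧ ⟪m, y⟫ ∈ Set.Icc d (d + 1) ∧
        ⟪n, y⟫ ∈ Set.Icc c (c + 1)} := by
    ext y
    simp only [mem_thick, mem_convexHull_of_const h hT hm hn, inner_sub_right, inner_smul_right,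
      h.hw, h.hwv, h.hvw, h.hv, h.huv, h.huw, mul_zero, sub_zero, mul_one, Set.mem_ofPred_eq]
    constructor
    · rintro ⟨s, hs, t, ht, h1, h2, h3⟩
      exact ⟨h1, ⟨by linarith [ht.1], by linarith [ht.2]⟩, by linarith [hs.1], by linarith [hs.2]⟩
    · rintro ⟨h1, h2, h3⟩
      exact ⟨⟪n, y⟫ - c, ⟨by linarith [h3.1], by linarith [h3.2]⟩, ⟪m, y⟫ - d,
        ⟨by linarith [h2.1], by linarith [h2.2]⟩, h1, by ring, by ring⟩
  rw [hset, h.volume_box]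
  simp

/-- The extent in direction `e` of the face in direction `m` of the face in direction `n`. -/
noncomputable def len (S : Finset E3) (n m e : E3) : ℝ :=
  supp (face (face S n) m) e + supp (face (face S n) m) (-e)

lemma len_nonneg {S : Finset E3} (hS : S.Nonempty) (n m e : E3) : 0 ≤ len S n m e :=
  supp_neg_le (face_nonempty (face_nonempty hS n) m) e

lemma len_neg (S : Finset E3) (n m e : E3) : len S n m (-e) = len S n m e := by
  rw [len, len, neg_neg, add_comm]

lemma inner_of_mem_face_face {S : Finset E3} {n m s : E3} (hs : s ∈ face (face S n) m) :
    ⟪n, s⟫ = supp S n ∧ ⟪m, s⟫ = supp (face S n) m :=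
  ⟨(mem_face.1 (mem_face.1 hs).1).2, (mem_face.1 hs).2⟩

lemma face_eq_of_const {T : Finset E3} (hT : T.Nonempty) {x : E3} {c : ℝ}
    (h : ∀ t ∈ T, ⟪x, t⟫ = c) : face T x = T := by
  ext s
  rw [mem_face, and_iff_left_iff_imp]
  intro hs
  have := supp_add_of_const hT h 0
  rw [zero_add, supp_zero hT, zero_add] at this
  rw [this, h s hs]

section

variable {S : Finset E3} {k : ℕ} {Λ : E3 → ℕ}

lemma len_relation (hk : 0 < k) (ht : IsMultipleTiling k (convexHull ℝ (S : Set E3)) Λ)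
    {e m n : E3} (h : ON3 e m n) :
    len S n m e + len S (-n) (-m) e = len S n (-m) e + len S (-n) m e := by
  have hS := nonempty_of_tiling hk ht
  have hv := volume_edge hk ht h
  have key : ∀ n' m', (n' = n ∨ n' = -n) → (m' = m ∨ m' = -m) →
      volume (thick (thick (convexHull ℝ (face (face S n') m' : Set E3)) m) n) =
        ENNReal.ofReal (len S n' m' e) := by
    intro n' m' hn hm
    have h2 : ∀ (a b : E3) (r : ℝ), (a = b ∨ a = -b) →
        ∃ c, ∀ z, ⟪a, z⟫ = r → ⟪b, z⟫ = c := by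
      rintro a b r (rfl | rfl)
      · exact ⟨r, fun z hz => hz⟩
      · exact ⟨-r, fun z hz => by rw [inner_neg_left] at hz; linarith⟩
    obtain ⟨c, hc⟩ := h2 n' n (supp S n') hn
    obtain ⟨d, hd⟩ := h2 m' m (supp (face S n') m') hm
    exact volume_thick_thick h (face_nonempty (face_nonempty hS n') m')
      (fun t ht => hd t (inner_of_mem_face_face ht).2)
      (fun t ht => hc t (inner_of_mem_face_face ht).1)
  rw [key n m (Or.inl rfl) (Or.inl rfl), key (-n) (-m) (Or.inr rfl) (Or.inr rfl),
    key n (-m) (Or.inl rfl) (Or.inr rfl), key (-n) m (Or.inr rfl) (Or.inl rfl),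
    ← ENNReal.ofReal_add (len_nonneg hS _ _ _) (len_nonneg hS _ _ _),
    ← ENNReal.ofReal_add (len_nonneg hS _ _ _) (len_nonneg hS _ _ _),
    ENNReal.ofReal_eq_ofReal_iff (add_nonneg (len_nonneg hS _ _ _) (len_nonneg hS _ _ _))
      (add_nonneg (len_nonneg hS _ _ _) (len_nonneg hS _ _ _))] at hv
  exact hv

lemma eventually_nhds_of_right_left {p : ℝ → Prop} {t : ℝ} (h0 : p t)
    (h1 : ∀ᶠ ε in 𝓝[>] (0 : ℝ), p (t + ε)) (h2 : ∀ᶠ ε in 𝓝[>] (0 : ℝ), p (t - ε)) :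
    ∀ᶠ s in 𝓝 t, p s := by
  obtain ⟨δ₁, hδ₁, h1⟩ := mem_nhdsGT_iff_exists_Ioo_subset.1 h1
  obtain ⟨δ₂, hδ₂, h2⟩ := mem_nhdsGT_iff_exists_Ioo_subset.1 h2
  filter_upwards [Ioo_mem_nhds (sub_lt_self t hδ₂) (lt_add_of_pos_right t hδ₁)] with s hs
  rcases lt_trichotomy s t with hst | rfl | hst
  · have := h2 (a := t - s) ⟨by linarith, by linarith [hs.1]⟩
    simpa using this
  · exact h0
  · have := h1 (a := s - t) ⟨by linarith, by linarith [hs.2]⟩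
    simpa using this

/-- The two edges in direction `e` on opposite sides of the polytope have constant total length. -/
lemma exists_len_const (hk : 0 < k) (ht : IsMultipleTiling k (convexHull ℝ (S : Set E3)) Λ) :
    ∃ C : E3 → ℝ, ∀ e m n, ON3 e m n → len S n m e + len S (-n) (-m) e = C e := by
  classical
  have hS := nonempty_of_tiling hk ht
  suffices H : ∀ e x₀ y₀, ON3 e x₀ y₀ → ∃ c, ∀ m n, ON3 e m n →
      len S n m e + len S (-n) (-m) e = c by
    have H' : ∀ e, ∃ c, ∀ m n, ON3 e m n → len S n m e + len S (-n) (-m) e = c := by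
      intro e
      by_cases he : ⟪e, e⟫ = 1
      · obtain ⟨x₀, y₀, h⟩ := exists_ON3 e he
        exact H e x₀ y₀ h
      · exact ⟨0, fun m n h => absurd h.hu he⟩
    choose C hC using H'
    exact ⟨C, hC⟩
  intro e x₀ y₀ h
  let n : ℝ → E3 := fun θ => Real.cos θ • x₀ + Real.sin θ • y₀
  let m : ℝ → E3 := fun θ => (-Real.sin θ) • x₀ + Real.cos θ • y₀
  have hON : ∀ θ, ON3 e (m θ) (n θ) := by
    intro θ
    have := Real.sin_sq_add_cos_sq θ
    constructor <;> simp only [m, n, inner_add_left, inner_add_right, real_inner_smul_left,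
      inner_smul_right, h.hu, h.hv, h.hw, h.huv, h.huw, h.hvw, h.hwv] <;> nlinarith
  let g : ℝ → ℝ := fun θ => len S (n θ) (m θ) e + len S (-n θ) (-m θ) e
  have hnadd : ∀ θ δ, n (θ + δ) = Real.cos δ • n θ + Real.sin δ • m θ := by
    intro θ δ
    simp only [n, m, Real.cos_add, Real.sin_add]
    module
  have hmadd : ∀ θ δ, m (θ + δ) = Real.cos δ • m θ + (-Real.sin δ) • n θ := by
    intro θ δ
    simp only [n, m, Real.cos_add, Real.sin_add]
    module
  have htan : Tendsto Real.tan (𝓝[>] 0) (𝓝[>] 0) := by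
    refine tendsto_nhdsWithin_iff.2 ⟨?_, ?_⟩
    · have : ContinuousAt Real.tan 0 := Real.continuousAt_tan.2 (by simp)
      simpa using this.tendsto.mono_left nhdsWithin_le_nhds
    · filter_upwards [eventually_pos_lt (by positivity : 0 < Real.pi / 2)] with δ hδ
      exact Real.tan_pos_of_pos_of_lt_pi_div_two hδ.1 hδ.2
  -- moving a little from `n` towards `m` selects the edge `face (face S n) m`
  have key : ∀ n m : E3, ∀ᶠ δ in 𝓝[>] (0 : ℝ),
      len S (Real.cos δ • n + Real.sin δ • m) (Real.cos δ • m + (-Real.sin δ) • n) e = len S n m e ∧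
      len S (Real.cos δ • n + Real.sin δ • m) (-(Real.cos δ • m + (-Real.sin δ) • n)) e =
        len S n m e := by
    intro n m
    filter_upwards [htan.eventually (eventually_face_add hS n m),
      eventually_pos_lt (by positivity : 0 < Real.pi / 2)] with δ h1 h2
    have hcos : 0 < Real.cos δ := Real.cos_pos_of_mem_Ioo ⟨by linarith, h2.2⟩
    have e1 : Real.cos δ • n + Real.sin δ • m = Real.cos δ • (n + Real.tan δ • m) := by
      rw [smul_add, smul_smul, Real.tan_eq_sin_div_cos, mul_div_cancel₀ _ hcos.ne']
    have e2 : face S (Real.cos δ • n + Real.sin δ • m) = face (face S n) m := by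
      rw [e1, face_smul hS hcos, h1.1]
    have hT := face_nonempty (face_nonempty hS n) m
    have hcst : ∀ t ∈ face (face S n) m, ⟪Real.cos δ • m + (-Real.sin δ) • n, t⟫ =
        Real.cos δ * supp (face S n) m - Real.sin δ * supp S n := by
      intro t ht
      obtain ⟨a1, a2⟩ := inner_of_mem_face_face ht
      rw [inner_add_left, real_inner_smul_left, real_inner_smul_left, a1, a2]
      ring
    have hcst' : ∀ t ∈ face (face S n) m, ⟪-(Real.cos δ • m + (-Real.sin δ) • n), t⟫ =
        -(Real.cos δ * supp (face S n) m - Real.sin δ * supp S n) := fun t ht => by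
      rw [inner_neg_left, hcst t ht]
    constructor
    · rw [len, e2, face_eq_of_const hT hcst, len]
    · rw [len, e2, face_eq_of_const hT hcst', len]
  have hlc : IsLocallyConstant g := by
    rw [IsLocallyConstant.iff_eventually_eq]
    intro θ
    refine eventually_nhds_of_right_left rfl ?_ ?_
    · filter_upwards [key (n θ) (m θ), key (-n θ) (-m θ)] with δ h1 h2
      simp only [g, hnadd, hmadd]
      rw [h1.1, ← h2.1]
      congr 2 <;> module
    · filter_upwards [key (n θ) (-m θ), key (-n θ) (m θ)] with δ h1 h2
      simp only [g, sub_eq_add_neg, hnadd, hmadd, Real.cos_neg, Real.sin_neg]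
      rw [len_relation hk ht (hON θ), ← h1.2, ← h2.2]
      congr 2 <;> module
  refine ⟨g 0, fun m' n' h' => ?_⟩
  obtain ⟨θ, hθ⟩ : ∃ θ, n' = n θ := by
    have e1 := h.expand n'
    rw [h'.huw, zero_smul, zero_add] at e1
    have e2 : ⟪x₀, n'⟫ ^ 2 + ⟪y₀, n'⟫ ^ 2 = 1 := by
      have := h'.hw
      rw [e1] at this
      simp only [inner_add_left, inner_add_right, real_inner_smul_left,
        inner_smul_right, h.hv, h.hw, h.hvw, h.hwv] at this
      nlinarith
    let z : ℂ := ⟨⟪x₀, n'⟫, ⟪y₀, n'⟫⟩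
    have hz : ‖z‖ = 1 := by
      rw [Complex.norm_eq_sqrt_sq_add_sq, e2, Real.sqrt_one]
    refine ⟨z.arg, ?_⟩
    have c1 := Complex.norm_mul_cos_arg z
    have c2 := Complex.norm_mul_sin_arg z
    rw [hz, one_mul] at c1 c2
    simp only [n, c1, c2]
    exact e1
  have hconst : g θ = g 0 := hlc.apply_eq_of_preconnectedSpace θ 0
  have hm' : m' = m θ ∨ m' = -m θ := by
    have e1 := (hON θ).expand m'
    rw [h'.huv, ← hθ, h'.hwv, zero_smul, zero_smul, zero_add, add_zero] at e1
    have e2 := h'.hv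
    rw [e1, real_inner_smul_left, inner_smul_right, (hON θ).hv, mul_one, ← sq,
      sq_eq_one_iff] at e2
    rcases e2 with e2 | e2 <;> rw [e2] at e1
    · left; simpa using e1
    · right; simpa using e1
  rw [← hconst]
  rcases hm' with rfl | rfl
  · rw [hθ]
  · rw [hθ, neg_neg, ← len_relation hk ht (hON θ)]

end

/-! ### The width function is a sum of absolute values of linear functions -/

open Classical in
/-- The unit vectors in the directions of the differences of points of `S`. -/
noncomputable def dirs (S : Finset E3) : Finset E3 :=
  ((S ×ˢ S).filter fun p => p.1 ≠ p.2).image fun p => ‖p.1 - p.2‖⁻¹ • (p.1 - p.2)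

lemma mem_dirs {S : Finset E3} {e : E3} :
    e ∈ dirs S ↔ ∃ s ∈ S, ∃ t ∈ S, s ≠ t ∧ ‖s - t‖⁻¹ • (s - t) = e := by
  simp only [dirs, Finset.mem_image, Finset.mem_filter, Finset.mem_product, Prod.exists]
  constructor
  · rintro ⟨s, t, ⟨⟨h1, h2⟩, h3⟩, h4⟩; exact ⟨s, h1, t, h2, h3, h4⟩
  · rintro ⟨s, h1, t, h2, h3, h4⟩; exact ⟨s, t, ⟨⟨h1, h2⟩, h3⟩, h4⟩

lemma inner_self_of_mem_dirs {S : Finset E3} {e : E3} (h : e ∈ dirs S) : ⟪e, e⟫ = 1 := by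
  obtain ⟨s, _, t, _, hne, rfl⟩ := mem_dirs.1 h
  have : ‖s - t‖ ≠ 0 := norm_ne_zero_iff.2 (sub_ne_zero.2 hne)
  rw [real_inner_smul_left, inner_smul_right, real_inner_self_eq_norm_sq]
  field_simp

lemma neg_mem_dirs {S : Finset E3} {e : E3} (h : e ∈ dirs S) : -e ∈ dirs S := by
  obtain ⟨s, hs, t, ht, hne, rfl⟩ := mem_dirs.1 h
  refine mem_dirs.2 ⟨t, ht, s, hs, hne.symm, ?_⟩
  rw [norm_sub_rev, ← smul_neg, neg_sub]

lemma len_eq_zero_of_notMem_dirs {S : Finset E3} (hS : S.Nonempty) {e m n : E3} (h : ON3 e m n)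
    (he : e ∉ dirs S) (n' m' : E3) (hn : n' = n ∨ n' = -n) (hm : m' = m ∨ m' = -m) :
    len S n' m' e = 0 := by
  have hT := face_nonempty (face_nonempty hS n') m'
  obtain ⟨t, ht⟩ := hT
  have hall : ∀ s ∈ face (face S n') m', s = t := by
    intro s hs
    by_contra hne
    have hsub : ∀ {a}, a ∈ face (face S n') m' → a ∈ S := fun h =>
      face_subset _ _ (face_subset _ _ h)
    have h1 := inner_of_mem_face_face hs
    have h2 := inner_of_mem_face_face ht
    have e1 : ⟪n, s - t⟫ = 0 := by
      have : ⟪n', s - t⟫ = 0 := by rw [inner_sub_right, h1.1, h2.1, sub_self]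
      rcases hn with rfl | rfl
      · exact this
      · simpa using this
    have e2 : ⟪m, s - t⟫ = 0 := by
      have : ⟪m', s - t⟫ = 0 := by rw [inner_sub_right, h1.2, h2.2, sub_self]
      rcases hm with rfl | rfl
      · exact this
      · simpa using this
    have e3 := h.expand (s - t)
    rw [e1, e2, zero_smul, zero_smul, add_zero, add_zero] at e3
    set r := ⟪e, s - t⟫
    have hnorm : ‖e‖ = 1 := by
      have := h.hu
      rw [real_inner_self_eq_norm_sq] at this
      nlinarith [norm_nonneg e]
    have hr : r ≠ 0 := by
      intro h0
      rw [h0, zero_smul, sub_eq_zero] at e3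
      exact hne e3
    apply he
    rcases lt_or_gt_of_ne hr with hr' | hr'
    · refine mem_dirs.2 ⟨t, hsub ht, s, hsub hs, fun h => hne h.symm, ?_⟩
      rw [norm_sub_rev, ← neg_sub s t, e3, norm_smul, hnorm, mul_one, Real.norm_eq_abs,
        abs_of_neg hr', ← neg_smul, smul_smul, inv_mul_cancel₀ (by linarith), one_smul]
    · refine mem_dirs.2 ⟨s, hsub hs, t, hsub ht, hne, ?_⟩
      rw [e3, norm_smul, hnorm, mul_one, Real.norm_eq_abs, abs_of_pos hr', smul_smul,
        inv_mul_cancel₀ hr, one_smul]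
  have hc : ∀ x, supp (face (face S n') m') x = ⟪x, t⟫ := fun x => by
    obtain ⟨s, hs, e⟩ := exists_eq_supp ⟨t, ht⟩ x
    rw [← e, hall s hs]
  rw [len, hc, hc, inner_neg_left, add_neg_cancel]

open Classical in
/-- The germ of `absGerm g x`. -/
noncomputable def absGerm₂ (g x y w : E3) : ℝ :=
  if ⟪g, x⟫ = 0 then absGerm g y w else if 0 < ⟪g, x⟫ then ⟪g, w⟫ else -⟪g, w⟫

lemma hasGerm_absGerm (g x : E3) : HasGerm (absGerm g x) (absGerm₂ g x) := by
  unfold absGerm₂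
  by_cases h : ⟪g, x⟫ = 0
  · have : absGerm g x = fun y => |⟪g, y⟫| := by ext y; simp [absGerm, h]
    rw [this]
    simpa [h] using hasGerm_abs g
  · by_cases h' : 0 < ⟪g, x⟫
    · have : absGerm g x = fun y => ⟪g, y⟫ := by ext y; simp [absGerm, h, h']
      rw [this]
      simpa [h, h'] using hasGerm_inner g
    · have : absGerm g x = fun y => ⟪-g, y⟫ := by ext y; simp [absGerm, h, h']
      rw [this]
      simpa [h, h'] using hasGerm_inner (-g)

lemma kink_absGerm₂ (g x y w : E3) :
    kink (absGerm₂ g x) y w = if ⟪g, x⟫ = 0 ∧ ⟪g, y⟫ = 0 then 2 * |⟪g, w⟫| else 0 := by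
  by_cases h : ⟪g, x⟫ = 0
  · have := kink_absGerm g y w
    unfold kink at this ⊢
    simp only [absGerm₂, h, if_true, true_and]
    exact this
  · unfold kink absGerm₂
    simp only [h, if_false, false_and]
    split_ifs <;> simp

lemma absGerm_smul (g x : E3) {r : ℝ} (hr : 0 < r) (y : E3) :
    absGerm g x (r • y) = r * absGerm g x y := by
  unfold absGerm
  simp only [inner_smul_right, abs_mul, abs_of_pos hr]
  split_ifs <;> ring

lemma absGerm_smul_left (g x : E3) {r : ℝ} (hr : 0 < r) (y : E3) :
    absGerm g (r • x) y = absGerm g x y := by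
  unfold absGerm
  simp [inner_smul_right, hr.ne', hr]

lemma absGerm_add_smul (g x y : E3) (r : ℝ) :
    absGerm g x (y + r • x) = absGerm g x y + r * |⟪g, x⟫| := by
  unfold absGerm
  simp only [inner_add_right, inner_smul_right]
  split_ifs with h h'
  · simp [h]
  · rw [abs_of_pos h']
  · rw [abs_of_neg (lt_of_le_of_ne (not_lt.1 h') h)]; ring

lemma supp_add_supp_neg_of_const {e m n : E3} (h : ON3 e m n) {T : Finset E3} (hT : T.Nonempty)
    {c d : ℝ} (hm : ∀ t ∈ T, ⟪m, t⟫ = d) (hn : ∀ t ∈ T, ⟪n, t⟫ = c) (w : E3) :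
    supp T w + supp T (-w) = |⟪e, w⟫| * (supp T e + supp T (-e)) := by
  have hw : w = ⟪e, w⟫ • e + (⟪m, w⟫ • m + ⟪n, w⟫ • n) := by
    rw [← add_assoc]; exact h.expand w
  have h1 : supp T w = supp T (⟪e, w⟫ • e) + (⟪m, w⟫ * d + ⟪n, w⟫ * c) := by
    conv_lhs => rw [hw]
    refine supp_add_of_const hT (fun t ht => ?_) _
    rw [inner_add_left, real_inner_smul_left, real_inner_smul_left, hm t ht, hn t ht]
  have h2 : supp T (-w) = supp T (⟪e, w⟫ • (-e)) + -(⟪m, w⟫ * d + ⟪n, w⟫ * c) := by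
    have hw' : -w = ⟪e, w⟫ • (-e) + -(⟪m, w⟫ • m + ⟪n, w⟫ • n) := by
      conv_lhs => rw [hw]
      module
    conv_lhs => rw [hw']
    refine supp_add_of_const hT (fun t ht => ?_) _
    rw [inner_neg_left, inner_add_left, real_inner_smul_left, real_inner_smul_left, hm t ht,
      hn t ht]
  rw [h1, h2]
  rcases le_total 0 ⟪e, w⟫ with h0 | h0
  · rw [supp_smul hT h0, supp_smul hT h0, abs_of_nonneg h0]; ring
  · have e1 : ⟪e, w⟫ • e = (-⟪e, w⟫) • (-e) := by module
    have e2 : ⟪e, w⟫ • (-e) = (-⟪e, w⟫) • e := by module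
    rw [e1, e2, supp_smul hT (by linarith), supp_smul hT (by linarith), abs_of_nonpos h0]; ring

section Width

variable {S : Finset E3} {C : E3 → ℝ}

/-- The defect between the width function and a sum of absolute values. -/
noncomputable def defect (S : Finset E3) (C : E3 → ℝ) (x : E3) : ℝ :=
  supp S x + supp S (-x) - ∑ e ∈ dirs S, C e / 4 * |⟪e, x⟫|

/-- The germ of `defect`. -/
noncomputable def defect₁ (S : Finset E3) (C : E3 → ℝ) (x y : E3) : ℝ :=
  supp (face S x) y + supp (face S (-x)) (-y) - ∑ e ∈ dirs S, C e / 4 * absGerm e x y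

/-- The germ of `defect₁`. -/
noncomputable def defect₂ (S : Finset E3) (C : E3 → ℝ) (x y w : E3) : ℝ :=
  supp (face (face S x) y) w + supp (face (face S (-x)) (-y)) (-w) -
    ∑ e ∈ dirs S, C e / 4 * absGerm₂ e x y w

lemma hasGerm_defect (hS : S.Nonempty) : HasGerm (defect S C) (defect₁ S C) :=
  ((hasGerm_supp hS).add (hasGerm_supp hS).comp_neg).sub
    (HasGerm.sum _ fun e _ => (hasGerm_abs e).const_mul _)

lemma hasGerm_defect₁ (hS : S.Nonempty) (x : E3) : HasGerm (defect₁ S C x) (defect₂ S C x) :=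
  ((hasGerm_supp (face_nonempty hS x)).add (hasGerm_supp (face_nonempty hS (-x))).comp_neg).sub
    (HasGerm.sum _ fun e _ => (hasGerm_absGerm e x).const_mul _)

lemma kink_defect₂_unit (hS : S.Nonempty)
    (hC : ∀ e m n, ON3 e m n → len S n m e + len S (-n) (-m) e = C e) {e m n : E3} (h : ON3 e m n)
    (w : E3) : kink (defect₂ S C n) m w = 0 := by
  have hT := face_nonempty (face_nonempty hS n) m
  have hT' := face_nonempty (face_nonempty hS (-n)) (-m)
  have e1 := supp_add_supp_neg_of_const h hT (fun t ht => (inner_of_mem_face_face ht).2)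
    (fun t ht => (inner_of_mem_face_face ht).1) w
  have e2 := supp_add_supp_neg_of_const (h.rot.neg.rot.neg.rot) hT'
    (fun t ht => (inner_of_mem_face_face ht).2) (fun t ht => (inner_of_mem_face_face ht).1) w
  have e3 : ∑ f ∈ dirs S, C f / 4 * kink (absGerm₂ f n) m w = C e * |⟪e, w⟫| := by
    have hCneg : C (-e) = C e := by
      rw [← hC e m n h, ← hC (-e) m n h.neg, len_neg, len_neg]
    have hC0 : e ∉ dirs S → C e = 0 := fun he => by
      rw [← hC e m n h, len_eq_zero_of_notMem_dirs hS h he n m (Or.inl rfl) (Or.inl rfl),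
        len_eq_zero_of_notMem_dirs hS h he (-n) (-m) (Or.inr rfl) (Or.inr rfl), add_zero]
    have hne : e ≠ -e := fun h0 => by
      have h1 := h.hu
      have h2 : ⟪e, e⟫ = ⟪e, -e⟫ := by rw [← h0]
      rw [inner_neg_right] at h2
      linarith
    rw [Finset.sum_eq_add e (-e) hne]
    · rw [kink_absGerm₂, kink_absGerm₂, if_pos ⟨h.huw, h.huv⟩, if_pos (by simp [h.huw, h.huv]),
        hCneg, inner_neg_left, abs_neg]
      ring
    · intro f hf hfe
      rw [kink_absGerm₂, if_neg, mul_zero]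
      rintro ⟨h1, h2⟩
      have h3 := h.expand f
      rw [real_inner_comm f m, real_inner_comm f n, h1, h2, zero_smul, zero_smul, add_zero,
        add_zero] at h3
      have h4 := inner_self_of_mem_dirs hf
      rw [h3, real_inner_smul_left, inner_smul_right, h.hu, mul_one, ← sq, sq_eq_one_iff] at h4
      rcases h4 with h4 | h4 <;> rw [h4] at h3
      · exact hfe.1 (by simpa using h3)
      · exact hfe.2 (by simpa using h3)
    · intro he; rw [hC0 he]; simp
    · intro he
      rw [hCneg, hC0 fun h => he (neg_mem_dirs h)]; simp
  have e4 := hC e m n h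
  rw [len, len] at e4
  have : kink (defect₂ S C n) m w =
      (supp (face (face S n) m) w + supp (face (face S n) m) (-w)) +
      (supp (face (face S (-n)) (-m)) w + supp (face (face S (-n)) (-m)) (-w)) -
      ∑ f ∈ dirs S, C f / 4 * kink (absGerm₂ f n) m w := by
    simp only [kink, defect₂, mul_add, Finset.sum_add_distrib, neg_neg]
    ring
  rw [this, e1, e2, e3, ← mul_add, e4]
  ring

lemma exists_ON3_of_orthogonal {m n : E3} (hm : ⟪m, m⟫ = 1) (hn : ⟪n, n⟫ = 1) (hnm : ⟪n, m⟫ = 0) :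
    ∃ e, ON3 e m n := by
  obtain ⟨v, w, h⟩ := exists_ON3 n hn
  refine ⟨(-⟪w, m⟫) • v + ⟪v, m⟫ • w, ?_⟩
  have h1 := h.expand m
  rw [hnm, zero_smul, zero_add] at h1
  have h2 : ⟪v, m⟫ ^ 2 + ⟪w, m⟫ ^ 2 = 1 := by
    have h3 := hm
    rw [h1] at h3
    simp only [inner_add_left, inner_add_right, real_inner_smul_left, inner_smul_right, h.hv,
      h.hw, h.hvw, h.hwv] at h3
    nlinarith
  refine ⟨?_, hm, hn, ?_, ?_, by rw [real_inner_comm]; exact hnm⟩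
  · simp only [inner_add_left, inner_add_right, real_inner_smul_left, inner_smul_right, h.hv,
      h.hw, h.hvw, h.hwv]
    nlinarith
  · rw [inner_add_left, real_inner_smul_left, real_inner_smul_left]; ring
  · rw [inner_add_left, real_inner_smul_left, real_inner_smul_left, h.hvu, h.hwu]; ring

lemma kink_defect₂ (hS : S.Nonempty)
    (hC : ∀ e m n, ON3 e m n → len S n m e + len S (-n) (-m) e = C e) {n p : E3} (hn : ⟪n, n⟫ = 1)
    (hp : p ≠ 0) (hnp : ⟪n, p⟫ = 0) (w : E3) : kink (defect₂ S C n) p w = 0 := by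
  set r := ‖p‖ with hr
  have hr0 : 0 < r := norm_pos_iff.2 hp
  obtain ⟨m, hm⟩ : ∃ m, m = r⁻¹ • p := ⟨_, rfl⟩
  have hpm : p = r • m := by rw [hm, smul_smul, mul_inv_cancel₀ hr0.ne', one_smul]
  have hmm : ⟪m, m⟫ = 1 := by
    rw [hm, real_inner_smul_left, inner_smul_right, real_inner_self_eq_norm_sq, ← hr]
    field_simp
  have hnm : ⟪n, m⟫ = 0 := by rw [hm, inner_smul_right, hnp, mul_zero]
  obtain ⟨e, he⟩ := exists_ON3_of_orthogonal hmm hn hnm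
  have := kink_defect₂_unit hS hC he w
  rw [← this, hpm]
  have habs : ∀ f w, absGerm₂ f n (r • m) w = absGerm₂ f n m w := fun f w => by
    unfold absGerm₂; rw [absGerm_smul_left f m hr0]
  simp only [kink, defect₂, face_smul (face_nonempty hS n) hr0, ← smul_neg,
    face_smul (face_nonempty hS (-n)) hr0, habs]

lemma exists_orthogonal (v : E3) : ∃ w, w ≠ 0 ∧ ⟪v, w⟫ = 0 := by
  by_cases hv : v = 0
  · obtain ⟨w, hw⟩ := exists_ne (0 : E3)
    exact ⟨w, hw, by simp [hv]⟩
  · have hn : ‖v‖ ≠ 0 := norm_ne_zero_iff.2 hv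
    obtain ⟨a, b, h⟩ := exists_ON3 (‖v‖⁻¹ • v) (by
      rw [real_inner_smul_left, inner_smul_right, real_inner_self_eq_norm_sq]; field_simp)
    refine ⟨a, fun h0 => ?_, ?_⟩
    · have := h.hv; simp [h0] at this
    · have := h.huv
      rw [real_inner_smul_left] at this
      exact (mul_eq_zero.1 this).resolve_left (inv_ne_zero hn)

lemma defect₁_odd (hS : S.Nonempty)
    (hC : ∀ e m n, ON3 e m n → len S n m e + len S (-n) (-m) e = C e) {n v : E3} (hn : ⟪n, n⟫ = 1)
    (hnv : ⟪n, v⟫ = 0) : defect₁ S C n (-v) = -defect₁ S C n v := by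
  obtain ⟨w, hw0, hnw, hvw⟩ : ∃ w, w ≠ 0 ∧ ⟪n, w⟫ = 0 ∧ ⟪w, v⟫ = 0 := by
    by_cases hv : v = 0
    · obtain ⟨w, hw, h⟩ := exists_orthogonal n
      exact ⟨w, hw, h, by simp [hv]⟩
    · obtain ⟨a, b, h⟩ := exists_ON3 n hn
      have h1 := h.expand v
      rw [hnv, zero_smul, zero_add] at h1
      refine ⟨(-⟪b, v⟫) • a + ⟪a, v⟫ • b, fun h0 => hv ?_, ?_, ?_⟩
      · have e1 := congrArg (fun z => ⟪a, z⟫) h0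
        have e2 := congrArg (fun z => ⟪b, z⟫) h0
        simp only [inner_add_right, inner_smul_right, h.hv, h.hvw, h.hwv, h.hw,
          inner_zero_right] at e1 e2
        have e3 : ⟪b, v⟫ = 0 := by linarith
        have e4 : ⟪a, v⟫ = 0 := by linarith
        rw [h1, e3, e4]; simp
      · rw [inner_add_right, inner_smul_right, inner_smul_right, h.huv, h.huw]; ring
      · rw [inner_add_left, real_inner_smul_left, real_inner_smul_left]; ring
  refine (hasGerm_defect₁ hS n).odd_of_no_kink (w := w) ?_ fun t => ?_
  · intro r hr x
    simp only [defect₁, ← smul_neg, supp_smul (face_nonempty hS _) hr.le, absGerm_smul _ _ hr]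
    rw [mul_sub, Finset.mul_sum, mul_add]
    congr 1
    exact Finset.sum_congr rfl fun e _ => by ring
  · refine kink_defect₂ hS hC hn (fun h0 => hw0 ?_) ?_ v
    · have h1 := congrArg (fun z => ⟪w, z⟫) h0
      simp only [inner_add_right, inner_smul_right, hvw, mul_zero, add_zero,
        inner_zero_right] at h1
      exact inner_self_eq_zero.1 h1
    · rw [inner_add_right, inner_smul_right, hnw, hnv]; simp

lemma kink_defect₁ (hS : S.Nonempty)
    (hC : ∀ e m n, ON3 e m n → len S n m e + len S (-n) (-m) e = C e) {x : E3} (hx : x ≠ 0)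
    (w : E3) : kink (defect₁ S C) x w = 0 := by
  set r := ‖x‖ with hr
  have hr0 : 0 < r := norm_pos_iff.2 hx
  obtain ⟨n, hn⟩ : ∃ n, n = r⁻¹ • x := ⟨_, rfl⟩
  have hxn : x = r • n := by rw [hn, smul_smul, mul_inv_cancel₀ hr0.ne', one_smul]
  have hnn : ⟪n, n⟫ = 1 := by
    rw [hn, real_inner_smul_left, inner_smul_right, real_inner_self_eq_norm_sq, ← hr]
    field_simp
  have hscale : ∀ y, defect₁ S C x y = defect₁ S C n y := fun y => by
    simp only [defect₁, hxn, ← smul_neg, face_smul hS hr0, absGerm_smul_left _ _ hr0]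
  -- modulo multiples of `n` only the component of `w` orthogonal to `n` matters
  have hmod : ∀ (y : E3) (s : ℝ), defect₁ S C n (y + s • n) =
      defect₁ S C n y + s * defect S C n := by
    intro y s
    have e1 : -(y + s • n) = -y + s • (-n) := by module
    simp only [defect₁, defect, e1, supp_face_add_smul hS, absGerm_add_smul, mul_add,
      Finset.sum_add_distrib, mul_sub, Finset.mul_sum]
    have : ∑ e ∈ dirs S, C e / 4 * (s * |⟪e, n⟫|) = ∑ e ∈ dirs S, s * (C e / 4 * |⟪e, n⟫|) :=
      Finset.sum_congr rfl fun e _ => by ring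
    rw [this]
    ring
  have hv : ⟪n, w - ⟪n, w⟫ • n⟫ = 0 := by
    rw [inner_sub_right, inner_smul_right, hnn]; ring
  have h1 := hmod (w - ⟪n, w⟫ • n) ⟪n, w⟫
  have h2 := hmod (-(w - ⟪n, w⟫ • n)) (-⟪n, w⟫)
  rw [defect₁_odd hS hC hnn hv] at h2
  rw [sub_add_cancel] at h1
  have e2 : -(w - ⟪n, w⟫ • n) + (-⟪n, w⟫) • n = -w := by module
  rw [e2] at h2
  rw [kink, hscale, hscale, h1, h2]
  ring

/-- The width function is a sum of absolute values of linear functions: the difference has no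
kinks and is even. -/
lemma width_eq_sum (hS : S.Nonempty)
    (hC : ∀ e m n, ON3 e m n → len S n m e + len S (-n) (-m) e = C e) (x : E3) :
    supp S x + supp S (-x) = ∑ e ∈ dirs S, C e / 4 * |⟪e, x⟫| := by
  obtain ⟨w, hw0, hw⟩ := exists_orthogonal x
  have hodd : defect S C (-x) = -defect S C x := by
    refine (hasGerm_defect hS).odd_of_no_kink (w := w) ?_ fun t => ?_
    · intro r hr x
      simp only [defect, ← smul_neg, supp_smul hS hr.le, inner_smul_right, abs_mul, abs_of_pos hr]
      rw [mul_sub, Finset.mul_sum, mul_add]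
      congr 1
      exact Finset.sum_congr rfl fun e _ => by ring
    · refine kink_defect₁ hS hC (fun h0 => hw0 ?_) x
      have h1 := congrArg (fun z => ⟪w, z⟫) h0
      rw [real_inner_comm] at hw
      simp only [inner_add_right, inner_smul_right, hw, mul_zero, add_zero,
        inner_zero_right] at h1
      exact inner_self_eq_zero.1 h1
  have heven : defect S C (-x) = defect S C x := by
    simp only [defect, neg_neg, inner_neg_right, abs_neg]
    ring
  have h0 : defect S C x = 0 := by linarith
  rw [defect] at h0
  linarith

end Width

/-- The width function of a multiply tiling polytope is that of a zonotope. -/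
lemma exists_width_eq_sum {S : Finset E3} {k : ℕ} {Λ : E3 → ℕ} (hk : 0 < k)
    (ht : IsMultipleTiling k (convexHull ℝ (S : Set E3)) Λ) :
    ∃ (I : Finset E3) (g : E3 → E3), (∀ i ∈ I, g i ≠ 0) ∧
      ∀ x, supp S x + supp S (-x) = ∑ i ∈ I, |⟪g i, x⟫| := by
  classical
  have hS := nonempty_of_tiling hk ht
  obtain ⟨C, hC⟩ := exists_len_const hk ht
  have hC0 : ∀ e ∈ dirs S, 0 ≤ C e := by
    intro e he
    obtain ⟨v, w, h⟩ := exists_ON3 e (inner_self_of_mem_dirs he)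
    rw [← hC e v w h]
    exact add_nonneg (len_nonneg hS _ _ _) (len_nonneg hS _ _ _)
  refine ⟨(dirs S).filter fun e => C e ≠ 0, fun e => (C e / 4) • e, ?_, fun x => ?_⟩
  · intro e he h0
    rw [Finset.mem_filter] at he
    rcases smul_eq_zero.1 h0 with h | h
    · exact he.2 (by linarith)
    · have := inner_self_of_mem_dirs he.1
      simp [h] at this
  · rw [width_eq_sum hS hC, Finset.sum_filter]
    refine Finset.sum_congr rfl fun e he => ?_
    split_ifs with h
    · rw [real_inner_smul_left, abs_mul,
        abs_of_nonneg (by linarith [hC0 e he] : (0 : ℝ) ≤ C e / 4)]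
    · rw [not_not] at h
      simp [h]

/-! ### The area of a polygon in terms of its support function -/

/-- The sum of the values of the piecewise linear function `t ↦ Σ a τ |t - τ|` at its knots,
weighted by the coefficients `a τ`, which are half its kinks. -/
noncomputable def knotEnergy (T : Finset ℝ) (a : ℝ → ℝ) : ℝ :=
  ∑ τ ∈ T, ∑ σ ∈ T, a τ * a σ * |τ - σ|

lemma knotEnergy_insert {T : Finset ℝ} {b : ℝ} (hb : b ∉ T) (a : ℝ → ℝ) :
    knotEnergy (insert b T) a = knotEnergy T a + 2 * a b * ∑ τ ∈ T, a τ * |b - τ| := by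
  have h1 : ∑ τ ∈ T, a τ * a b * |τ - b| = a b * ∑ τ ∈ T, a τ * |b - τ| := by
    rw [Finset.mul_sum]
    exact Finset.sum_congr rfl fun τ _ => by rw [abs_sub_comm]; ring
  have h2 : ∑ τ ∈ T, a b * a τ * |b - τ| = a b * ∑ τ ∈ T, a τ * |b - τ| := by
    rw [Finset.mul_sum]
    exact Finset.sum_congr rfl fun τ _ => by ring
  unfold knotEnergy
  rw [Finset.sum_insert hb]
  simp only [Finset.sum_insert hb, Finset.sum_add_distrib]
  rw [h1, h2]
  simp
  ring

lemma sum_mul_abs_of_le {T : Finset ℝ} (a : ℝ → ℝ) {t : ℝ} (h : ∀ τ ∈ T, τ ≤ t) :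
    ∑ τ ∈ T, a τ * |t - τ| = (∑ τ ∈ T, a τ) * t - ∑ τ ∈ T, a τ * τ := by
  rw [Finset.sum_mul, ← Finset.sum_sub_distrib]
  exact Finset.sum_congr rfl fun τ hτ => by rw [abs_of_nonneg (by linarith [h τ hτ])]; ring

lemma sum_mul_abs_sub_le {T : Finset ℝ} {a : ℝ → ℝ} (ha : ∀ τ ∈ T, 0 ≤ a τ) (s t : ℝ) :
    ∑ τ ∈ T, a τ * |s - τ| - ∑ τ ∈ T, a τ * |t - τ| ≤ (∑ τ ∈ T, a τ) * |s - t| := by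
  rw [Finset.sum_mul, ← Finset.sum_sub_distrib]
  refine Finset.sum_le_sum fun τ hτ => ?_
  rw [← mul_sub]
  refine mul_le_mul_of_nonneg_left ?_ (ha τ hτ)
  have := abs_sub_abs_le_abs_sub (s - τ) (t - τ)
  simpa using this

/-- The concave conjugate of `t ↦ Σ a τ |t - τ|`: it is finite on `[-Σ a, Σ a]` and its integral
is `knotEnergy`. The knots are added in increasing order. -/
lemma exists_conjugate (T : Finset ℝ) (a : ℝ → ℝ) (ha : ∀ τ ∈ T, 0 ≤ a τ) :
    ∃ u : ℝ → ℝ, (∀ s y : ℝ, (∀ t, t * s + y ≤ ∑ τ ∈ T, a τ * |t - τ|) ↔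
        s ∈ Set.Icc (-∑ τ ∈ T, a τ) (∑ τ ∈ T, a τ) ∧ y ≤ u s) ∧
      IntervalIntegrable u volume (-∑ τ ∈ T, a τ) (∑ τ ∈ T, a τ) ∧
      ∫ s in (-∑ τ ∈ T, a τ)..(∑ τ ∈ T, a τ), u s = knotEnergy T a := by
  induction T using Finset.induction_on_max with
  | empty =>
    refine ⟨0, fun s y => ?_, by simp, by simp [knotEnergy]⟩
    simp only [Finset.sum_empty, neg_zero, Set.Icc_self, Set.mem_singleton_iff, Pi.zero_apply]
    constructor
    · intro h
      have h0 := h 0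
      have h1 := h ((1 - y) / s)
      refine ⟨?_, by linarith⟩
      by_contra hs
      rw [div_mul_cancel₀ _ hs] at h1
      linarith
    · rintro ⟨rfl, h⟩ t
      simpa using h
  | insert b T hb ih =>
    have hbT : b ∉ T := fun h => lt_irrefl _ (hb b h)
    obtain ⟨u, hu, hint, hval⟩ := ih fun τ hτ => ha τ (Finset.mem_insert_of_mem hτ)
    have haT : ∀ τ ∈ T, 0 ≤ a τ := fun τ hτ => ha τ (Finset.mem_insert_of_mem hτ)
    have hab : 0 ≤ a b := ha b (Finset.mem_insert_self _ _)
    have hA : 0 ≤ ∑ τ ∈ T, a τ := Finset.sum_nonneg haT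
    have hlip := fun s t => sum_mul_abs_sub_le haT s t
    have hbig := fun t (h : ∀ τ ∈ T, τ ≤ t) => sum_mul_abs_of_le a h
    simp only [Finset.sum_insert hbT, knotEnergy_insert hbT]
    set A := ∑ τ ∈ T, a τ
    set h := fun t => ∑ τ ∈ T, a τ * |t - τ| with hh
    have hb' : ∀ t, b ≤ t → h t = h b + A * (t - b) := fun t hbt => by
      have e1 := hbig t fun τ hτ => (hb τ hτ).le.trans hbt
      have e2 := hbig b fun τ hτ => (hb τ hτ).le
      simp only [hh, e1, e2]; ring
    have hlip' : ∀ s t, h s - h t ≤ A * |s - t| := hlip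
    change (∀ s y : ℝ, (∀ t, t * s + y ≤ h t) ↔ s ∈ Set.Icc (-A) A ∧ y ≤ u s) at hu
    change ∃ v : ℝ → ℝ, (∀ s y : ℝ, (∀ t, t * s + y ≤ a b * |t - b| + h t) ↔
        s ∈ Set.Icc (-(a b + A)) (a b + A) ∧ y ≤ v s) ∧
      IntervalIntegrable v volume (-(a b + A)) (a b + A) ∧
      ∫ s in (-(a b + A))..(a b + A), v s = knotEnergy T a + 2 * a b * h b
    clear_value A h
    set v : ℝ → ℝ := fun s => if s ≤ A - a b then a b * b + u (s + a b) else h b - b * s with hv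
    have hshift : IntervalIntegrable (fun s => a b * b + u (s + a b)) volume (-(a b + A))
        (A - a b) := by
      refine intervalIntegrable_const.add ?_
      have := hint.comp_add_right (a b)
      convert this using 1
      ring
    have hlin : IntervalIntegrable (fun s => h b - b * s) volume (A - a b) (a b + A) :=
      (by fun_prop : Continuous fun s : ℝ => h b - b * s).intervalIntegrable _ _
    have hc1 : Set.EqOn (fun s => a b * b + u (s + a b)) v (Set.uIoc (-(a b + A)) (A - a b)) := by
      intro s hs
      rw [Set.uIoc_of_le (by linarith)] at hs
      simp only [hv, if_pos hs.2]
    have hc2 : Set.EqOn (fun s => h b - b * s) v (Set.uIoc (A - a b) (a b + A)) := by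
      intro s hs
      rw [Set.uIoc_of_le (by linarith)] at hs
      simp only [hv, if_neg (not_le.2 hs.1)]
    have hi1 : IntervalIntegrable v volume (-(a b + A)) (A - a b) := hshift.congr hc1
    have hi2 : IntervalIntegrable v volume (A - a b) (a b + A) := hlin.congr hc2
    refine ⟨v, fun s y => ?_, hi1.trans hi2, ?_⟩
    · constructor
      · intro H
        have hs1 : s ≤ a b + A := by
          by_contra! hs
          -- far to the right the slope of the right-hand side is `a b + A`
          have h1 := H (b + (|h b - b * s - y| + 1) / (s - (a b + A)))
          have hpos : 0 < s - (a b + A) := by linarith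
          have hq : 0 < (|h b - b * s - y| + 1) / (s - (a b + A)) := by positivity
          rw [hb' (b + (|h b - b * s - y| + 1) / (s - (a b + A))) (by linarith),
            add_sub_cancel_left, abs_of_pos hq] at h1
          have h2 : (|h b - b * s - y| + 1) / (s - (a b + A)) * (s - (a b + A)) =
            |h b - b * s - y| + 1 := div_mul_cancel₀ _ hpos.ne'
          have h3 := le_abs_self (h b - b * s - y)
          nlinarith
        have hs2 : -(a b + A) ≤ s := by
          by_contra! hs
          have h1 := H (b - (|h b - b * s - y| + 1) / (-s - (a b + A)))
          have hpos : 0 < -s - (a b + A) := by linarith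
          have hq : 0 < (|h b - b * s - y| + 1) / (-s - (a b + A)) := by positivity
          have h4 := hlip' (b - (|h b - b * s - y| + 1) / (-s - (a b + A))) b
          rw [sub_sub_cancel_left, abs_neg, abs_of_pos hq] at h1 h4
          have h2 : (|h b - b * s - y| + 1) / (-s - (a b + A)) * (-s - (a b + A)) =
            |h b - b * s - y| + 1 := div_mul_cancel₀ _ hpos.ne'
          have h3 := le_abs_self (h b - b * s - y)
          nlinarith
        refine ⟨⟨hs2, hs1⟩, ?_⟩
        simp only [hv]
        split_ifs with hs
        · have : ∀ t, t * (s + a b) + (y - a b * b) ≤ h t := by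
            intro t
            rcases le_total t b with htb | htb
            · have := H t
              rw [abs_of_nonpos (by linarith)] at this
              linarith
            · have h1 := H b
              rw [sub_self, abs_zero, mul_zero, zero_add] at h1
              rw [hb' t htb]
              nlinarith
          linarith [((hu _ _).1 this).2]
        · have h1 := H b
          rw [sub_self, abs_zero, mul_zero, zero_add] at h1
          linarith
      · rintro ⟨⟨hs2, hs1⟩, hy⟩ t
        simp only [hv] at hy
        split_ifs at hy with hs
        · have h1 := (hu (s + a b) (y - a b * b)).2 ⟨⟨by linarith, by linarith⟩, by linarith⟩ t
          have h2 := mul_le_mul_of_nonneg_left (neg_abs_le (t - b)) hab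
          nlinarith
        · rw [not_le] at hs
          rcases le_total t b with htb | htb
          · have h1 := hlip' b t
            rw [abs_of_nonneg (by linarith)] at h1
            rw [abs_of_nonpos (by linarith)]
            nlinarith
          · rw [hb' t htb, abs_of_nonneg (by linarith)]
            nlinarith
    · rw [← intervalIntegral.integral_add_adjacent_intervals hi1 hi2,
        ← intervalIntegral.integral_congr_ae (Eventually.of_forall hc1),
        ← intervalIntegral.integral_congr_ae (Eventually.of_forall hc2),
        intervalIntegral.integral_add intervalIntegrable_const
          (by have := hint.comp_add_right (a b); convert this using 1; ring),
        intervalIntegral.integral_comp_add_right, intervalIntegral.integral_sub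
          intervalIntegrable_const ((by fun_prop : Continuous fun s : ℝ => b * s).intervalIntegrable
            _ _), intervalIntegral.integral_const_mul, intervalIntegral.integral_const_mul, integral_id,
        intervalIntegral.integral_const, intervalIntegral.integral_const,
        show -(a b + A) + a b = -A by ring, show A - a b + a b = A by ring, hval]
      simp only [smul_eq_mul]
      ring

lemma volume_eq_knotEnergy {T : Finset ℝ} {a a' : ℝ → ℝ} (ha : ∀ τ ∈ T, 0 ≤ a τ)
    (ha' : ∀ τ ∈ T, 0 ≤ a' τ) (h0 : ∑ τ ∈ T, a τ = ∑ τ ∈ T, a' τ)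
    (h1 : ∑ τ ∈ T, a τ * τ = ∑ τ ∈ T, a' τ * τ) :
    volume {p : ℝ × ℝ | ∀ t, t * p.1 + p.2 ≤ ∑ τ ∈ T, a τ * |t - τ| ∧
      -(t * p.1 + p.2) ≤ ∑ τ ∈ T, a' τ * |t - τ|} =
    ENNReal.ofReal (knotEnergy T a + knotEnergy T a') := by
  obtain ⟨u, hu, hui, huv⟩ := exists_conjugate T a ha
  obtain ⟨u', hu', hui', huv'⟩ := exists_conjugate T a' ha'
  rw [← h0] at hu' hui' huv'
  have hA : 0 ≤ ∑ τ ∈ T, a τ := Finset.sum_nonneg ha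
  have hpos : ∀ s ∈ Set.Icc (-∑ τ ∈ T, a τ) (∑ τ ∈ T, a τ), 0 ≤ u s + u' (-s) := by
    intro s hs
    -- the chord above `s` contains a point of the segment joining the two extremal points
    set y := -(s * ((∑ τ ∈ T, a τ * τ) / ∑ τ ∈ T, a τ)) with hy
    have key : ∀ t : ℝ, |t * s + y| ≤ |∑ τ ∈ T, a τ * (t - τ)| := by
      intro t
      have e1 : ∑ τ ∈ T, a τ * (t - τ) = (∑ τ ∈ T, a τ) * t - ∑ τ ∈ T, a τ * τ := by
        rw [Finset.sum_mul, ← Finset.sum_sub_distrib]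
        exact Finset.sum_congr rfl fun _ _ => by ring
      rcases hA.eq_or_lt with h | h
      · have : s = 0 := by rw [← h] at hs; simpa using hs
        simp [hy, this]
      · have e2 : t * s + y = s / (∑ τ ∈ T, a τ) * ∑ τ ∈ T, a τ * (t - τ) := by
          rw [e1, hy]; field_simp; ring
        rw [e2, abs_mul]
        refine mul_le_of_le_one_left (abs_nonneg _) ?_
        rw [abs_div, abs_of_pos h]
        exact (div_le_one h).2 (abs_le.2 hs)
    have bound : ∀ (c : ℝ → ℝ), (∀ τ ∈ T, 0 ≤ c τ) → ∀ t : ℝ,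
        |∑ τ ∈ T, c τ * (t - τ)| ≤ ∑ τ ∈ T, c τ * |t - τ| := by
      intro c hc t
      refine (Finset.abs_sum_le_sum_abs _ _).trans (Finset.sum_le_sum fun τ hτ => ?_)
      rw [abs_mul, abs_of_nonneg (hc τ hτ)]
    have heq : ∀ t : ℝ, ∑ τ ∈ T, a τ * (t - τ) = ∑ τ ∈ T, a' τ * (t - τ) := by
      intro t
      simp only [mul_sub, Finset.sum_sub_distrib, ← Finset.sum_mul, h0, h1]
    have h2 := ((hu s y).1 fun t => (le_abs_self _).trans ((key t).trans (bound a ha t))).2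
    have h3 := ((hu' (-s) (-y)).1 fun t => by
      have := (neg_le_abs _).trans ((key t).trans (heq t ▸ bound a' ha' t))
      linarith).2
    linarith
  have hclosed : IsClosed {p : ℝ × ℝ | ∀ t, t * p.1 + p.2 ≤ ∑ τ ∈ T, a τ * |t - τ| ∧
      -(t * p.1 + p.2) ≤ ∑ τ ∈ T, a' τ * |t - τ|} := by
    rw [Set.ofPred_forall]
    refine isClosed_iInter fun t => ?_
    exact (isClosed_le (f := fun p : ℝ × ℝ => t * p.1 + p.2) (by fun_prop) continuous_const).inter
      (isClosed_le (f := fun p : ℝ × ℝ => -(t * p.1 + p.2)) (by fun_prop) continuous_const)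
  have hmem : ∀ s y : ℝ, (∀ t, t * s + y ≤ ∑ τ ∈ T, a τ * |t - τ| ∧
      -(t * s + y) ≤ ∑ τ ∈ T, a' τ * |t - τ|) ↔
      s ∈ Set.Icc (-∑ τ ∈ T, a τ) (∑ τ ∈ T, a τ) ∧ y ∈ Set.Icc (-u' (-s)) (u s) := by
    intro s y
    rw [forall_and, hu]
    have : (∀ t, -(t * s + y) ≤ ∑ τ ∈ T, a' τ * |t - τ|) ↔
        ∀ t, t * -s + -y ≤ ∑ τ ∈ T, a' τ * |t - τ| :=
      forall_congr' fun t => by rw [show t * -s + -y = -(t * s + y) by ring]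
    rw [this, hu']
    simp only [Set.mem_Icc]
    constructor
    · rintro ⟨⟨h1, h2⟩, _, h4⟩; exact ⟨h1, by linarith, h2⟩
    · rintro ⟨h1, h2, h3⟩; exact ⟨⟨h1, h3⟩, ⟨by linarith [h1.2], by linarith [h1.1]⟩, by linarith⟩
  have hui'' : IntervalIntegrable (fun s => u' (-s)) volume (-∑ τ ∈ T, a τ) (∑ τ ∈ T, a τ) := by
    have := hui'.comp_mul_left (c := -1)
    simp only [neg_mul, one_mul, div_neg, div_one, neg_neg] at this
    exact this.symm
  rw [Measure.volume_eq_prod, Measure.prod_apply hclosed.measurableSet]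
  have hslice : ∀ s : ℝ, volume (Prod.mk s ⁻¹' {p : ℝ × ℝ | ∀ t,
      t * p.1 + p.2 ≤ ∑ τ ∈ T, a τ * |t - τ| ∧ -(t * p.1 + p.2) ≤ ∑ τ ∈ T, a' τ * |t - τ|}) =
      (Set.Icc (-∑ τ ∈ T, a τ) (∑ τ ∈ T, a τ)).indicator
        (fun s => ENNReal.ofReal (u s + u' (-s))) s := by
    intro s
    have : Prod.mk s ⁻¹' {p : ℝ × ℝ | ∀ t,
        t * p.1 + p.2 ≤ ∑ τ ∈ T, a τ * |t - τ| ∧ -(t * p.1 + p.2) ≤ ∑ τ ∈ T, a' τ * |t - τ|} =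
        {y | s ∈ Set.Icc (-∑ τ ∈ T, a τ) (∑ τ ∈ T, a τ) ∧ y ∈ Set.Icc (-u' (-s)) (u s)} := by
      ext y
      exact hmem s y
    rw [this]
    by_cases hs : s ∈ Set.Icc (-∑ τ ∈ T, a τ) (∑ τ ∈ T, a τ)
    · rw [Set.indicator_of_mem hs]
      simp only [hs, true_and]
      change volume (Set.Icc (-u' (-s)) (u s)) = _
      rw [Real.volume_Icc, sub_neg_eq_add]
    · rw [Set.indicator_of_notMem hs]
      simp [hs]
  simp only [hslice]
  rw [lintegral_indicator measurableSet_Icc, setLIntegral_congr Ioc_ae_eq_Icc.symm,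
    ← ofReal_integral_eq_lintegral_ofReal]
  · congr 1
    rw [← intervalIntegral.integral_of_le (by linarith), intervalIntegral.integral_add hui hui'',
      huv, intervalIntegral.integral_comp_neg, neg_neg, huv']
  · exact (intervalIntegrable_iff_integrableOn_Ioc_of_le (by linarith)).1 (hui.add hui'')
  · refine (ae_restrict_iff' measurableSet_Ioc).2 (Eventually.of_forall fun s hs => ?_)
    exact hpos s (Set.Ioc_subset_Icc_self hs)

/-! ### The relation between kinks given by equal areas of opposite facets -/

lemma eventually_supp_add_smul {F : Finset E3} (hF : F.Nonempty) (e m : E3) :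
    ∀ᶠ t : ℝ in atTop, supp F (m + t • e) = t * supp F e + supp (face F e) m := by
  filter_upwards [tendsto_inv_atTop_nhdsGT_zero.eventually (eventually_face_add hF e m),
    eventually_gt_atTop 0] with t h ht
  have : m + t • e = t • (e + t⁻¹ • m) := by
    rw [smul_add, smul_smul, mul_inv_cancel₀ ht.ne', one_smul, add_comm]
  rw [this, supp_smul hF ht.le, h.2]
  field_simp

lemma eq_of_eventually_eq_affine {p q r s : ℝ} (h : ∀ᶠ t : ℝ in atTop, q * t + p = r * t + s) :
    q = r ∧ p = s := by
  obtain ⟨M, hM⟩ := eventually_atTop.1 h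
  have h1 := hM M le_rfl
  have h2 := hM (M + 1) (by linarith)
  have h3 : q = r := by linarith
  exact ⟨h3, by rw [h3] at h1; linarith⟩

/-- Half the kink of the support function of `F` at `m + t • e`, in direction `e`. -/
noncomputable def sideLen (F : Finset E3) (e m : E3) (t : ℝ) : ℝ :=
  (supp (face F (m + t • e)) e + supp (face F (m + t • e)) (-e)) / 2

lemma sideLen_nonneg {F : Finset E3} (hF : F.Nonempty) (e m : E3) (t : ℝ) :
    0 ≤ sideLen F e m t :=
  div_nonneg (supp_neg_le (face_nonempty hF _) e) zero_le_two

lemma sideLen_neg (F : Finset E3) (e m : E3) (t : ℝ) :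
    sideLen F (-e) (-m) t =
      (supp (face F (-(m + t • e))) e + supp (face F (-(m + t • e))) (-e)) / 2 := by
  rw [sideLen, smul_neg, ← neg_add, neg_neg, add_comm]

lemma exists_supp_eq_sum {F : Finset E3} (hF : F.Nonempty) {e m : E3} {T : Finset ℝ}
    (hT : ∀ t ∉ T, sideLen F e m t = 0) :
    ∃ α β : ℝ, ∀ t, supp F (m + t • e) =
      α + β * t + ∑ τ ∈ T, sideLen F e m τ * |t - τ| :=
  ((hasGerm_supp hF).hasGerm1 m e).exists_eq_sum_abs T fun t ht => by
    have := hT t ht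
    rw [sideLen] at this
    linarith

/-- The support function of a polygon, in the chart `t ↦ m + t • e` and its opposite. When `e` and
`-e` are not normal to a side, the two representations have opposite affine parts. -/
lemma exists_supp_eq_sum_of_smooth {F : Finset E3} (hF : F.Nonempty) {e m : E3} {T : Finset ℝ}
    (hT : ∀ t ∉ T, sideLen F e m t = 0) (hT' : ∀ t ∉ T, sideLen F (-e) (-m) t = 0)
    (h₁ : supp (face F e) m + supp (face F e) (-m) = 0)
    (h₂ : supp (face F (-e)) m + supp (face F (-e)) (-m) = 0) :
    (∃ α β : ℝ, (∀ t, supp F (m + t • e) = α + β * t + ∑ τ ∈ T, sideLen F e m τ * |t - τ|) ∧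
      ∀ t, supp F (-(m + t • e)) =
        -(α + β * t) + ∑ τ ∈ T, sideLen F (-e) (-m) τ * |t - τ|) ∧
    ∑ τ ∈ T, sideLen F e m τ = ∑ τ ∈ T, sideLen F (-e) (-m) τ ∧
    ∑ τ ∈ T, sideLen F e m τ * τ = ∑ τ ∈ T, sideLen F (-e) (-m) τ * τ := by
  obtain ⟨α, β, h⟩ := exists_supp_eq_sum hF hT
  obtain ⟨α', β', h'⟩ := exists_supp_eq_sum hF hT'
  obtain ⟨M, hM⟩ : ∃ M, ∀ τ ∈ T, |τ| ≤ M := by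
    obtain ⟨M, hM⟩ := (T.finite_toSet.image abs).bddAbove
    exact ⟨M, fun τ hτ => hM ⟨τ, hτ, rfl⟩⟩
  have hp : ∀ (c : ℝ → ℝ) (t : ℝ), M ≤ t →
      ∑ τ ∈ T, c τ * |t - τ| = (∑ τ ∈ T, c τ) * t - ∑ τ ∈ T, c τ * τ := fun c t ht =>
    sum_mul_abs_of_le c fun τ hτ => (le_abs_self τ).trans ((hM τ hτ).trans ht)
  have hn : ∀ (c : ℝ → ℝ) (t : ℝ), M ≤ t →
      ∑ τ ∈ T, c τ * |-t - τ| = (∑ τ ∈ T, c τ) * t + ∑ τ ∈ T, c τ * τ := by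
    intro c t ht
    rw [Finset.sum_mul, ← Finset.sum_add_distrib]
    refine Finset.sum_congr rfl fun τ hτ => ?_
    have := (neg_le_abs τ).trans ((hM τ hτ).trans ht)
    rw [abs_of_nonpos (by linarith)]
    ring
  obtain ⟨a1, a2⟩ := eq_of_eventually_eq_affine (p := α - ∑ τ ∈ T, sideLen F e m τ * τ)
      (q := β + ∑ τ ∈ T, sideLen F e m τ) (r := supp F e) (s := supp (face F e) m) (by
    filter_upwards [eventually_supp_add_smul hF e m, eventually_ge_atTop M] with t e1 ht
    rw [h, hp _ t ht] at e1
    linarith)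
  obtain ⟨b1, b2⟩ := eq_of_eventually_eq_affine (p := α + ∑ τ ∈ T, sideLen F e m τ * τ)
      (q := -β + ∑ τ ∈ T, sideLen F e m τ) (r := supp F (-e)) (s := supp (face F (-e)) m) (by
    filter_upwards [eventually_supp_add_smul hF (-e) m, eventually_ge_atTop M] with t e1 ht
    rw [smul_neg, ← neg_smul, h, hn _ t ht] at e1
    linarith)
  obtain ⟨c1, c2⟩ := eq_of_eventually_eq_affine (p := α' - ∑ τ ∈ T, sideLen F (-e) (-m) τ * τ)
      (q := β' + ∑ τ ∈ T, sideLen F (-e) (-m) τ) (r := supp F (-e))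
      (s := supp (face F (-e)) (-m)) (by
    filter_upwards [eventually_supp_add_smul hF (-e) (-m), eventually_ge_atTop M] with t e1 ht
    rw [h', hp _ t ht] at e1
    linarith)
  obtain ⟨d1, d2⟩ := eq_of_eventually_eq_affine (p := α' + ∑ τ ∈ T, sideLen F (-e) (-m) τ * τ)
      (q := -β' + ∑ τ ∈ T, sideLen F (-e) (-m) τ) (r := supp F e)
      (s := supp (face F e) (-m)) (by
    filter_upwards [eventually_supp_add_smul hF e (-m), eventually_ge_atTop M] with t e1 ht
    have : -m + t • e = -m + (-t) • (-e) := by module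
    rw [this, h', hn _ t ht] at e1
    linarith)
  refine ⟨⟨α, β, h, fun t => ?_⟩, by linarith, by linarith⟩
  have : -(m + t • e) = -m + t • (-e) := by module
  rw [this, h']
  have e1 : α' = -α := by linarith
  have e2 : β' = -β := by linarith
  rw [e1, e2]
  ring

lemma mem_convexHull_iff_chart {F : Finset E3} (hF : F.Nonempty) {e m n : E3} (h : ON3 e m n)
    {c : ℝ} (hn : ∀ s ∈ F, ⟪n, s⟫ = c) (z : E3) :
    z ∈ convexHull ℝ (F : Set E3) ↔ ⟪n, z⟫ = c ∧ ∀ t : ℝ,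
      ⟪m + t • e, z⟫ ≤ supp F (m + t • e) ∧ ⟪-(m + t • e), z⟫ ≤ supp F (-(m + t • e)) := by
  rw [mem_convexHull_iff_supp hF]
  constructor
  · refine fun hz => ⟨?_, fun t => ⟨hz _, hz _⟩⟩
    have h1 := supp_add_of_const hF hn 0
    have h2 := supp_add_of_const hF (x := -n) (c := -c) (fun t ht => by
      rw [inner_neg_left, hn t ht]) 0
    rw [zero_add, supp_zero hF, zero_add] at h1 h2
    have h3 := hz n
    have h4 := hz (-n)
    rw [inner_neg_left] at h4
    linarith
  · rintro ⟨hz, H⟩ y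
    -- directions `p • m + q • e` with `p ≠ 0` are multiples of chart points
    have H1 : ∀ p q : ℝ, p ≠ 0 → ⟪p • m + q • e, z⟫ ≤ supp F (p • m + q • e) := by
      intro p q hp
      rcases lt_or_gt_of_ne hp with hp | hp
      · have e1 : p • m + q • e = (-p) • (-(m + (q / p) • e)) := by
          rw [neg_smul_neg, smul_add, smul_smul, mul_div_cancel₀ _ hp.ne]
        rw [e1, supp_smul hF (by linarith), real_inner_smul_left]
        exact mul_le_mul_of_nonneg_left (H _).2 (by linarith)
      · have e1 : p • m + q • e = p • (m + (q / p) • e) := by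
          rw [smul_add, smul_smul, mul_div_cancel₀ _ hp.ne']
        rw [e1, supp_smul hF hp.le, real_inner_smul_left]
        exact mul_le_mul_of_nonneg_left (H _).1 hp.le
    have H2 : ∀ p q : ℝ, ⟪p • m + q • e, z⟫ ≤ supp F (p • m + q • e) := by
      intro p q
      by_cases hp : p = 0
      · have hc : Continuous fun ε : ℝ => supp F (ε • m + q • e) - ⟪ε • m + q • e, z⟫ := by
          have := continuous_supp F
          fun_prop
        have h1 := (hc.tendsto 0).mono_left (nhdsWithin_le_nhds (s := Set.Ioi 0))
        have h2 := ge_of_tendsto h1 (b := 0) (by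
          filter_upwards [self_mem_nhdsWithin] with ε (hε : 0 < ε)
          linarith [H1 ε q hε.ne'])
        rw [hp]
        linarith
      · exact H1 p q hp
    have e1 : y = (⟪m, y⟫ • m + ⟪e, y⟫ • e) + ⟪n, y⟫ • n := by
      rw [add_comm (⟪m, y⟫ • m)]; exact h.expand y
    have e2 : supp F y = supp F (⟪m, y⟫ • m + ⟪e, y⟫ • e) + ⟪n, y⟫ * c := by
      conv_lhs => rw [e1]
      refine supp_add_of_const hF (fun t ht => ?_) _
      rw [real_inner_smul_left, hn t ht]
    rw [e2]
    conv_lhs => rw [e1]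
    rw [inner_add_left, real_inner_smul_left _ _ ⟪n, y⟫, hz]
    linarith [H2 ⟪m, y⟫ ⟪e, y⟫]

lemma ON3.volume_preimage {e m n : E3} (h : ON3 e m n) {K : Set (ℝ × ℝ)} (hK : MeasurableSet K)
    (c : ℝ) : volume {y : E3 | (⟪e, y⟫, ⟪m, y⟫) ∈ K ∧ ⟪n, y⟫ ∈ Set.Icc c (c + 1)} = volume K := by
  have h1 := (PiLp.volume_preserving_ofLp (Fin 3)).comp h.basis.measurePreserving_repr
  have h2 := (volume_preserving_piFinSuccAbove (fun _ : Fin 3 => ℝ) 2).comp h1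
  have h3 := ((MeasurePreserving.id (volume : Measure ℝ)).prod
    (volume_preserving_piFinTwo fun _ : Fin 2 => ℝ)).comp h2
  have hset : {y : E3 | (⟪e, y⟫, ⟪m, y⟫) ∈ K ∧ ⟪n, y⟫ ∈ Set.Icc c (c + 1)} =
      (Prod.map id (MeasurableEquiv.piFinTwo fun _ : Fin 2 => ℝ) ∘
        (MeasurableEquiv.piFinSuccAbove (fun _ : Fin 3 => ℝ) 2) ∘
        (WithLp.ofLp ∘ h.basis.repr)) ⁻¹' (Set.Icc c (c + 1) ×ˢ K) := by
    ext y
    have e0 : (h.basis.repr y).ofLp 0 = ⟪e, y⟫ := by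
      rw [OrthonormalBasis.repr_apply_apply]; simp [ON3.basis]
    have e1 : (h.basis.repr y).ofLp 1 = ⟪m, y⟫ := by
      rw [OrthonormalBasis.repr_apply_apply]; simp [ON3.basis]
    have e2 : (h.basis.repr y).ofLp 2 = ⟪n, y⟫ := by
      rw [OrthonormalBasis.repr_apply_apply]; simp [ON3.basis]
    simp only [Set.mem_ofPred_eq, Set.mem_preimage, Function.comp_apply, Set.mem_prod, Prod.map]
    change _ ↔ (h.basis.repr y).ofLp 2 ∈ _ ∧ ((h.basis.repr y).ofLp 0, (h.basis.repr y).ofLp 1) ∈ K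
    rw [e0, e1, e2]
    tauto
  rw [hset]
  rw [h3.measure_preimage (measurableSet_Icc.prod hK).nullMeasurableSet]
  rw [Measure.prod_prod, Real.volume_Icc]
  simp

/-- The area of a polygon, as the volume of the prism of height one over it, when neither `e` nor
`-e` is the outer normal of a side. -/
lemma volume_thick_eq_knotEnergy {F : Finset E3} (hF : F.Nonempty) {e m n : E3} (h : ON3 e m n)
    {c : ℝ} (hn : ∀ s ∈ F, ⟪n, s⟫ = c) {T : Finset ℝ}
    (hT : ∀ t ∉ T, sideLen F e m t = 0) (hT' : ∀ t ∉ T, sideLen F (-e) (-m) t = 0)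
    (h₁ : supp (face F e) m + supp (face F e) (-m) = 0)
    (h₂ : supp (face F (-e)) m + supp (face F (-e)) (-m) = 0) :
    volume (thick (convexHull ℝ (F : Set E3)) n) = ENNReal.ofReal
      (knotEnergy T (sideLen F e m) + knotEnergy T (sideLen F (-e) (-m))) := by
  obtain ⟨⟨α, β, r1, r2⟩, s1, s2⟩ := exists_supp_eq_sum_of_smooth hF hT hT' h₁ h₂
  rw [← volume_eq_knotEnergy (fun τ _ => sideLen_nonneg hF e m τ)
    (fun τ _ => sideLen_nonneg hF _ _ τ) s1 s2]
  set K := {p : ℝ × ℝ | ∀ t, t * p.1 + p.2 ≤ ∑ τ ∈ T, sideLen F e m τ * |t - τ| ∧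
      -(t * p.1 + p.2) ≤ ∑ τ ∈ T, sideLen F (-e) (-m) τ * |t - τ|} with hK
  have hclosed : IsClosed K := by
    rw [hK, Set.ofPred_forall]
    refine isClosed_iInter fun t => ?_
    exact (isClosed_le (f := fun p : ℝ × ℝ => t * p.1 + p.2) (by fun_prop) continuous_const).inter
      (isClosed_le (f := fun p : ℝ × ℝ => -(t * p.1 + p.2)) (by fun_prop) continuous_const)
  have hshift : volume ((fun p : ℝ × ℝ => p - (β, α)) ⁻¹' K) = volume K := by
    simp only [sub_eq_add_neg]
    exact measure_preimage_add_right volume _ K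
  rw [← hshift, ← h.volume_preimage (hclosed.measurableSet.preimage (by fun_prop)) c]
  congr 1
  ext y
  simp only [mem_thick, mem_convexHull_iff_chart hF h hn]
  have hin : ∀ (t : ℝ) (w : E3), ⟪m + t • e, w⟫ = ⟪m, w⟫ + t * ⟪e, w⟫ := fun t w => by
    rw [inner_add_left, real_inner_smul_left]
  have key : (∀ t : ℝ, ⟪m + t • e, y⟫ ≤ supp F (m + t • e) ∧
      ⟪-(m + t • e), y⟫ ≤ supp F (-(m + t • e))) ↔ (⟪e, y⟫, ⟪m, y⟫) - (β, α) ∈ K := by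
    change _ ↔ ∀ t, _
    refine forall_congr' fun t => ?_
    rw [r1, r2, inner_neg_left, hin]
    simp only [Prod.mk_sub_mk]
    constructor <;> rintro ⟨h1, h2⟩ <;> constructor <;> linarith
  change _ ↔ (⟪e, y⟫, ⟪m, y⟫) - (β, α) ∈ K ∧ ⟪n, y⟫ ∈ Set.Icc c (c + 1)
  rw [← key]
  have hx : ∀ (s t : ℝ), ⟪m + t • e, y - s • n⟫ = ⟪m + t • e, y⟫ := fun s t => by
    rw [inner_sub_right, inner_smul_right, hin t n, h.hvw, h.huw]
    ring
  simp only [inner_neg_left, hx]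
  constructor
  · rintro ⟨s, hs, h1, h2⟩
    rw [inner_sub_right, inner_smul_right, h.hw] at h1
    exact ⟨h2, by linarith [hs.1], by linarith [hs.2]⟩
  · rintro ⟨h1, h2⟩
    refine ⟨⟪n, y⟫ - c, ⟨by linarith [h2.1], by linarith [h2.2]⟩, ?_, h1⟩
    rw [inner_sub_right, inner_smul_right, h.hw]
    ring

lemma exists_ON3_generic {n : E3} (hn : ⟪n, n⟫ = 1) (J : Finset E3) (hJ : ∀ g ∈ J, g ≠ 0)
    (hJn : ∀ g ∈ J, ⟪g, n⟫ = 0) : ∃ e m, ON3 e m n ∧ ∀ g ∈ J, ⟪g, e⟫ ≠ 0 := by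
  classical
  obtain ⟨v, w, h⟩ := exists_ON3 n hn
  obtain ⟨s, hs⟩ := Infinite.exists_notMem_finset (J.image fun g => -(⟪g, v⟫ / ⟪g, w⟫))
  have hpos : 0 < 1 + s ^ 2 := by positivity
  have hr : (√(1 + s ^ 2))⁻¹ ^ 2 * (1 + s ^ 2) = 1 := by
    rw [inv_pow, Real.sq_sqrt hpos.le, inv_mul_cancel₀ hpos.ne']
  have hr0 : (√(1 + s ^ 2))⁻¹ ≠ 0 := inv_ne_zero (Real.sqrt_pos.2 hpos).ne'
  set r := (√(1 + s ^ 2))⁻¹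
  refine ⟨r • (v + s • w), r • (w - s • v), ⟨?_, ?_, hn, ?_, ?_, ?_⟩, ?_⟩
  · simp only [inner_add_left, inner_add_right, real_inner_smul_left, inner_smul_right, h.hv,
      h.hw, h.hvw, h.hwv]
    linarith
  · simp only [inner_sub_left, inner_sub_right, real_inner_smul_left, inner_smul_right, h.hv,
      h.hw, h.hvw, h.hwv]
    linarith
  · simp only [inner_add_left, inner_sub_right, real_inner_smul_left, inner_smul_right, h.hv,
      h.hw, h.hvw, h.hwv]
    ring
  · simp only [inner_add_left, real_inner_smul_left, h.hvu, h.hwu]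
    ring
  · simp only [inner_sub_left, real_inner_smul_left, h.hvu, h.hwu]
    ring
  · intro g hg h0
    rw [inner_smul_right, inner_add_right, inner_smul_right] at h0
    have h1 := (mul_eq_zero.1 h0).resolve_left hr0
    by_cases hw : ⟪g, w⟫ = 0
    · rw [hw, mul_zero, add_zero] at h1
      apply hJ g hg
      rw [h.expand g, real_inner_comm, hJn g hg, real_inner_comm, h1, real_inner_comm, hw]
      simp
    · refine hs (Finset.mem_image.2 ⟨g, hg, ?_⟩)
      field_simp
      linarith

/-- The difference of the support functions of `S` and `-S`. -/
noncomputable def asym (S : Finset E3) (x : E3) : ℝ := supp S x - supp S (-x)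

/-- The germ of `asym`. -/
noncomputable def asym₁ (S : Finset E3) (x y : E3) : ℝ :=
  supp (face S x) y - supp (face S (-x)) (-y)

lemma hasGerm_asym {S : Finset E3} (hS : S.Nonempty) : HasGerm (asym S) (asym₁ S) :=
  (hasGerm_supp hS).sub (hasGerm_supp hS).comp_neg

lemma kink_asym₁_smul {S : Finset E3} (hS : S.Nonempty) (n x : E3) (r : ℝ) :
    kink (asym₁ S) n (r • x) = |r| * kink (asym₁ S) n x := by
  have h1 := face_nonempty hS n
  have h2 := face_nonempty hS (-n)
  rcases le_total 0 r with hr | hr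
  · simp only [kink, asym₁, ← smul_neg, supp_smul h1 hr, supp_smul h2 hr, abs_of_nonneg hr]
    ring
  · have e : r • x = (-r) • (-x) := by module
    have hr' : 0 ≤ -r := by linarith
    simp only [e, kink, asym₁, ← smul_neg, supp_smul h1 hr', supp_smul h2 hr', abs_of_nonpos hr,
      neg_neg]
    ring

lemma knotEnergy_sub (T : Finset ℝ) (a b : ℝ → ℝ) : knotEnergy T a - knotEnergy T b =
    ∑ τ ∈ T, (a τ + b τ) * (∑ σ ∈ T, a σ * |τ - σ| - ∑ σ ∈ T, b σ * |τ - σ|) := by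
  have h1 : ∑ τ ∈ T, ∑ σ ∈ T, a τ * b σ * |τ - σ| = ∑ τ ∈ T, ∑ σ ∈ T, b τ * a σ * |τ - σ| := by
    rw [Finset.sum_comm]
    refine Finset.sum_congr rfl fun τ _ => Finset.sum_congr rfl fun σ _ => ?_
    rw [abs_sub_comm]; ring
  have h2 : ∀ τ, (a τ + b τ) * (∑ σ ∈ T, a σ * |τ - σ| - ∑ σ ∈ T, b σ * |τ - σ|) =
      ∑ σ ∈ T, a τ * a σ * |τ - σ| - ∑ σ ∈ T, b τ * b σ * |τ - σ| -
      (∑ σ ∈ T, a τ * b σ * |τ - σ| - ∑ σ ∈ T, b τ * a σ * |τ - σ|) := by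
    intro τ
    simp only [mul_assoc, ← Finset.mul_sum]
    ring
  simp only [h2, Finset.sum_sub_distrib, h1, knotEnergy]
  ring

lemma knotEnergy_nonneg {T : Finset ℝ} {a : ℝ → ℝ} (ha : ∀ τ, 0 ≤ a τ) : 0 ≤ knotEnergy T a :=
  Finset.sum_nonneg fun _ _ => Finset.sum_nonneg fun _ _ =>
    mul_nonneg (mul_nonneg (ha _) (ha _)) (abs_nonneg _)

/-- Equality of the areas of the facets with normals `n` and `-n`, whose width function is known,
says that the mixed area of their difference and their sum vanishes. -/
lemma sum_kink_asym₁_eq_zero {S : Finset E3} {k : ℕ} {Λ : E3 → ℕ} (hk : 0 < k)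
    (ht : IsMultipleTiling k (convexHull ℝ (S : Set E3)) Λ) {I : Finset E3} {g : E3 → E3}
    (hg : ∀ i ∈ I, g i ≠ 0) (hW : ∀ x, supp S x + supp S (-x) = ∑ i ∈ I, |⟪g i, x⟫|)
    {n : E3} (hn : ⟪n, n⟫ = 1) (w : E3 → E3)
    (hw : ∀ i ∈ I, ⟪g i, n⟫ = 0 → ⟪n, w i⟫ = 0 ∧ ⟪g i, w i⟫ = 0 ∧ ⟪w i, w i⟫ = ⟪g i, g i⟫) :
    ∑ i ∈ I with ⟪g i, n⟫ = 0, kink (asym₁ S) n (w i) = 0 := by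
  classical
  have hS := nonempty_of_tiling hk ht
  obtain ⟨e, m, h, hgen⟩ := exists_ON3_generic hn ((I.filter fun i => ⟪g i, n⟫ = 0).image g)
    (fun x hx => by
      obtain ⟨i, hi, rfl⟩ := Finset.mem_image.1 hx
      exact hg i (Finset.mem_filter.1 hi).1)
    (fun x hx => by
      obtain ⟨i, hi, rfl⟩ := Finset.mem_image.1 hx
      exact (Finset.mem_filter.1 hi).2)
  have hgen' : ∀ i ∈ I.filter fun i => ⟪g i, n⟫ = 0, ⟪g i, e⟫ ≠ 0 := fun i hi =>
    hgen _ (Finset.mem_image_of_mem g hi)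
  set J := I.filter fun i => ⟪g i, n⟫ = 0 with hJ
  have hF := face_nonempty hS n
  have hF' := face_nonempty hS (-n)
  have hFn : ∀ s ∈ face S n, ⟪n, s⟫ = supp S n := fun s hs => (mem_face.1 hs).2
  have hFn' : ∀ s ∈ face S (-n), ⟪n, s⟫ = -supp S (-n) := fun s hs => by
    rw [← (mem_face.1 hs).2, inner_neg_left, neg_neg]
  have hvol := volume_facet hk ht h
  -- the germs of the width function
  have hW1 : ∀ y, supp (face S n) y + supp (face S (-n)) (-y) = ∑ i ∈ I, absGerm (g i) n y := by
    have h1 := (hasGerm_supp hS).add (hasGerm_supp hS).comp_neg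
    have h2 := HasGerm.sum I fun i _ => hasGerm_abs (g i)
    have h3 : (fun x => supp S x + supp S (-x)) = fun x => ∑ i ∈ I, |⟪g i, x⟫| := funext hW
    rw [h3] at h1
    exact fun y => h1.unique h2 n y
  have hW2 : ∀ y z, supp (face (face S n) y) z + supp (face (face S (-n)) (-y)) (-z) =
      ∑ i ∈ I, absGerm₂ (g i) n y z := by
    have h1 := (hasGerm_supp hF).add (hasGerm_supp hF').comp_neg
    have h2 := HasGerm.sum I fun i _ => hasGerm_absGerm (g i) n
    have h3 : (fun y => supp (face S n) y + supp (face S (-n)) (-y)) =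
      fun y => ∑ i ∈ I, absGerm (g i) n y := funext hW1
    rw [h3] at h1
    exact fun y z => h1.unique h2 y z
  have hK : ∀ y z, (supp (face (face S n) y) z + supp (face (face S n) y) (-z)) +
      (supp (face (face S (-n)) (-y)) z + supp (face (face S (-n)) (-y)) (-z)) =
      2 * ∑ i ∈ J, if ⟪g i, y⟫ = 0 then |⟪g i, z⟫| else 0 := by
    intro y z
    have h1 := hW2 y z
    have h2 := hW2 y (-z)
    have h3 : ∑ i ∈ I, kink (absGerm₂ (g i) n) y z =
        2 * ∑ i ∈ J, if ⟪g i, y⟫ = 0 then |⟪g i, z⟫| else 0 := by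
      rw [hJ, Finset.sum_filter, Finset.mul_sum]
      refine Finset.sum_congr rfl fun i _ => ?_
      rw [kink_absGerm₂]
      by_cases h1 : ⟪g i, n⟫ = 0 <;> by_cases h2 : ⟪g i, y⟫ = 0 <;> simp [h1, h2]
    simp only [kink, Finset.sum_add_distrib] at h3
    rw [neg_neg] at h2
    linarith
  set c : ℝ → ℝ := fun t => ∑ i ∈ J, if ⟪g i, m + t • e⟫ = 0 then |⟪g i, e⟫| else 0 with hc
  set p := sideLen (face S n) e m with hp
  set p' := sideLen (face S n) (-e) (-m) with hp'
  set q := sideLen (face S (-n)) e m with hq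
  set q' := sideLen (face S (-n)) (-e) (-m) with hq'
  have hp0 : ∀ t, 0 ≤ p t := sideLen_nonneg hF e m
  have hp0' : ∀ t, 0 ≤ p' t := sideLen_nonneg hF _ _
  have hq0 : ∀ t, 0 ≤ q t := sideLen_nonneg hF' e m
  have hq0' : ∀ t, 0 ≤ q' t := sideLen_nonneg hF' _ _
  have hpq : ∀ t, p t + q' t = c t := fun t => by
    have := hK (m + t • e) e
    rw [hq', sideLen_neg, hp, sideLen]
    linarith
  have hpq' : ∀ t, p' t + q t = c t := fun t => by
    have := hK (-(m + t • e)) e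
    simp only [neg_neg, inner_neg_right, neg_eq_zero] at this
    rw [hp', sideLen_neg, hq, sideLen]
    linarith
  set knot : E3 → ℝ := fun i => -(⟪g i, m⟫ / ⟪g i, e⟫) with hknot
  have hzero : ∀ i ∈ J, ∀ t, ⟪g i, m + t • e⟫ = 0 ↔ t = knot i := by
    intro i hi t
    have h0 := hgen' i hi
    rw [inner_add_right, inner_smul_right, hknot]
    constructor
    · intro h1; field_simp; linarith
    · rintro rfl; field_simp; ring
  set T := J.image knot with hT
  have hcT : ∀ t ∉ T, c t = 0 := by
    intro t htT
    refine Finset.sum_eq_zero fun i hi => if_neg fun h0 => htT ?_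
    rw [(hzero i hi t).1 h0]
    exact Finset.mem_image_of_mem _ hi
  have hs : ∀ y, (y = e ∨ y = -e) →
      (supp (face (face S n) y) m + supp (face (face S n) y) (-m)) = 0 ∧
      (supp (face (face S (-n)) (-y)) m + supp (face (face S (-n)) (-y)) (-m)) = 0 := by
    intro y hy
    have h1 := hK y m
    rw [Finset.sum_eq_zero, mul_zero] at h1
    · have h2 := supp_neg_le (face_nonempty hF y) m
      have h3 := supp_neg_le (face_nonempty hF' (-y)) m
      exact ⟨by linarith, by linarith⟩
    · intro i hi
      refine if_neg fun h0 => hgen' i hi ?_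
      rcases hy with rfl | rfl
      · exact h0
      · simpa using h0
  have hs1 := hs e (Or.inl rfl)
  have hs2 := hs (-e) (Or.inr rfl)
  rw [neg_neg] at hs2
  have zp : ∀ t ∉ T, p t = 0 := fun t h' => by linarith [hpq t, hcT t h', hp0 t, hq0' t]
  have zq' : ∀ t ∉ T, q' t = 0 := fun t h' => by linarith [hpq t, hcT t h', hp0 t, hq0' t]
  have zp' : ∀ t ∉ T, p' t = 0 := fun t h' => by linarith [hpq' t, hcT t h', hp0' t, hq0 t]
  have zq : ∀ t ∉ T, q t = 0 := fun t h' => by linarith [hpq' t, hcT t h', hp0' t, hq0 t]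
  rw [volume_thick_eq_knotEnergy hF h hFn zp zp' hs1.1 hs2.1,
    volume_thick_eq_knotEnergy hF' h hFn' zq zq' hs2.2 hs1.2,
    ENNReal.ofReal_eq_ofReal_iff (add_nonneg (knotEnergy_nonneg hp0) (knotEnergy_nonneg hp0'))
      (add_nonneg (knotEnergy_nonneg hq0) (knotEnergy_nonneg hq0'))]
    at hvol
  obtain ⟨⟨α, β, r1, r2⟩, -, -⟩ := exists_supp_eq_sum_of_smooth hF zp zp' hs1.1 hs2.1
  obtain ⟨⟨α', β', r1', r2'⟩, -, -⟩ := exists_supp_eq_sum_of_smooth hF' zq zq' hs2.2 hs1.2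
  have hmain : ∑ τ ∈ T, c τ * kink (asym₁ S) n (m + τ • e) = 0 := by
    have h1 := knotEnergy_sub T p q'
    have h2 := knotEnergy_sub T p' q
    simp only [hpq, hpq'] at h1 h2
    have h3 : ∑ τ ∈ T, c τ * kink (asym₁ S) n (m + τ • e) =
        (knotEnergy T p - knotEnergy T q') + (knotEnergy T p' - knotEnergy T q) := by
      rw [h1, h2, ← Finset.sum_add_distrib]
      refine Finset.sum_congr rfl fun τ _ => ?_
      rw [← mul_add]
      congr 1
      simp only [kink, asym₁, neg_neg, r1, r2, r1', r2']
      ring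
    rw [h3]
    linarith
  rw [← hmain]
  simp only [hc, Finset.sum_mul]
  rw [Finset.sum_comm]
  refine Finset.sum_congr rfl fun i hi => ?_
  have hiI := (Finset.mem_filter.1 hi).1
  have hin := (Finset.mem_filter.1 hi).2
  rw [Finset.sum_eq_single (knot i)]
  · rw [if_pos ((hzero i hi _).2 rfl), ← kink_asym₁_smul hS]
    obtain ⟨w1, w2, w3⟩ := hw i hiI hin
    have h0 := hgen' i hi
    have e1 : ⟪g i, e⟫ • (m + knot i • e) = ⟪g i, e⟫ • m - ⟪g i, m⟫ • e := by
      rw [smul_add, smul_smul, hknot, mul_neg, mul_div_cancel₀ _ h0]; module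
    rw [e1]
    have gexp := h.expand (g i)
    have wexp := h.expand (w i)
    rw [w1, zero_smul, add_zero] at wexp
    rw [real_inner_comm (g i) n, hin, zero_smul, add_zero, real_inner_comm (g i) e,
      real_inner_comm (g i) m] at gexp
    set ge := ⟪g i, e⟫
    set gm := ⟪g i, m⟫
    set we := ⟪e, w i⟫
    set wm := ⟪m, w i⟫
    rw [gexp, wexp] at w2 w3
    simp only [inner_add_left, inner_add_right, real_inner_smul_left, inner_smul_right, h.hu,
      h.hv, h.huv, h.hvu] at w2 w3
    have hprop : w i = (wm / ge) • (ge • m - gm • e) := by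
      have : we = -(wm / ge * gm) := by field_simp; linarith
      rw [wexp, this, smul_sub, smul_smul, smul_smul, div_mul_cancel₀ _ h0]
      module
    have hr : |wm / ge| = 1 := by
      rw [← sq_eq_sq₀ (abs_nonneg _) zero_le_one, sq_abs, one_pow, div_pow,
        div_eq_one_iff_eq (pow_ne_zero 2 h0)]
      have h4 : ge ^ 2 * (we ^ 2 + wm ^ 2) = ge ^ 2 * (ge ^ 2 + gm ^ 2) := by
        congr 1; linarith
      have h5 : (ge * we) ^ 2 = (gm * wm) ^ 2 := by
        rw [show ge * we = -(gm * wm) by linarith]; ring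
      have h6 : (ge ^ 2 + gm ^ 2) * (wm ^ 2 - ge ^ 2) = 0 := by nlinarith
      have h7 : ge ^ 2 + gm ^ 2 ≠ 0 := by positivity
      linarith [(mul_eq_zero.1 h6).resolve_left h7]
    rw [hprop, kink_asym₁_smul hS, hr, one_mul]
  · intro τ _ hτ
    rw [if_neg (fun h0 => hτ ((hzero i hi τ).1 h0)), zero_mul]
  · intro h0
    exact absurd (Finset.mem_image_of_mem _ hi) h0

/-! ### The asymmetry of the support function is linear -/

section

variable {S : Finset E3}

lemma asym_neg (S : Finset E3) (x : E3) : asym S (-x) = -asym S x := by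
  rw [asym, asym, neg_neg]; ring

lemma asym_smul (hS : S.Nonempty) (r : ℝ) (x : E3) : asym S (r • x) = r * asym S x := by
  have h : ∀ {r : ℝ}, 0 ≤ r → ∀ x, asym S (r • x) = r * asym S x := fun hr x => by
    rw [asym, asym, ← smul_neg, supp_smul hS hr, supp_smul hS hr]; ring
  rcases le_total 0 r with hr | hr
  · exact h hr x
  · have e : r • x = (-r) • (-x) := by module
    rw [e, h (by linarith), asym_neg]; ring

lemma kink_asym₁_neg (S : Finset E3) (x w : E3) :
    kink (asym₁ S) (-x) w = -kink (asym₁ S) x w := by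
  simp only [kink, asym₁, neg_neg]; ring

lemma kink_asym₁_pos_smul (hS : S.Nonempty) {r : ℝ} (hr : 0 < r) (x w : E3) :
    kink (asym₁ S) (r • x) w = kink (asym₁ S) x w := by
  simp only [kink, asym₁, ← smul_neg, face_smul hS hr]

lemma kink_asym₁_add_smul (hS : S.Nonempty) (x w : E3) (r : ℝ) :
    kink (asym₁ S) x (w + r • x) = kink (asym₁ S) x w := by
  have e1 : -(w + r • x) = -w + r • (-x) := by module
  have e2 : -(w + r • x) = -w + (-r) • x := by module
  have e3 : w + r • x = w + (-r) • (-x) := by module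
  have h1 : supp (face S x) (-(w + r • x)) = supp (face S x) (-w) + (-r) * supp S x := by
    rw [e2, supp_face_add_smul hS]
  have h2 : supp (face S (-x)) (-(w + r • x)) = supp (face S (-x)) (-w) + r * supp S (-x) := by
    rw [e1, supp_face_add_smul hS]
  have h3 : supp (face S (-x)) (w + r • x) = supp (face S (-x)) w + (-r) * supp S (-x) := by
    rw [e3, supp_face_add_smul hS]
  simp only [kink, asym₁, neg_neg, h1, h2, h3, supp_face_add_smul hS]
  ring

lemma eventually_asym_add_smul (hS : S.Nonempty) (e m : E3) :
    ∀ᶠ t : ℝ in atTop, asym S (m + t • e) = t * asym S e + asym₁ S e m := by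
  filter_upwards [eventually_supp_add_smul hS e m, eventually_supp_add_smul hS (-e) (-m)]
    with t h1 h2
  have : -(m + t • e) = -m + t • (-e) := by module
  rw [asym, h1, this, h2, asym, asym₁]
  ring

variable {I : Finset E3} {g : E3 → E3}

/-- The support function of `S` and of `-S` have nonnegative kinks, which add up to those of the
width function. -/
lemma kink_asym₁_eq_zero (hS : S.Nonempty)
    (hW : ∀ x, supp S x + supp S (-x) = ∑ i ∈ I, |⟪g i, x⟫|) {x w : E3}
    (h : ∀ i ∈ I, ⟪g i, x⟫ = 0 → ⟪g i, w⟫ = 0) : kink (asym₁ S) x w = 0 := by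
  have h1 := (hasGerm_supp hS).add (hasGerm_supp hS).comp_neg
  have h2 := HasGerm.sum I fun i _ => hasGerm_abs (g i)
  have h3 : (fun x => supp S x + supp S (-x)) = fun x => ∑ i ∈ I, |⟪g i, x⟫| := funext hW
  rw [h3] at h1
  have h4 := fun y => h1.unique h2 x y
  have h5 : ∑ i ∈ I, kink (absGerm (g i)) x w = 0 :=
    Finset.sum_eq_zero fun i hi => by
      rw [kink_absGerm]
      split_ifs with h0
      · rw [h i hi h0]; simp
      · rfl
  simp only [kink, Finset.sum_add_distrib, ← h4, neg_neg] at h5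
  have h6 := supp_neg_le (face_nonempty hS x) w
  have h7 := supp_neg_le (face_nonempty hS (-x)) w
  simp only [kink, asym₁, neg_neg]
  linarith

lemma exists_finite_normals (I : Finset E3) (g : E3 → E3) (hg : ∀ i ∈ I, g i ≠ 0) :
    ∃ N : Finset E3, (∀ n ∈ N, ⟪n, n⟫ = 1 ∧ -n ∈ N) ∧
      ∀ n y : E3, ⟪n, n⟫ = 1 → ∀ i ∈ I, ∀ j ∈ I, ⟪g i, n⟫ = 0 → ⟪g j, n⟫ = 0 → ⟪g i, y⟫ = 0 →
        ⟪g j, y⟫ ≠ 0 → n ∈ N := by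
  classical
  have key : ∀ i j, ∃ d : E3, i ∈ I → ∀ n y : E3, ⟪n, n⟫ = 1 → ⟪g i, n⟫ = 0 → ⟪g j, n⟫ = 0 →
      ⟪g i, y⟫ = 0 → ⟪g j, y⟫ ≠ 0 → n = d ∨ n = -d := by
    intro i j
    by_cases hex : ∃ d : E3, ⟪d, d⟫ = 1 ∧ ⟪g i, d⟫ = 0 ∧ ⟪g j, d⟫ = 0
    · obtain ⟨d, hd, h1, h2⟩ := hex
      refine ⟨d, fun hi n y hn h3 h4 h5 h6 => ?_⟩
      have hgn : ‖g i‖ ≠ 0 := norm_ne_zero_iff.2 (hg i hi)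
      obtain ⟨z, hz⟩ := exists_ON3_of_orthogonal (m := ‖g i‖⁻¹ • g i) (n := d) (by
        rw [real_inner_smul_left, inner_smul_right, real_inner_self_eq_norm_sq]; field_simp) hd
        (by rw [inner_smul_right, real_inner_comm, h1, mul_zero])
      have e1 := hz.expand n
      have e2 := hz.expand y
      rw [real_inner_smul_left, h3, mul_zero, zero_smul, add_zero] at e1
      rw [real_inner_smul_left, h5, mul_zero, zero_smul, add_zero] at e2
      rw [e1, inner_add_right, inner_smul_right, inner_smul_right, h2, mul_zero, add_zero] at h4
      rw [e2, inner_add_right, inner_smul_right, inner_smul_right, h2, mul_zero, add_zero] at h6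
      rcases mul_eq_zero.1 h4 with h7 | h7
      · rw [h7, zero_smul, zero_add] at e1
        rw [e1, real_inner_smul_left, inner_smul_right, hd, mul_one, ← sq, sq_eq_one_iff] at hn
        rcases hn with hn | hn <;> rw [hn] at e1
        · left; simpa using e1
        · right; simpa using e1
      · rw [h7, mul_zero] at h6
        exact absurd rfl h6
    · exact ⟨0, fun _ n y hn h3 h4 _ _ => absurd ⟨n, hn, h3, h4⟩ hex⟩
  choose d hd using key
  set D := (I ×ˢ I).image fun p => d p.1 p.2
  refine ⟨(D ∪ D.image Neg.neg).filter fun n => ⟪n, n⟫ = 1, fun n hn => ?_, ?_⟩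
  · rw [Finset.mem_filter, Finset.mem_union] at hn
    refine ⟨hn.2, Finset.mem_filter.2 ⟨Finset.mem_union.2 ?_, by rw [inner_neg_neg]; exact hn.2⟩⟩
    rcases hn.1 with h | h
    · exact Or.inr (Finset.mem_image_of_mem _ h)
    · obtain ⟨x, hx, rfl⟩ := Finset.mem_image.1 h
      left; rwa [neg_neg]
  · intro n y hn i hi j hj h1 h2 h3 h4
    refine Finset.mem_filter.2 ⟨Finset.mem_union.2 ?_, hn⟩
    have hD : d i j ∈ D := Finset.mem_image.2 ⟨(i, j), Finset.mk_mem_product hi hj, rfl⟩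
    rcases hd i j hi n y hn h1 h2 h3 h4 with h | h
    · exact Or.inl (h ▸ hD)
    · exact Or.inr (h ▸ Finset.mem_image_of_mem _ hD)

lemma exists_asym_eq_zero (S : Finset E3) {p : E3} (hp : ⟪p, p⟫ = 1) :
    ∃ x y, ON3 p x y ∧ asym S y = 0 := by
  obtain ⟨v, w, h⟩ := exists_ON3 p hp
  have hc : Continuous fun θ : ℝ => asym S (Real.cos θ • v + Real.sin θ • w) := by
    have := continuous_supp S
    unfold asym
    fun_prop
  have hmem : (0 : ℝ) ∈ Set.uIcc (asym S (Real.cos 0 • v + Real.sin 0 • w))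
      (asym S (Real.cos Real.pi • v + Real.sin Real.pi • w)) := by
    simp only [Real.cos_zero, Real.sin_zero, Real.cos_pi, Real.sin_pi, one_smul, zero_smul,
      add_zero, neg_one_smul, asym_neg, Set.mem_uIcc]
    rcases le_total 0 (asym S v) with h | h
    · right; exact ⟨by linarith, h⟩
    · left; exact ⟨h, by linarith⟩
  obtain ⟨θ, -, hθ⟩ := intermediate_value_uIcc hc.continuousOn hmem
  have hsc := Real.sin_sq_add_cos_sq θ
  refine ⟨Real.sin θ • v - Real.cos θ • w, _, ⟨hp, ?_, ?_, ?_, ?_, ?_⟩, hθ⟩ <;>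
    simp only [inner_add_left, inner_add_right, inner_sub_left, inner_sub_right,
      real_inner_smul_left, inner_smul_right, h.hv, h.hw, h.hvw, h.hwv, h.huv, h.huw] <;>
    first | ring1 | linarith

/-- On the plane orthogonal to `g i` the asymmetry has nonpositive energy, and it is linear there
if the energy vanishes. In the chart `t ↦ x + t • y`, with `y` a zero of the asymmetry, this is
`HasGerm1.energy`. -/
lemma plane_energy (hS : S.Nonempty) (hg : ∀ i ∈ I, g i ≠ 0)
    (hW : ∀ x, supp S x + supp S (-x) = ∑ i ∈ I, |⟪g i, x⟫|) {N : Finset E3}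
    (hN : ∀ n ∈ N, ⟪n, n⟫ = 1 ∧ -n ∈ N)
    (hN' : ∀ n y : E3, ⟪n, n⟫ = 1 → ∀ i ∈ I, ∀ j ∈ I, ⟪g i, n⟫ = 0 → ⟪g j, n⟫ = 0 →
      ⟪g i, y⟫ = 0 → ⟪g j, y⟫ ≠ 0 → n ∈ N) {i : E3} (hi : i ∈ I) (w : E3 → E3)
    (hw : ∀ n ∈ N, ⟪g i, n⟫ = 0 → ⟪n, w n⟫ = 0 ∧ ⟪g i, w n⟫ = 0 ∧ ⟪w n, w n⟫ = ⟪g i, g i⟫) :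
    ∑ n ∈ N with ⟪g i, n⟫ = 0, asym S n * kink (asym₁ S) n (w n) ≤ 0 ∧
    (∑ n ∈ N with ⟪g i, n⟫ = 0, asym S n * kink (asym₁ S) n (w n) = 0 →
      ∃ c : E3, ∀ x, ⟪g i, x⟫ = 0 → asym S x = ⟪c, x⟫) := by
  classical
  have hgn : 0 < ‖g i‖ := norm_pos_iff.2 (hg i hi)
  obtain ⟨x, y, h, hy0⟩ := exists_asym_eq_zero S (p := ‖g i‖⁻¹ • g i) (by
    rw [real_inner_smul_left, inner_smul_right, real_inner_self_eq_norm_sq]; field_simp)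
  have hgx : ⟪g i, x⟫ = 0 := by
    have := h.huv
    rw [real_inner_smul_left] at this
    exact (mul_eq_zero.1 this).resolve_left (inv_ne_zero hgn.ne')
  have hgy : ⟪g i, y⟫ = 0 := by
    have := h.huw
    rw [real_inner_smul_left] at this
    exact (mul_eq_zero.1 this).resolve_left (inv_ne_zero hgn.ne')
  have hplane : ∀ z, ⟪g i, z⟫ = 0 → z = ⟪x, z⟫ • x + ⟪y, z⟫ • y := fun z hz => by
    have := h.expand z
    rwa [real_inner_smul_left, hz, mul_zero, zero_smul, zero_add] at this
  set f : ℝ → ℝ := fun t => asym S (x + t • y) with hf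
  set κ : ℝ → ℝ := fun t => kink (asym₁ S) (x + t • y) y with hκ
  set M := (N.filter fun n => ⟪g i, n⟫ = 0).filter fun n => ⟪x, n⟫ ≠ 0 with hM
  set q : E3 → ℝ := fun n => ⟪y, n⟫ / ⟪x, n⟫ with hq
  have hmemM : ∀ {n}, n ∈ M ↔ n ∈ N ∧ ⟪g i, n⟫ = 0 ∧ ⟪x, n⟫ ≠ 0 := by
    intro n; simp only [hM, Finset.mem_filter, and_assoc]
  have hnq : ∀ n ∈ M, n = ⟪x, n⟫ • (x + q n • y) := by
    intro n hn
    obtain ⟨h1, h2, h3⟩ := hmemM.1 hn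
    conv_lhs => rw [hplane n h2]
    rw [smul_add, smul_smul, hq, mul_div_cancel₀ _ h3]
  have hnorm : ∀ n ∈ M, ⟪x, n⟫ ^ 2 * (1 + q n ^ 2) = 1 := by
    intro n hn
    have h1 := (hN n (hmemM.1 hn).1).1
    rw [hnq n hn] at h1
    simp only [inner_add_left, inner_add_right, real_inner_smul_left, inner_smul_right, h.hv,
      h.hw, h.hvw, h.hwv] at h1
    linarith
  -- the terms of the energy in the chart
  have hterm : ∀ n ∈ M, asym S n * kink (asym₁ S) n (w n) = ‖g i‖ * (f (q n) * κ (q n)) := by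
    intro n hn
    obtain ⟨h1, h2, h3⟩ := hmemM.1 hn
    obtain ⟨w1, w2, w3⟩ := hw n h1 h2
    have hn' := hnq n hn
    have hno := hnorm n hn
    set r := ⟪x, n⟫
    set t := q n
    have wexp := hplane (w n) w2
    set wx := ⟪x, w n⟫
    set wy := ⟪y, w n⟫
    have hperp : wx + t * wy = 0 := by
      have h4 := w1
      rw [wexp, hn'] at h4
      simp only [inner_add_left, inner_add_right, real_inner_smul_left, inner_smul_right, h.hv,
        h.hw, h.hvw, h.hwv] at h4
      have : r * (wx + t * wy) = 0 := by linarith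
      exact (mul_eq_zero.1 this).resolve_left h3
    have hwn : w n = (wy * (1 + t ^ 2)) • y + wx • (x + t • y) := by
      have e1 : wx = -(t * wy) := by linarith
      rw [wexp, e1]; module
    have hsize : |wy * (1 + t ^ 2)| * |r| = ‖g i‖ := by
      rw [← abs_mul, ← sq_eq_sq₀ (abs_nonneg _) hgn.le, sq_abs, ← real_inner_self_eq_norm_sq, ← w3,
        wexp]
      simp only [inner_add_left, inner_add_right, real_inner_smul_left, inner_smul_right, h.hv,
        h.hw, h.hvw, h.hwv]
      have e1 : wx = -(t * wy) := by linarith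
      rw [e1]
      linear_combination (wy ^ 2 * (1 + t ^ 2)) * hno
    have hkink : kink (asym₁ S) (x + t • y) (w n) = |wy * (1 + t ^ 2)| * κ t := by
      rw [hwn, kink_asym₁_add_smul hS, kink_asym₁_smul hS]
    rw [show asym S n = r * f t from (congrArg (asym S) hn').trans (asym_smul hS _ _)]
    rcases lt_or_gt_of_ne h3 with hr | hr
    · have e1 : n = (-r) • (-(x + t • y)) := by rw [neg_smul_neg]; exact hn'
      have e2 : kink (asym₁ S) n (w n) = -(|wy * (1 + t ^ 2)| * κ t) := by
        rw [← hkink, ← kink_asym₁_neg]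
        exact (congrArg (fun z => kink (asym₁ S) z (w n)) e1).trans
          (kink_asym₁_pos_smul hS (show 0 < -r by linarith) _ _)
      rw [e2, ← hsize, abs_of_neg hr]
      ring
    · have e2 : kink (asym₁ S) n (w n) = |wy * (1 + t ^ 2)| * κ t := by
        rw [← hkink]
        exact (congrArg (fun z => kink (asym₁ S) z (w n)) hn').trans
          (kink_asym₁_pos_smul hS hr _ _)
      rw [e2, ← hsize, abs_of_pos hr]
      ring
  have hfiber : ∀ t ∈ M.image q, (M.filter fun n => q n = t).card = 2 := by
    intro t ht
    obtain ⟨n, hn, rfl⟩ := Finset.mem_image.1 ht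
    obtain ⟨h1, h2, h3⟩ := hmemM.1 hn
    rw [Finset.card_eq_two]
    refine ⟨n, -n, fun h0 => h3 ?_, ?_⟩
    · have : ⟪x, n⟫ = ⟪x, -n⟫ := by rw [← h0]
      rw [inner_neg_right] at this
      linarith
    · ext n'
      simp only [Finset.mem_filter, Finset.mem_insert, Finset.mem_singleton]
      constructor
      · rintro ⟨hn', hqq⟩
        have e1 := hnorm n' hn'
        have e2 := hnorm n hn
        have e3 := hnq n' hn'
        have e4 := hnq n hn
        rw [hqq] at e1 e3
        have e5 : ⟪x, n'⟫ ^ 2 = ⟪x, n⟫ ^ 2 :=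
          mul_right_cancel₀ (by positivity : (1 + q n ^ 2) ≠ 0) (e1.trans e2.symm)
        rcases sq_eq_sq_iff_eq_or_eq_neg.1 e5 with e6 | e6
        · left; rw [e3, e6, ← e4]
        · right; rw [e3, e6, neg_smul, ← e4]
      · rintro (rfl | rfl)
        · exact ⟨hn, rfl⟩
        · refine ⟨hmemM.2 ⟨(hN n h1).2, by simpa using h2, by simpa using h3⟩, ?_⟩
          simp [hq]
  have hsum : ∑ n ∈ N with ⟪g i, n⟫ = 0, asym S n * kink (asym₁ S) n (w n) =
      2 * ‖g i‖ * ∑ t ∈ M.image q, f t * κ t := by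
    have e1 : ∑ n ∈ N with ⟪g i, n⟫ = 0, asym S n * kink (asym₁ S) n (w n) =
        ∑ n ∈ M, asym S n * kink (asym₁ S) n (w n) := by
      refine (Finset.sum_subset (Finset.filter_subset _ _) fun n hn hnM => ?_).symm
      have hn' := Finset.mem_filter.1 hn
      have h3 : ⟪x, n⟫ = 0 := by
        by_contra h3
        exact hnM (hmemM.2 ⟨hn'.1, hn'.2, h3⟩)
      rw [hplane n hn'.2, h3, zero_smul, zero_add, asym_smul hS, hy0]
      ring
    rw [e1, Finset.sum_congr rfl hterm, Finset.sum_comp (fun t => ‖g i‖ * (f t * κ t)) q,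
      Finset.mul_sum]
    refine Finset.sum_congr rfl fun t ht => ?_
    rw [hfiber t ht, nsmul_eq_mul]
    push_cast
    ring
  have hT : ∀ t ∉ M.image q, asym₁ S (x + t • y) y + asym₁ S (x + t • y) (-y) = 0 := by
    intro t ht
    refine kink_asym₁_eq_zero hS hW (x := x + t • y) (w := y) fun j hj h1 => ?_
    by_contra h2
    have hpos : 0 < 1 + t ^ 2 := by positivity
    have hr0 : (√(1 + t ^ 2))⁻¹ ≠ 0 := inv_ne_zero (Real.sqrt_pos.2 hpos).ne'
    have hr : (√(1 + t ^ 2))⁻¹ ^ 2 * (1 + t ^ 2) = 1 := by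
      rw [inv_pow, Real.sq_sqrt hpos.le, inv_mul_cancel₀ hpos.ne']
    set r := (√(1 + t ^ 2))⁻¹
    have hx1 : ⟪x, r • (x + t • y)⟫ = r := by
      rw [inner_smul_right, inner_add_right, inner_smul_right, h.hv, h.hvw]; ring
    have hg0 : ⟪g i, r • (x + t • y)⟫ = 0 := by
      rw [inner_smul_right, inner_add_right, inner_smul_right, hgx, hgy]; ring
    apply ht
    refine Finset.mem_image.2 ⟨r • (x + t • y), hmemM.2 ⟨?_, hg0, by rw [hx1]; exact hr0⟩, ?_⟩
    · refine hN' _ y ?_ i hi j hj hg0 (by rw [inner_smul_right, h1, mul_zero]) hgy h2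
      simp only [inner_add_left, inner_add_right, real_inner_smul_left, inner_smul_right, h.hv,
        h.hw, h.hvw, h.hwv]
      linarith
    · simp only [hq]
      rw [hx1, inner_smul_right, inner_add_right, inner_smul_right, h.hw, h.hwv]
      field_simp
      ring
  have hE := ((hasGerm_asym hS).hasGerm1 x y).energy (M.image q) hT
    (c₁ := asym₁ S y x) (c₂ := asym₁ S (-y) x)
    ((eventually_asym_add_smul hS y x).mono fun t ht => by rw [ht, hy0]; ring)
    ((eventually_asym_add_smul hS (-y) x).mono fun t ht => by
      rw [neg_smul, ← smul_neg, ht, asym_neg, hy0]; ring)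
  rw [hsum]
  refine ⟨mul_nonpos_of_nonneg_of_nonpos (by positivity) hE.1, fun h0 => ?_⟩
  obtain ⟨α, hα⟩ := hE.2 ((mul_eq_zero.1 h0).resolve_left (by positivity))
  refine ⟨α • x, fun z hz => ?_⟩
  rw [real_inner_smul_left]
  by_cases hp : ⟪x, z⟫ = 0
  · have := hplane z hz
    rw [hp, zero_smul, zero_add] at this
    rw [this, asym_smul hS, hy0, inner_smul_right, h.hvw]; ring
  · have e1 : z = ⟪x, z⟫ • (x + (⟪y, z⟫ / ⟪x, z⟫) • y) := by
      rw [smul_add, smul_smul, mul_div_cancel₀ _ hp]; exact hplane z hz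
    conv_lhs => rw [e1]
    rw [asym_smul hS, hα]
    ring

end

lemma exists_rotation {p n : E3} (hn : ⟪n, n⟫ = 1) (h : ⟪p, n⟫ = 0) :
    ∃ w, ⟪n, w⟫ = 0 ∧ ⟪p, w⟫ = 0 ∧ ⟪w, w⟫ = ⟪p, p⟫ := by
  obtain ⟨v, z, hz⟩ := exists_ON3 n hn
  have e := hz.expand p
  rw [real_inner_comm, h, zero_smul, zero_add] at e
  set a := ⟪v, p⟫
  set b := ⟪z, p⟫
  refine ⟨(-b) • v + a • z, ?_, ?_, ?_⟩ <;> (try rw [e]) <;>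
    simp only [inner_add_left, inner_add_right, real_inner_smul_left, inner_smul_right, hz.hv,
      hz.hw, hz.hvw, hz.hwv, hz.huv, hz.huw] <;> ring

section

variable {S : Finset E3} {k : ℕ} {Λ : E3 → ℕ} {I : Finset E3} {g : E3 → E3}

/-- Weighting the relations between opposite facets with the asymmetry and exchanging the order of
summation gives a vanishing sum of energies. -/
lemma exists_asym_eq_inner_plane (hk : 0 < k)
    (ht : IsMultipleTiling k (convexHull ℝ (S : Set E3)) Λ)
    (hg : ∀ i ∈ I, g i ≠ 0) (hW : ∀ x, supp S x + supp S (-x) = ∑ i ∈ I, |⟪g i, x⟫|)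
    {i : E3} (hi : i ∈ I) : ∃ c : E3, ∀ x, ⟪g i, x⟫ = 0 → asym S x = ⟪c, x⟫ := by
  classical
  have hS := nonempty_of_tiling hk ht
  obtain ⟨N, hN, hN'⟩ := exists_finite_normals I g hg
  have hex : ∀ n i, ∃ w, ⟪n, n⟫ = 1 → ⟪g i, n⟫ = 0 →
      ⟪n, w⟫ = 0 ∧ ⟪g i, w⟫ = 0 ∧ ⟪w, w⟫ = ⟪g i, g i⟫ := by
    intro n i
    by_cases h : ⟪n, n⟫ = 1 ∧ ⟪g i, n⟫ = 0
    · obtain ⟨w, hw⟩ := exists_rotation h.1 h.2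
      exact ⟨w, fun _ _ => hw⟩
    · exact ⟨0, fun h1 h2 => absurd ⟨h1, h2⟩ h⟩
  choose w hw using hex
  have hE := fun i (hi : i ∈ I) => plane_energy hS hg hW hN hN' hi (fun n => w n i)
    fun n hn h => hw n i (hN n hn).1 h
  have htot : ∑ i ∈ I, ∑ n ∈ N with ⟪g i, n⟫ = 0, asym S n * kink (asym₁ S) n (w n i) = 0 := by
    have h1 : ∑ n ∈ N, asym S n * ∑ i ∈ I with ⟪g i, n⟫ = 0, kink (asym₁ S) n (w n i) = 0 :=
      Finset.sum_eq_zero fun n hn => by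
        rw [sum_kink_asym₁_eq_zero hk ht hg hW (hN n hn).1 (w n)
          fun i _ h => hw n i (hN n hn).1 h, mul_zero]
    refine Eq.trans ?_ h1
    simp only [Finset.sum_filter, Finset.mul_sum, mul_ite, mul_zero]
    exact Finset.sum_comm
  exact (hE i hi).2 ((Finset.sum_eq_zero_iff_of_nonpos fun i hi => (hE i hi).1).1 htot i hi)

lemma exists_inner_ne_zero (hint : (interior (convexHull ℝ (S : Set E3))).Nonempty)
    (hW : ∀ x, supp S x + supp S (-x) = ∑ i ∈ I, |⟪g i, x⟫|) {y : E3} (hy : y ≠ 0) :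
    ∃ i ∈ I, ⟪g i, y⟫ ≠ 0 := by
  by_contra! h
  have h0 : supp S y + supp S (-y) = 0 := by
    rw [hW, Finset.sum_eq_zero fun i hi => by rw [h i hi, abs_zero]]
  obtain ⟨o, ho⟩ := hint
  have hS : S.Nonempty := by
    by_contra hS
    rw [Finset.not_nonempty_iff_eq_empty] at hS
    simp [hS] at ho
  have hc : ∀ z ∈ convexHull ℝ (S : Set E3), ⟪y, z⟫ = supp S y := fun z hz => by
    have h1 := (mem_convexHull_iff_supp hS).1 hz y
    have h2 := (mem_convexHull_iff_supp hS).1 hz (-y)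
    rw [inner_neg_left] at h2
    linarith
  have hcont : Tendsto (fun ε : ℝ => o + ε • y) (𝓝[>] 0) (𝓝 o) := by
    have : Continuous fun ε : ℝ => o + ε • y := by fun_prop
    have := this.tendsto 0
    simp only [zero_smul, add_zero] at this
    exact this.mono_left nhdsWithin_le_nhds
  obtain ⟨ε, h1, h2⟩ := ((hcont.eventually (mem_interior_iff_mem_nhds.1 ho)).and
    self_mem_nhdsWithin).exists
  have h3 := hc _ h1
  rw [inner_add_right, inner_smul_right, hc o (interior_subset ho)] at h3
  have h4 : ε * ⟪y, y⟫ = 0 := by linarith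
  rcases mul_eq_zero.1 h4 with h5 | h5
  · exact (ne_of_gt h2) h5
  · exact hy (inner_self_eq_zero.1 h5)

/-- Three of the vectors `g i` form a basis; here is the dual basis. -/
lemma exists_dual_basis (h : ∀ y : E3, y ≠ 0 → ∃ i ∈ I, ⟪g i, y⟫ ≠ 0) :
    ∃ (p : Fin 3 → E3) (d : Fin 3 → E3), (∀ k, p k ∈ I) ∧
      (∀ k l, ⟪g (p k), d l⟫ = if k = l then 1 else 0) ∧ ∀ x, x = ∑ k, ⟪g (p k), x⟫ • d k := by
  classical
  have hspan : Submodule.span ℝ (g '' (I : Set E3)) = ⊤ := by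
    rw [← Submodule.orthogonal_eq_bot_iff, Submodule.eq_bot_iff]
    intro y hy
    by_contra hy0
    obtain ⟨i, hi, h1⟩ := h y hy0
    exact h1 ((Submodule.mem_orthogonal _ _).1 hy _ (Submodule.subset_span ⟨i, hi, rfl⟩))
  obtain ⟨b, hbs, hbspan, hb⟩ := exists_linearIndependent ℝ (g '' (I : Set E3))
  let B : Module.Basis b ℝ E3 := Module.Basis.mk hb (by
    rw [Subtype.range_coe, hbspan, hspan])
  have : Fintype b := FiniteDimensional.fintypeBasisIndex B
  have hcard : Fintype.card b = 3 := by
    rw [← Module.finrank_eq_card_basis B]; simp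
  let e : Fin 3 ≃ b := (Fintype.equivFinOfCardEq hcard).symm
  have hp : ∀ k, ∃ i ∈ I, g i = e k := fun k => by
    obtain ⟨i, hi, h⟩ := hbs (e k).2
    exact ⟨i, hi, h⟩
  choose p hpI hp using hp
  let B' := B.reindex e.symm
  have hB' : ∀ k, B' k = g (p k) := fun k => by
    rw [hp]; simp [B', B]
  let d : Fin 3 → E3 := fun l =>
    (InnerProductSpace.toDual ℝ E3).symm (LinearMap.toContinuousLinearMap (B'.coord l))
  have hd : ∀ l x, ⟪d l, x⟫ = B'.coord l x := fun l x => by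
    simp [d]
  refine ⟨p, d, hpI, fun k l => ?_, fun x => ?_⟩
  · rw [real_inner_comm, hd, ← hB', Module.Basis.coord_apply, Module.Basis.repr_self,
      Finsupp.single_apply]
  · refine ext_inner_right ℝ fun y => ?_
    rw [sum_inner]
    simp only [real_inner_smul_left, hd, ← hB']
    conv_lhs => rw [← B'.sum_repr y, inner_sum]
    refine Finset.sum_congr rfl fun k _ => ?_
    rw [inner_smul_right, Module.Basis.coord_apply, real_inner_comm, mul_comm]

/-- The linear functions on the planes orthogonal to the `g i` fit together: a plane meets at
least two of the coordinate planes of the dual basis in different lines. -/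
lemma exists_asym_eq_inner_planes (h : ∀ y : E3, y ≠ 0 → ∃ i ∈ I, ⟪g i, y⟫ ≠ 0)
    (hg : ∀ i ∈ I, g i ≠ 0)
    (hpl : ∀ i ∈ I, ∃ c : E3, ∀ x, ⟪g i, x⟫ = 0 → asym S x = ⟪c, x⟫) :
    ∃ c : E3, ∀ i ∈ I, ∀ x, ⟪g i, x⟫ = 0 → asym S x = ⟪c, x⟫ := by
  obtain ⟨p, d, hpI, hpd, hexp⟩ := exists_dual_basis h
  refine ⟨∑ k, asym S (d k) • g (p k), fun i hi x hx => ?_⟩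
  set c := ∑ k, asym S (d k) • g (p k) with hc
  have hcd : ∀ l, ⟪c, d l⟫ = asym S (d l) := fun l => by
    rw [hc, sum_inner]
    simp only [real_inner_smul_left, hpd]
    simp
  obtain ⟨ci, hci⟩ := hpl i hi
  obtain ⟨k, hk⟩ : ∃ k, ⟪g i, d k⟫ ≠ 0 := by
    by_contra! h0
    apply hg i hi
    rw [← inner_self_eq_zero (𝕜 := ℝ), congrArg (fun z => ⟪g i, z⟫) (hexp (g i)), inner_sum]
    refine Finset.sum_eq_zero fun k _ => ?_
    rw [inner_smul_right, h0, mul_zero]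
  have hedge : ∀ l, ⟪ci, ⟪g i, d l⟫ • d k - ⟪g i, d k⟫ • d l⟫ =
      ⟪c, ⟪g i, d l⟫ • d k - ⟪g i, d k⟫ • d l⟫ := by
    intro l
    obtain ⟨m, hmk, hml⟩ := (by decide : ∀ k l : Fin 3, ∃ m, m ≠ k ∧ m ≠ l) k l
    obtain ⟨cm, hcm⟩ := hpl (p m) (hpI m)
    have h1 : ∀ l, m ≠ l → ⟪g (p m), d l⟫ = 0 := fun l hl => by rw [hpd, if_neg hl]
    rw [← hci, hcm]
    · rw [inner_sub_right, inner_sub_right, inner_smul_right, inner_smul_right, inner_smul_right,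
        inner_smul_right, ← hcm _ (h1 k hmk), ← hcm _ (h1 l hml), hcd, hcd]
    · rw [inner_sub_right, inner_smul_right, inner_smul_right, h1 k hmk, h1 l hml]; ring
    · rw [inner_sub_right, inner_smul_right, inner_smul_right]; ring
  have hx' : x = ∑ l, (-(⟪g (p l), x⟫ / ⟪g i, d k⟫)) •
      (⟪g i, d l⟫ • d k - ⟪g i, d k⟫ • d l) := by
    have h1 : ∑ l, ⟪g (p l), x⟫ * ⟪g i, d l⟫ = 0 := by
      rw [← hx]
      conv_rhs => rw [hexp x, inner_sum]
      simp only [inner_smul_right]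
    have h2 : ∀ l, (-(⟪g (p l), x⟫ / ⟪g i, d k⟫)) • (⟪g i, d l⟫ • d k - ⟪g i, d k⟫ • d l) =
        (-(⟪g (p l), x⟫ * ⟪g i, d l⟫) / ⟪g i, d k⟫) • d k + ⟪g (p l), x⟫ • d l := by
      intro l
      rw [smul_sub, smul_smul, smul_smul, neg_mul, neg_mul, div_mul_cancel₀ _ hk, neg_smul,
        neg_smul, sub_neg_eq_add, ← neg_smul]
      congr 2
      ring
    simp only [h2]
    rw [Finset.sum_add_distrib, ← Finset.sum_smul, ← Finset.sum_div, Finset.sum_neg_distrib, h1,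
      ← hexp]
    simp
  rw [hci x hx, hx', inner_sum, inner_sum]
  refine Finset.sum_congr rfl fun l _ => ?_
  rw [inner_smul_right, inner_smul_right, hedge]

/-- Along a line the asymmetry minus `⟪c, ·⟫` vanishes at all its kinks, so its energy is zero. -/
lemma asym_eq_inner (hS : S.Nonempty) (h : ∀ y : E3, y ≠ 0 → ∃ i ∈ I, ⟪g i, y⟫ ≠ 0)
    (hW : ∀ x, supp S x + supp S (-x) = ∑ i ∈ I, |⟪g i, x⟫|) {c : E3}
    (hc : ∀ i ∈ I, ∀ x, ⟪g i, x⟫ = 0 → asym S x = ⟪c, x⟫) (y : E3) : asym S y = ⟪c, y⟫ := by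
  classical
  obtain ⟨p, d, hpI, hpd, -⟩ := exists_dual_basis h
  set w := d 1 with hw
  have hw0 : asym S w = ⟪c, w⟫ := hc _ (hpI 0) _ (by rw [hpd]; rfl)
  have hw1 : ⟪g (p 1), w⟫ = 1 := by rw [hw, hpd]; rfl
  set T := I.image fun j => -(⟪g j, y⟫ / ⟪g j, w⟫)
  have hker : ∀ t ∉ T, kink (asym₁ S) (y + t • w) w = 0 := by
    intro t ht
    refine kink_asym₁_eq_zero (x := y + t • w) (w := w) hS hW fun j hj h1 => ?_
    by_contra h2
    refine ht (Finset.mem_image.2 ⟨j, hj, ?_⟩)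
    rw [inner_add_right, inner_smul_right] at h1
    field_simp
    linarith
  have hgerm := ((hasGerm_asym hS).sub (hasGerm_inner c)).hasGerm1 y w
  have hkk : ∀ t : ℝ, (asym₁ S (y + t • w) w - ⟪c, w⟫) + (asym₁ S (y + t • w) (-w) - ⟪c, -w⟫) =
      kink (asym₁ S) (y + t • w) w := fun t => by
    rw [kink, inner_neg_right]; ring
  have hE := hgerm.energy T (fun t ht => by rw [hkk, hker t ht])
    (c₁ := asym₁ S w y - ⟪c, y⟫) (c₂ := asym₁ S (-w) y - ⟪c, y⟫)
    ((eventually_asym_add_smul hS w y).mono fun t ht => by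
      rw [ht, hw0, inner_add_right, inner_smul_right]; ring)
    ((eventually_asym_add_smul hS (-w) y).mono fun t ht => by
      rw [neg_smul, ← smul_neg, ht, asym_neg, hw0, inner_add_right, inner_smul_right,
        inner_neg_right]; ring)
  obtain ⟨α, hα⟩ := hE.2 (Finset.sum_eq_zero fun t _ => by
    rw [hkk]
    by_cases h0 : ∃ j ∈ I, ⟪g j, y + t • w⟫ = 0
    · obtain ⟨j, hj, h1⟩ := h0
      rw [hc j hj _ h1, sub_self, zero_mul]
    · rw [kink_asym₁_eq_zero hS hW fun j hj h1 => absurd ⟨j, hj, h1⟩ h0, mul_zero])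
  have h1 := hα (-⟪g (p 1), y⟫)
  rw [hc (p 1) (hpI 1) _ (by rw [inner_add_right, inner_smul_right, hw1]; ring), sub_self] at h1
  have h2 := hα 0
  rw [zero_smul, add_zero, ← h1] at h2
  linarith

end

/-- A multiply tiling polytope is a zonotope: its support function is that of the zonotope with
centre `c` and generators `g i`. -/
lemma exists_supp_eq_sum_abs {S : Finset E3} {k : ℕ} {Λ : E3 → ℕ} (hk : 0 < k)
    (ht : IsMultipleTiling k (convexHull ℝ (S : Set E3)) Λ) :
    ∃ (I : Finset E3) (g : E3 → E3) (c : E3), (∀ i ∈ I, g i ≠ 0) ∧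
      (∀ y : E3, y ≠ 0 → ∃ i ∈ I, ⟪g i, y⟫ ≠ 0) ∧
      ∀ x, supp S x = ⟪c, x⟫ + ∑ i ∈ I, |⟪g i, x⟫| := by
  obtain ⟨I, g, hg, hW⟩ := exists_width_eq_sum hk ht
  have hS := nonempty_of_tiling hk ht
  have hspan : ∀ y : E3, y ≠ 0 → ∃ i ∈ I, ⟪g i, y⟫ ≠ 0 := fun y hy =>
    exists_inner_ne_zero (interior_nonempty_of_tiling hk ht) hW hy
  obtain ⟨c, hc⟩ := exists_asym_eq_inner_planes hspan hg
    fun i hi => exists_asym_eq_inner_plane hk ht hg hW hi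
  refine ⟨I, fun i => (1 / 2 : ℝ) • g i, (1 / 2 : ℝ) • c, fun i hi => ?_, fun y hy => ?_,
    fun x => ?_⟩
  · exact smul_ne_zero (by norm_num) (hg i hi)
  · obtain ⟨i, hi, h⟩ := hspan y hy
    exact ⟨i, hi, by rw [real_inner_smul_left]; exact mul_ne_zero (by norm_num) h⟩
  · have h1 := hW x
    have h2 := asym_eq_inner hS hspan hW hc x
    rw [asym] at h2
    simp only [real_inner_smul_left, abs_mul, ← Finset.mul_sum]
    rw [abs_of_pos (by norm_num : (0 : ℝ) < 1 / 2)]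
    linarith

/-! ### Zonotopes -/

/-- The zonotope with centre `c` and generators `g j`, `j ∈ J`: the Minkowski sum of `{c}` and the
segments `[-g j, g j]`. -/
def zono (c : E3) (J : Finset E3) (g : E3 → E3) : Set E3 :=
  {z | ∃ s : E3 → ℝ, (∀ j ∈ J, |s j| ≤ 1) ∧ z = c + ∑ j ∈ J, s j • g j}

/-- The sum of the generators, each with the sign of its scalar product with `n`. -/
noncomputable def signSum (J : Finset E3) (g : E3 → E3) (n : E3) : E3 :=
  ∑ j ∈ J, (SignType.sign ⟪n, g j⟫ : ℝ) • g j

lemma mem_zono {c : E3} {J : Finset E3} {g : E3 → E3} {z : E3} :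
    z ∈ zono c J g ↔ ∃ s : E3 → ℝ, (∀ j ∈ J, |s j| ≤ 1) ∧ z = c + ∑ j ∈ J, s j • g j := Iff.rfl

lemma mem_supportFace {P : Set E3} {n z : E3} :
    z ∈ supportFace P n ↔ z ∈ P ∧ ∀ y ∈ P, ⟪n, y⟫ ≤ ⟪n, z⟫ := Iff.rfl

lemma abs_sign_le_one (x : ℝ) : |(SignType.sign x : ℝ)| ≤ 1 := by
  rcases lt_trichotomy x 0 with h | h | h <;> simp [h]

section

variable {c : E3} {J : Finset E3} {g : E3 → E3}

lemma center_mem_zono : c ∈ zono c J g := ⟨0, by simp, by simp⟩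

lemma inner_le_of_mem_zono {z : E3} (hz : z ∈ zono c J g) (n : E3) :
    ⟪n, z⟫ ≤ ⟪n, c⟫ + ∑ j ∈ J, |⟪n, g j⟫| := by
  obtain ⟨s, hs, rfl⟩ := hz
  rw [inner_add_right, inner_sum]
  gcongr with j hj
  rw [inner_smul_right]
  refine (le_abs_self _).trans ?_
  rw [abs_mul]
  exact mul_le_of_le_one_left (abs_nonneg _) (hs j hj)

lemma inner_signSum (n : E3) : ⟪n, signSum J g n⟫ = ∑ j ∈ J, |⟪n, g j⟫| := by
  rw [signSum, inner_sum]
  refine Finset.sum_congr rfl fun j _ => ?_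
  rw [inner_smul_right, sign_mul_self]

lemma add_signSum_mem_zono (n : E3) : c + signSum J g n ∈ zono c J g :=
  ⟨fun j => SignType.sign ⟪n, g j⟫, fun _ _ => abs_sign_le_one _, rfl⟩

lemma zono_add_zono [DecidableEq E3] {K : Finset E3} (h : Disjoint J K) (c' : E3) :
    zono c J g + zono c' K g = zono (c + c') (J ∪ K) g := by
  ext z
  rw [Set.mem_add]
  constructor
  · rintro ⟨x, ⟨s, hs, rfl⟩, y, ⟨t, ht, rfl⟩, rfl⟩
    refine ⟨fun j => if j ∈ J then s j else t j, fun j hj => ?_, ?_⟩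
    · dsimp only
      split_ifs with hJ
      · exact hs j hJ
      · exact ht j ((Finset.mem_union.1 hj).resolve_left hJ)
    · have e1 : ∑ j ∈ J, (if j ∈ J then s j else t j) • g j = ∑ j ∈ J, s j • g j :=
        Finset.sum_congr rfl fun j hj => by rw [if_pos hj]
      have e2 : ∑ j ∈ K, (if j ∈ J then s j else t j) • g j = ∑ j ∈ K, t j • g j :=
        Finset.sum_congr rfl fun j hj => by
          rw [if_neg fun hJ => Finset.disjoint_left.1 h hJ hj]
      rw [Finset.sum_union h, e1, e2]
      abel
  · rintro ⟨s, hs, rfl⟩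
    refine ⟨_, ⟨s, fun j hj => hs j (Finset.mem_union_left _ hj), rfl⟩, _,
      ⟨s, fun j hj => hs j (Finset.mem_union_right _ hj), rfl⟩, ?_⟩
    rw [Finset.sum_union h]
    abel

lemma supportFace_zono (n : E3) : supportFace (zono c J g) n =
    zono (c + signSum J g n) (J.filter fun j => ⟪n, g j⟫ = 0) g := by
  classical
  ext z
  rw [mem_supportFace]
  constructor
  · rintro ⟨⟨s, hs, rfl⟩, hmax⟩
    have h1 := hmax _ (add_signSum_mem_zono n)
    rw [inner_add_right, inner_signSum, inner_add_right, inner_sum] at h1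
    have hle : ∀ j ∈ J, ⟪n, s j • g j⟫ ≤ |⟪n, g j⟫| := fun j hj => by
      rw [inner_smul_right]
      refine (le_abs_self _).trans ?_
      rw [abs_mul]
      exact mul_le_of_le_one_left (abs_nonneg _) (hs j hj)
    have h2 := (Finset.sum_eq_sum_iff_of_le hle).1
      (le_antisymm (Finset.sum_le_sum hle) (by linarith))
    refine ⟨s, fun j hj => hs j (Finset.mem_filter.1 hj).1, ?_⟩
    rw [signSum, Finset.sum_filter, add_assoc, ← Finset.sum_add_distrib]
    congr 1
    refine Finset.sum_congr rfl fun j hj => ?_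
    split_ifs with h0
    · simp [h0]
    · have h3 := h2 j hj
      rw [inner_smul_right, ← sign_mul_self] at h3
      rw [mul_right_cancel₀ h0 h3, add_zero]
  · rintro ⟨s, hs, rfl⟩
    have hmem : c + signSum J g n + ∑ j ∈ J with ⟪n, g j⟫ = 0, s j • g j ∈ zono c J g := by
      refine ⟨fun j => if ⟪n, g j⟫ = 0 then s j else SignType.sign ⟪n, g j⟫, fun j hj => ?_, ?_⟩
      · dsimp only
        split_ifs with h0
        · exact hs j (Finset.mem_filter.2 ⟨hj, h0⟩)
        · exact abs_sign_le_one _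
      · rw [signSum, Finset.sum_filter, add_assoc, ← Finset.sum_add_distrib]
        congr 1
        refine Finset.sum_congr rfl fun j hj => ?_
        by_cases h0 : ⟪n, g j⟫ = 0
        · simp [h0]
        · simp only [if_neg h0, add_zero]
    refine ⟨hmem, fun y hy => (inner_le_of_mem_zono hy n).trans_eq ?_⟩
    rw [inner_add_right, inner_add_right, inner_signSum, inner_sum,
      Finset.sum_eq_zero (s := J.filter fun j => ⟪n, g j⟫ = 0), add_zero]
    intro j hj
    rw [inner_smul_right, (Finset.mem_filter.1 hj).2, mul_zero]

lemma vectorSpan_zono : vectorSpan ℝ (zono c J g) = Submodule.span ℝ (g '' (J : Set E3)) := by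
  classical
  apply le_antisymm
  · rw [vectorSpan_def, Submodule.span_le]
    rintro _ ⟨x, ⟨s, _, rfl⟩, y, ⟨t, _, rfl⟩, rfl⟩
    simp only [vsub_eq_sub, add_sub_add_left_eq_sub]
    exact sub_mem
      (sum_mem fun j hj => Submodule.smul_mem _ _ (Submodule.subset_span ⟨j, hj, rfl⟩))
      (sum_mem fun j hj => Submodule.smul_mem _ _ (Submodule.subset_span ⟨j, hj, rfl⟩))
  · rw [Submodule.span_le]
    rintro _ ⟨j, hj, rfl⟩
    have h1 : c + g j ∈ zono c J g := by
      refine ⟨fun i => if i = j then 1 else 0, fun i _ => ?_, ?_⟩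
      · dsimp only; split_ifs <;> simp
      · simp [Finset.mem_coe.1 hj]
    have h2 := vsub_mem_vectorSpan ℝ h1 (center_mem_zono (c := c) (J := J) (g := g))
    simpa using h2

lemma zono_insert [DecidableEq E3] {j : E3} (hj : j ∉ J) :
    zono c (insert j J) g = zono c J g + segment ℝ (-g j) (g j) := by
  have h1 : zono 0 {j} g = segment ℝ (-g j) (g j) := by
    ext z
    rw [mem_zono, segment_eq_image']
    simp only [Finset.mem_singleton, forall_eq, Finset.sum_singleton, zero_add, Set.mem_image]
    constructor
    · rintro ⟨s, hs, rfl⟩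
      have := abs_le.1 hs
      exact ⟨(s j + 1) / 2, ⟨by linarith, by linarith⟩, by module⟩
    · rintro ⟨t, ht, rfl⟩
      exact ⟨fun _ => 2 * t - 1, abs_le.2 ⟨by linarith [ht.1], by linarith [ht.2]⟩, by module⟩
  rw [← h1, zono_add_zono (Finset.disjoint_singleton_right.2 hj), add_zero, Finset.union_comm]
  rfl

lemma zono_empty : zono c ∅ g = {c} := by
  ext z
  rw [mem_zono]
  simp

lemma isPolytope_zono : IsPolytope (zono c J g) := by
  classical
  induction J using Finset.induction_on with
  | empty =>
    rw [zono_empty]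
    exact ⟨{c}, Set.finite_singleton c, Set.singleton_nonempty c, (convexHull_singleton c).symm⟩
  | insert j J hj ih =>
    obtain ⟨A, hA, hA', h⟩ := ih
    rw [zono_insert hj, h, ← convexHull_pair, ← convexHull_add]
    exact ⟨_, hA.add (by simp), hA'.add (by simp), rfl⟩

lemma zono_eq_sum : zono c J g = {c} + ∑ j ∈ J, segment ℝ (-g j) (g j) := by
  classical
  induction J using Finset.induction_on with
  | empty => rw [zono_empty]; simp
  | insert j J hj ih =>
    rw [zono_insert hj, ih, Finset.sum_insert hj, add_assoc, add_comm (segment _ _ _)]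

/-- A polytope is determined by its support function. -/
lemma convexHull_eq_zono {S : Finset E3} (hS : S.Nonempty)
    (h : ∀ x, supp S x = ⟪c, x⟫ + ∑ j ∈ J, |⟪g j, x⟫|) :
    convexHull ℝ (S : Set E3) = zono c J g := by
  have h' : ∀ y, supp S y = ⟪y, c⟫ + ∑ j ∈ J, |⟪y, g j⟫| := fun y => by
    rw [h, real_inner_comm]
    congr 1
    exact Finset.sum_congr rfl fun j _ => by rw [real_inner_comm]
  apply Set.Subset.antisymm
  · obtain ⟨A, hA, hA', hZ⟩ := isPolytope_zono (c := c) (J := J) (g := g)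
    lift A to Finset E3 using hA
    intro z hz
    rw [hZ, mem_convexHull_iff_supp (Finset.coe_nonempty.1 hA')]
    intro y
    refine ((mem_convexHull_iff_supp hS).1 hz y).trans ?_
    have h1 := add_signSum_mem_zono (c := c) (J := J) (g := g) y
    rw [hZ, mem_convexHull_iff_supp (Finset.coe_nonempty.1 hA')] at h1
    have h2 := h1 y
    rwa [inner_add_right, inner_signSum, ← h'] at h2
  · intro z hz
    rw [mem_convexHull_iff_supp hS]
    intro y
    rw [h']
    exact inner_le_of_mem_zono hz y

lemma pointReflection_zono (a : E3) :
    Equiv.pointReflection c '' zono (c + a) J g = zono (c - a) J g := by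
  have key : ∀ a, Equiv.pointReflection c '' zono (c + a) J g ⊆ zono (c - a) J g := by
    rintro a _ ⟨_, ⟨s, hs, rfl⟩, rfl⟩
    refine ⟨fun j => -s j, fun j hj => by rw [abs_neg]; exact hs j hj, ?_⟩
    rw [Equiv.pointReflection_apply]
    simp only [vsub_eq_sub, vadd_eq_add, neg_smul, Finset.sum_neg_distrib]
    abel
  refine (key a).antisymm fun z hz => ⟨Equiv.pointReflection c z, ?_,
    Equiv.pointReflection_involutive c z⟩
  have h1 := key (-a) ⟨z, by rwa [← sub_eq_add_neg], rfl⟩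
  rwa [sub_neg_eq_add] at h1

/-- A zonotope whose generators are nonnegative multiples of one vector is a segment. -/
lemma zono_eq_segment {d : E3} (h : ∀ j ∈ J, ∃ r : ℝ, 0 ≤ r ∧ g j = r • d) :
    zono c J g = segment ℝ (c - ∑ j ∈ J, g j) (c + ∑ j ∈ J, g j) := by
  choose! r hr hg using h
  have hsum : ∑ j ∈ J, g j = (∑ j ∈ J, r j) • d := by
    rw [Finset.sum_smul]; exact Finset.sum_congr rfl hg
  ext z
  rw [segment_eq_image']
  constructor
  · rintro ⟨s, hs, rfl⟩
    have h1 : ∑ j ∈ J, s j • g j = (∑ j ∈ J, s j * r j) • d := by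
      rw [Finset.sum_smul]
      exact Finset.sum_congr rfl fun j hj => by rw [mul_smul, ← hg j hj]
    have h2 : |∑ j ∈ J, s j * r j| ≤ ∑ j ∈ J, r j := by
      refine (Finset.abs_sum_le_sum_abs _ _).trans (Finset.sum_le_sum fun j hj => ?_)
      rw [abs_mul, abs_of_nonneg (hr j hj)]
      exact mul_le_of_le_one_left (hr j hj) (hs j hj)
    rw [h1, hsum]
    set R := ∑ j ∈ J, r j
    set q := ∑ j ∈ J, s j * r j
    have hR : 0 ≤ R := (abs_nonneg _).trans h2
    have hq := abs_le.1 h2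
    rcases hR.eq_or_lt with h0 | h0
    · refine ⟨0, by simp, ?_⟩
      have : q = 0 := by rw [← h0] at hq; linarith
      rw [this, ← h0]
      simp
    · refine ⟨(q / R + 1) / 2, ⟨?_, ?_⟩, ?_⟩
      · have : -1 ≤ q / R := by rw [le_div_iff₀ h0]; linarith
        linarith
      · have : q / R ≤ 1 := by rw [div_le_iff₀ h0]; linarith
        linarith
      · have e1 : q = q / R * R := (div_mul_cancel₀ _ h0.ne').symm
        conv_rhs => rw [e1]
        module
  · rintro ⟨t, ht, rfl⟩
    refine ⟨fun _ => 2 * t - 1, fun _ _ => abs_le.2 ⟨by linarith [ht.1], by linarith [ht.2]⟩, ?_⟩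
    rw [← Finset.smul_sum]
    module

end

lemma isExposed_supportFace (P : Set E3) (n : E3) : IsExposed ℝ P (supportFace P n) :=
  fun _ => ⟨innerSL ℝ n, by ext z; simp [mem_supportFace]⟩

/-- A small perturbation of `n` in direction `m` orders the signs lexicographically. -/
lemma exists_sign_inner_eq (J : Finset E3) (g : E3 → E3) (n m : E3) :
    ∃ n' : E3, ∀ j ∈ J, SignType.sign ⟪n', g j⟫ =
      if ⟪n, g j⟫ = 0 then SignType.sign ⟪m, g j⟫ else SignType.sign ⟪n, g j⟫ := by
  have h : ∀ j ∈ J, ∀ᶠ ε in 𝓝[>] (0 : ℝ), SignType.sign ⟪n + ε • m, g j⟫ =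
      if ⟪n, g j⟫ = 0 then SignType.sign ⟪m, g j⟫ else SignType.sign ⟪n, g j⟫ := by
    intro j _
    simp only [inner_add_left, real_inner_smul_left]
    by_cases h0 : ⟪n, g j⟫ = 0
    · filter_upwards [self_mem_nhdsWithin] with ε (hε : 0 < ε)
      rw [if_pos h0, h0, zero_add, sign_mul, sign_pos hε, one_mul]
    · have hc : Tendsto (fun ε : ℝ => ⟪n, g j⟫ + ε * ⟪m, g j⟫) (𝓝[>] 0) (𝓝 ⟪n, g j⟫) := by
        have : Continuous fun ε : ℝ => ⟪n, g j⟫ + ε * ⟪m, g j⟫ := by fun_prop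
        have := this.tendsto 0
        simp only [zero_mul, add_zero] at this
        exact this.mono_left nhdsWithin_le_nhds
      simp only [if_neg h0]
      rcases lt_or_gt_of_ne h0 with h1 | h1
      · filter_upwards [hc.eventually (gt_mem_nhds h1)] with ε h2
        rw [sign_neg h2, sign_neg h1]
      · filter_upwards [hc.eventually (lt_mem_nhds h1)] with ε h2
        rw [sign_pos h2, sign_pos h1]
  obtain ⟨ε, hε⟩ := ((Finset.eventually_all J).2 h).exists
  exact ⟨_, hε⟩

/-! ### Frames of zonotopes -/

lemma exists_orthogonal₂ (x y : E3) : ∃ n, n ≠ 0 ∧ ⟪n, x⟫ = 0 ∧ ⟪n, y⟫ = 0 := by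
  classical
  have h : (Submodule.span ℝ {x, y})ᗮ ≠ ⊥ := by
    intro h
    rw [Submodule.orthogonal_eq_bot_iff] at h
    have h1 : Module.finrank ℝ (Submodule.span ℝ (({x, y} : Finset E3) : Set E3)) ≤ _ :=
      finrank_span_finset_le_card {x, y}
    rw [Finset.coe_pair, h, finrank_top] at h1
    have h2 := Finset.card_le_two (a := x) (b := y)
    have h3 : Module.finrank ℝ E3 = 3 := by simp
    omega
  obtain ⟨n, hn, hn0⟩ := (Submodule.ne_bot_iff _).1 h
  rw [Submodule.mem_orthogonal'] at hn
  exact ⟨n, hn0, hn x (Submodule.subset_span (by simp)), hn y (Submodule.subset_span (by simp))⟩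

lemma exists_inner_eq_zero_ne_zero {x y : E3} (h : y ∉ Submodule.span ℝ {x}) :
    ∃ w, ⟪w, x⟫ = 0 ∧ ⟪w, y⟫ ≠ 0 := by
  by_contra! h'
  apply h
  rw [← Submodule.orthogonal_orthogonal (Submodule.span ℝ {x}), Submodule.mem_orthogonal]
  intro w hw
  refine h' w ?_
  rw [real_inner_comm]
  exact Submodule.mem_orthogonal_singleton_iff_inner_right.1 hw

lemma inner_eq_zero_of_mem_span {x y w : E3} (h : y ∈ Submodule.span ℝ {x}) (hw : ⟪w, x⟫ = 0) :
    ⟪w, y⟫ = 0 := by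
  obtain ⟨r, rfl⟩ := Submodule.mem_span_singleton.1 h
  rw [inner_smul_right, hw, mul_zero]

lemma exists_sub_mul_nonneg {ι : Type*} {V : Finset ι} (hV : V.Nonempty) (a b : ι → ℝ)
    (hb : ∀ j ∈ V, 0 < b j) :
    ∃ t : ℝ, (∀ j ∈ V, 0 ≤ a j - t * b j) ∧ ∃ j ∈ V, a j - t * b j = 0 := by
  obtain ⟨i, hi, hmin⟩ := V.exists_min_image (fun j => a j / b j) hV
  refine ⟨a i / b i, fun j hj => ?_, i, hi, ?_⟩
  · have := (le_div_iff₀ (hb j hj)).1 (hmin j hj)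
    linarith
  · rw [div_mul_cancel₀ _ (hb i hi).ne', sub_self]

/-- Vectors in an open half-space which are not all parallel lie on one side of a plane through
two nonparallel ones among them: this is an edge of the convex hull of the rays in a section of the
half-space. -/
lemma exists_supporting_plane {V : Finset E3} {g : E3 → E3} {u : E3}
    (hu : ∀ j ∈ V, 0 < ⟪u, g j⟫) {x y : E3} (hx : x ∈ V) (hy : y ∈ V)
    (hxy : g y ∉ Submodule.span ℝ {g x}) :
    ∃ n, n ≠ 0 ∧ (∀ j ∈ V, 0 ≤ ⟪n, g j⟫) ∧ ∃ z ∈ V, ∃ z' ∈ V, ⟪n, g z⟫ = 0 ∧ ⟪n, g z'⟫ = 0 ∧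
      g z' ∉ Submodule.span ℝ {g z} := by
  obtain ⟨w, hw1, hw2⟩ := exists_inner_eq_zero_ne_zero hxy
  obtain ⟨t, ht, z, hz, htz⟩ := exists_sub_mul_nonneg ⟨x, hx⟩ (fun j => ⟪w, g j⟫)
    (fun j => ⟪u, g j⟫) hu
  have hm : ∀ v, ⟪w - t • u, v⟫ = ⟪w, v⟫ - t * ⟪u, v⟫ := fun v => by
    rw [inner_sub_left, real_inner_smul_left]
  obtain ⟨m, hm'⟩ : ∃ m, m = w - t • u := ⟨_, rfl⟩
  simp only [← hm, ← hm'] at ht htz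
  obtain ⟨p, hp, hmp⟩ : ∃ p ∈ V, ⟪m, g p⟫ ≠ 0 := by
    by_contra! h
    have h1 := h x hx
    have h2 := h y hy
    rw [hm', hm] at h1 h2
    rw [hw1, zero_sub, neg_eq_zero] at h1
    rw [(mul_eq_zero.1 h1).resolve_right (hu x hx).ne', zero_mul, sub_zero] at h2
    exact hw2 h2
  have hm0 : m ≠ 0 := fun h => hmp (by rw [h, inner_zero_left])
  by_cases h2 : ∃ z' ∈ V, ⟪m, g z'⟫ = 0 ∧ g z' ∉ Submodule.span ℝ {g z}
  · obtain ⟨z', hz', h3, h4⟩ := h2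
    exact ⟨m, hm0, ht, z, hz, z', hz', htz, h3, h4⟩
  · push Not at h2
    -- rotate the plane about the only ray it contains, until it meets another one
    obtain ⟨w₂, hw₂, h5, h6⟩ := exists_orthogonal₂ (g z) m
    obtain ⟨t₂, ht₂, z', hz', htz'⟩ := exists_sub_mul_nonneg
      (V := V.filter fun j => 0 < ⟪m, g j⟫)
      ⟨p, Finset.mem_filter.2 ⟨hp, lt_of_le_of_ne (ht p hp) hmp.symm⟩⟩ (fun j => ⟪w₂, g j⟫)
      (fun j => ⟪m, g j⟫) fun j hj => (Finset.mem_filter.1 hj).2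
    rw [Finset.mem_filter] at hz'
    have hn : ∀ v, ⟪w₂ - t₂ • m, v⟫ = ⟪w₂, v⟫ - t₂ * ⟪m, v⟫ := fun v => by
      rw [inner_sub_left, real_inner_smul_left]
    refine ⟨w₂ - t₂ • m, fun h0 => hw₂ ?_, fun j hj => ?_, z, hz, z', hz'.1, ?_, ?_, fun h => ?_⟩
    · have h7 := congrArg (fun v => ⟪w₂, v⟫) h0
      simp only [inner_sub_right, inner_smul_right, h6, mul_zero, sub_zero,
        inner_zero_right] at h7
      exact inner_self_eq_zero.1 h7
    · rw [hn]
      rcases (ht j hj).eq_or_lt with h7 | h7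
      · rw [← h7, inner_eq_zero_of_mem_span (h2 j hj h7.symm) h5]; simp
      · exact ht₂ j (Finset.mem_filter.2 ⟨hj, h7⟩)
    · rw [hn, h5, htz]; ring
    · rw [hn]; exact htz'
    · exact hz'.2.ne' (inner_eq_zero_of_mem_span h htz)

section

variable {c : E3} {I N E : Finset E3} {g : E3 → E3} {n m : E3}

lemma finrank_span_eq_two (hn : n ≠ 0) (hN : ∀ j ∈ N, ⟪n, g j⟫ = 0) {x y : E3} (hx : x ∈ N)
    (hy : y ∈ N) (hx0 : g x ≠ 0) (hxy : g y ∉ Submodule.span ℝ {g x}) :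
    Module.finrank ℝ (Submodule.span ℝ (g '' (N : Set E3))) = 2 := by
  have : Fact (Module.finrank ℝ E3 = 2 + 1) := ⟨by simp⟩
  have hle : Submodule.span ℝ (g '' (N : Set E3)) ≤ (Submodule.span ℝ {n})ᗮ := by
    rw [Submodule.span_le]
    rintro _ ⟨j, hj, rfl⟩
    exact Submodule.mem_orthogonal_singleton_iff_inner_right.2 (hN j hj)
  have h1 := Submodule.finrank_mono hle
  rw [Submodule.finrank_orthogonal_span_singleton (n := 2) hn] at h1
  have hlt : Submodule.span ℝ {g x} < Submodule.span ℝ (g '' (N : Set E3)) := by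
    refine lt_of_le_of_ne ?_ fun h => hxy (h ▸ Submodule.subset_span ⟨y, hy, rfl⟩)
    rw [Submodule.span_le, Set.singleton_subset_iff]
    exact Submodule.subset_span ⟨x, hx, rfl⟩
  have h2 := Submodule.finrank_lt_finrank_of_lt hlt
  rw [finrank_span_singleton hx0] at h2
  omega

lemma finrank_span_lt (hE : ∀ j ∈ E, j ∈ N ∧ ⟪m, g j⟫ = 0) {y : E3} (hy : y ∈ N)
    (hmy : ⟪m, g y⟫ ≠ 0) : Module.finrank ℝ (Submodule.span ℝ (g '' (E : Set E3))) <
      Module.finrank ℝ (Submodule.span ℝ (g '' (N : Set E3))) := by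
  apply Submodule.finrank_lt_finrank_of_lt
  refine lt_of_le_of_ne (Submodule.span_mono (Set.image_mono fun j hj => (hE j hj).1))
    fun h => hmy ?_
  have h1 : Submodule.span ℝ (g '' (E : Set E3)) ≤ (Submodule.span ℝ {m})ᗮ := by
    rw [Submodule.span_le]
    rintro _ ⟨j, hj, rfl⟩
    exact Submodule.mem_orthogonal_singleton_iff_inner_right.2 (hE j hj).2
  exact Submodule.mem_orthogonal_singleton_iff_inner_right.1
    (h1 (h ▸ Submodule.subset_span ⟨y, hy, rfl⟩))

lemma signSum_neg (J : Finset E3) (g : E3 → E3) (n : E3) : signSum J g (-n) = -signSum J g n := by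
  rw [signSum, signSum, ← Finset.sum_neg_distrib]
  refine Finset.sum_congr rfl fun j _ => ?_
  rw [inner_neg_left, Left.sign_neg]
  simp

/-- The face of the face is exposed by a perturbed functional. -/
lemma isExposed_zono_of_lex (hN : ∀ j, j ∈ N ↔ j ∈ I ∧ ⟪n, g j⟫ = 0)
    (hE : ∀ j, j ∈ E ↔ j ∈ N ∧ ⟪m, g j⟫ = 0) :
    IsExposed ℝ (zono c I g) (zono (c + signSum I g n + signSum N g m) E g) := by
  classical
  obtain ⟨n', hn'⟩ := exists_sign_inner_eq I g n m
  have h1 : signSum I g n' = signSum I g n + signSum N g m := by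
    have hN' : N = I.filter fun j => ⟪n, g j⟫ = 0 := by
      ext j; rw [hN, Finset.mem_filter]
    rw [hN', signSum, signSum, signSum, Finset.sum_filter, ← Finset.sum_add_distrib]
    refine Finset.sum_congr rfl fun j hj => ?_
    rw [hn' j hj]
    split_ifs with h0
    · simp [h0]
    · simp
  have h2 : (I.filter fun j => ⟪n', g j⟫ = 0) = E := by
    ext j
    rw [Finset.mem_filter, hE, hN, and_assoc, and_congr_right_iff]
    intro hj
    rw [← sign_eq_zero_iff, hn' j hj]
    split_ifs with h0
    · simp [h0, sign_eq_zero_iff]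
    · simp [h0, sign_eq_zero_iff]
  have h3 := isExposed_supportFace (zono c I g) n'
  rwa [supportFace_zono, h1, h2, ← add_assoc] at h3

/-- A facet of a zonotope and an edge of the facet give a frame. -/
lemma isFourLeggedFrame_zono (hn : n ≠ 0) (hN : ∀ j, j ∈ N ↔ j ∈ I ∧ ⟪n, g j⟫ = 0)
    (hE : ∀ j, j ∈ E ↔ j ∈ N ∧ ⟪m, g j⟫ = 0) {x y p d : E3} (hx : x ∈ N) (hy : y ∈ N)
    (hx0 : g x ≠ 0) (hxy : g y ∉ Submodule.span ℝ {g x}) (hp : p ∈ N) (hmp : ⟪m, g p⟫ ≠ 0)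
    (hd : ∀ j ∈ E, ∃ r : ℝ, 0 ≤ r ∧ g j = r • d) {z : E3} (hz : z ∈ E) (hz0 : g z ≠ 0)
    (hb : signSum N g m ≠ 0) :
    IsFourLeggedFrame (zono c I g) (c + signSum I g n + signSum N g m - ∑ j ∈ E, g j)
      ((2 : ℝ) • ∑ j ∈ E, g j) ((-2 : ℝ) • signSum N g m) ((-2 : ℝ) • signSum I g n) := by
  have hdim2 := finrank_span_eq_two hn (fun j hj => ((hN j).1 hj).2) hx hy hx0 hxy
  have hdim1 : Module.finrank ℝ (Submodule.span ℝ (g '' (E : Set E3))) = 1 := by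
    have h1 := finrank_span_lt (fun j hj => (hE j).1 hj) hp hmp
    have h2 : 0 < Module.finrank ℝ (Submodule.span ℝ (g '' (E : Set E3))) := by
      rw [Module.finrank_pos_iff, Submodule.nontrivial_iff_ne_bot, Submodule.ne_bot_iff]
      exact ⟨g z, Submodule.subset_span ⟨z, hz, rfl⟩, hz0⟩
    omega
  have hN' : ∀ j, j ∈ N ↔ j ∈ I ∧ ⟪-n, g j⟫ = 0 := fun j => by
    rw [hN, inner_neg_left, neg_eq_zero]
  have hE' : ∀ j, j ∈ E ↔ j ∈ N ∧ ⟪-m, g j⟫ = 0 := fun j => by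
    rw [hE, inner_neg_left, neg_eq_zero]
  have hface : ∀ n' m', (∀ j, j ∈ N ↔ j ∈ I ∧ ⟪n', g j⟫ = 0) →
      (∀ j, j ∈ E ↔ j ∈ N ∧ ⟪m', g j⟫ = 0) →
      IsFaceOfDim 1 (zono c I g) (zono (c + signSum I g n' + signSum N g m') E g) :=
    fun n' m' h1 h2 => ⟨isExposed_zono_of_lex h1 h2, ⟨_, center_mem_zono⟩, by
      rw [vectorSpan_zono, hdim1]⟩
  have hfilter : (I.filter fun j => ⟪n, g j⟫ = 0) = N := by
    ext j; rw [Finset.mem_filter, hN]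
  have hsub : ∀ (c' m' : E3), (∀ j, j ∈ E ↔ j ∈ N ∧ ⟪m', g j⟫ = 0) →
      zono (c' + signSum N g m') E g ⊆ zono c' N g := by
    intro c' m' h
    have : (N.filter fun j => ⟪m', g j⟫ = 0) = E := by ext j; rw [Finset.mem_filter, h]
    rw [← this, ← supportFace_zono]
    exact fun _ h => h.1
  have hseg : ∀ c', zono c' E g = segment ℝ (c' - ∑ j ∈ E, g j) (c' + ∑ j ∈ E, g j) := fun c' =>
    zono_eq_segment hd
  set a := signSum I g n with ha
  set b := signSum N g m with hb'
  set w := ∑ j ∈ E, g j with hw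
  have e1 : segment ℝ (c + a + b - w) (c + a + b - w + (2 : ℝ) • w) = zono (c + a + b) E g := by
    rw [hseg]; congr 1; module
  have e2 : segment ℝ (c + a + b - w + (-2 : ℝ) • b) (c + a + b - w + (2 : ℝ) • w + (-2 : ℝ) • b) =
      zono (c + a + -b) E g := by
    rw [hseg]; congr 1 <;> module
  have e3 : segment ℝ (c + a + b - w + (-2 : ℝ) • a) (c + a + b - w + (2 : ℝ) • w + (-2 : ℝ) • a) =
      zono (c + -a + b) E g := by
    rw [hseg]; congr 1 <;> module
  have e4 : segment ℝ (c + a + b - w + (-2 : ℝ) • b + (-2 : ℝ) • a)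
      (c + a + b - w + (2 : ℝ) • w + (-2 : ℝ) • b + (-2 : ℝ) • a) = zono (c + -a + -b) E g := by
    rw [hseg]; congr 1 <;> module
  rw [IsFourLeggedFrame, e1, e2, e3, e4]
  refine ⟨smul_ne_zero (by norm_num) hb, hface n m hN hE, ?_, ?_, ?_, c, zono (c + a) N g, ?_,
    ⟨?_, ⟨_, center_mem_zono⟩, by rw [vectorSpan_zono, hdim2]⟩, hsub _ _ hE, ?_, ?_, ?_⟩
  · have := hface n (-m) hN hE'
    rwa [signSum_neg] at this
  · have := hface (-n) m hN' hE
    rwa [signSum_neg] at this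
  · have := hface (-n) (-m) hN' hE'
    rwa [signSum_neg, signSum_neg] at this
  · have := pointReflection_zono (c := c) (J := I) (g := g) 0
    rwa [add_zero, sub_zero] at this
  · have := isExposed_supportFace (zono c I g) n
    rwa [supportFace_zono, hfilter] at this
  · have := hsub (c + a) _ hE'
    rwa [signSum_neg] at this
  · rw [pointReflection_zono, sub_eq_add_neg]
    exact hsub _ _ hE
  · rw [pointReflection_zono, sub_eq_add_neg]
    have := hsub (c + -a) _ hE'
    rwa [signSum_neg] at this

end

/-! ### Zonotopes whose frames satisfy the condition -/

section

variable {c : E3} {I : Finset E3} {g : E3 → E3}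

/-- All generators not orthogonal to `u` lie in the plane of a facet: otherwise a facet through two
of them and a suitable edge of it form a frame violating the condition. -/
lemma exists_facet_normal (hg : ∀ i ∈ I, g i ≠ 0)
    (hspan : ∀ y : E3, y ≠ 0 → ∃ i ∈ I, ⟪g i, y⟫ ≠ 0) {u : E3} (hu0 : u ≠ 0)
    (hpos : ∀ i ∈ I, 0 ≤ ⟪u, g i⟫)
    (hframe : ∀ v e τ₁ τ₂, IsFourLeggedFrame (zono c I g) v e τ₁ τ₂ →
      ⟪u, e⟫ = 0 ∨ ⟪u, τ₁⟫ = 0 ∨ ⟪u, τ₂⟫ = 0) :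
    ∃ n, n ≠ 0 ∧ (∀ i ∈ I, ⟪u, g i⟫ ≠ 0 → ⟪n, g i⟫ = 0) ∧
      ∃ x ∈ I, ∃ y ∈ I, ⟪n, g x⟫ = 0 ∧ ⟪n, g y⟫ = 0 ∧ g y ∉ Submodule.span ℝ {g x} := by
  classical
  obtain ⟨V, hV⟩ : ∃ V, V = I.filter fun i => ⟪u, g i⟫ ≠ 0 := ⟨_, rfl⟩
  have hmem : ∀ {i}, i ∈ V ↔ i ∈ I ∧ ⟪u, g i⟫ ≠ 0 := by intro i; rw [hV, Finset.mem_filter]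
  have hVpos : ∀ i ∈ V, 0 < ⟪u, g i⟫ := fun i hi =>
    lt_of_le_of_ne (hpos i (hmem.1 hi).1) (hmem.1 hi).2.symm
  obtain ⟨x, hxI, hx⟩ := hspan u hu0
  rw [real_inner_comm] at hx
  have hxV : x ∈ V := hmem.2 ⟨hxI, hx⟩
  by_cases hpar : ∀ j ∈ V, g j ∈ Submodule.span ℝ {g x}
  · obtain ⟨h, hh, hhx⟩ : ∃ h ∈ I, g h ∉ Submodule.span ℝ {g x} := by
      by_contra! hall
      obtain ⟨w, hw0, hw⟩ := exists_orthogonal (g x)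
      obtain ⟨i, hi, hiw⟩ := hspan w hw0
      rw [real_inner_comm] at hw hiw
      exact hiw (inner_eq_zero_of_mem_span (hall i hi) hw)
    obtain ⟨n, hn, hn1, hn2⟩ := exists_orthogonal₂ (g x) (g h)
    exact ⟨n, hn, fun i hi h0 => inner_eq_zero_of_mem_span (hpar i (hmem.2 ⟨hi, h0⟩)) hn1,
      x, hxI, h, hh, hn1, hn2, hhx⟩
  · push Not at hpar
    obtain ⟨y, hy, hxy⟩ := hpar
    obtain ⟨n, hn, hnV, z, hz, z', hz', hnz, hnz', hzz⟩ := exists_supporting_plane hVpos hxV hy hxy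
    refine ⟨n, hn, ?_, z, (hmem.1 hz).1, z', (hmem.1 hz').1, hnz, hnz', hzz⟩
    -- an extreme ray among the generators in the plane of the facet not orthogonal to `u`
    obtain ⟨w, hw1, hw2⟩ := exists_inner_eq_zero_ne_zero hzz
    obtain ⟨t, ht, q, hq, htq⟩ := exists_sub_mul_nonneg (V := V.filter fun j => ⟪n, g j⟫ = 0)
      ⟨z, Finset.mem_filter.2 ⟨hz, hnz⟩⟩ (fun j => ⟪w, g j⟫) (fun j => ⟪u, g j⟫)
      fun j hj => hVpos j (Finset.mem_filter.1 hj).1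
    have hm : ∀ v, ⟪w - t • u, v⟫ = ⟪w, v⟫ - t * ⟪u, v⟫ := fun v => by
      rw [inner_sub_left, real_inner_smul_left]
    obtain ⟨m, hm'⟩ : ∃ m, m = w - t • u := ⟨_, rfl⟩
    simp only [← hm, ← hm'] at ht htq
    rw [Finset.mem_filter] at hq
    obtain ⟨N, hNdef⟩ : ∃ N, N = I.filter fun j => ⟪n, g j⟫ = 0 := ⟨_, rfl⟩
    have hN : ∀ j, j ∈ N ↔ j ∈ I ∧ ⟪n, g j⟫ = 0 := fun j => by rw [hNdef, Finset.mem_filter]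
    obtain ⟨E, hEdef⟩ : ∃ E, E = N.filter fun j => ⟪m, g j⟫ = 0 := ⟨_, rfl⟩
    have hE : ∀ j, j ∈ E ↔ j ∈ N ∧ ⟪m, g j⟫ = 0 := fun j => by rw [hEdef, Finset.mem_filter]
    have hVN : ∀ {j}, j ∈ V → ⟪n, g j⟫ = 0 → j ∈ N := fun hj h => (hN _).2 ⟨(hmem.1 hj).1, h⟩
    obtain ⟨p, hp, hnp, hmp⟩ : ∃ p ∈ V, ⟪n, g p⟫ = 0 ∧ ⟪m, g p⟫ ≠ 0 := by
      by_contra! h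
      have h1 := h z hz hnz
      have h2 := h z' hz' hnz'
      rw [hm', hm] at h1 h2
      rw [hw1, zero_sub, neg_eq_zero] at h1
      rw [(mul_eq_zero.1 h1).resolve_right (hVpos z hz).ne', zero_mul, sub_zero] at h2
      exact hw2 h2
    have hqE : q ∈ E := (hE q).2 ⟨hVN hq.1 hq.2, htq⟩
    have hq0 : g q ≠ 0 := hg q (hmem.1 hq.1).1
    have hspanE : Submodule.span ℝ {g q} = Submodule.span ℝ (g '' (E : Set E3)) := by
      refine Submodule.eq_of_le_of_finrank_le ?_ ?_
      · rw [Submodule.span_le, Set.singleton_subset_iff]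
        exact Submodule.subset_span ⟨q, hqE, rfl⟩
      · have h1 := finrank_span_lt (fun j hj => (hE j).1 hj) (hVN hp hnp) hmp
        rw [finrank_span_eq_two hn (fun j hj => ((hN j).1 hj).2) (hVN hz hnz) (hVN hz' hnz')
          (hg z (hmem.1 hz).1) hzz] at h1
        rw [finrank_span_singleton hq0]
        omega
    have hd : ∀ j ∈ E, ∃ r : ℝ, 0 ≤ r ∧ g j = r • g q := by
      intro j hj
      have h1 : g j ∈ Submodule.span ℝ {g q} := hspanE ▸ Submodule.subset_span ⟨j, hj, rfl⟩
      obtain ⟨r, hr⟩ := Submodule.mem_span_singleton.1 h1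
      refine ⟨r, ?_, hr.symm⟩
      have h2 := hpos j ((hN j).1 ((hE j).1 hj).1).1
      rw [← hr, inner_smul_right] at h2
      by_contra! h3
      nlinarith [hVpos q hq.1]
    -- each sign sum has a nonnegative product with `u`, positive as soon as some term counts
    have hub : 0 < ⟪u, signSum N g m⟫ := by
      rw [signSum, inner_sum]
      have hterm : ∀ j ∈ N, 0 ≤ ⟪u, (SignType.sign ⟪m, g j⟫ : ℝ) • g j⟫ := by
        intro j hj
        rw [inner_smul_right]
        by_cases h0 : ⟪u, g j⟫ = 0
        · rw [h0, mul_zero]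
        · have h1 := ht j (Finset.mem_filter.2 ⟨hmem.2 ⟨((hN j).1 hj).1, h0⟩, ((hN j).1 hj).2⟩)
          refine mul_nonneg ?_ (hpos j ((hN j).1 hj).1)
          rcases h1.eq_or_lt with h2 | h2
          · simp [← h2]
          · simp [sign_pos h2]
      refine Finset.sum_pos' hterm ⟨p, hVN hp hnp, ?_⟩
      have h1 := lt_of_le_of_ne (ht p (Finset.mem_filter.2 ⟨hp, hnp⟩)) hmp.symm
      rw [inner_smul_right, sign_pos h1]
      simpa using hVpos p hp
    have hue : 0 < ⟪u, ∑ j ∈ E, g j⟫ := by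
      rw [inner_sum]
      exact Finset.sum_pos' (fun j hj => hpos j ((hN j).1 ((hE j).1 hj).1).1)
        ⟨q, hqE, hVpos q hq.1⟩
    have hF := hframe _ _ _ _ (isFourLeggedFrame_zono (c := c) hn hN hE (hVN hz hnz)
      (hVN hz' hnz') (hg z (hmem.1 hz).1) hzz (hVN hp hnp) hmp hd hqE hq0
      fun h0 => by rw [h0, inner_zero_right] at hub; exact lt_irrefl _ hub)
    simp only [inner_smul_right] at hF
    have hua : ⟪u, signSum I g n⟫ = 0 := by
      rcases hF with h | h | h <;> linarith
    have hterm : ∀ j ∈ I, 0 ≤ ⟪u, (SignType.sign ⟪n, g j⟫ : ℝ) • g j⟫ := by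
      intro j hj
      rw [inner_smul_right]
      by_cases h0 : ⟪u, g j⟫ = 0
      · rw [h0, mul_zero]
      · refine mul_nonneg ?_ (hpos j hj)
        rcases (hnV j (hmem.2 ⟨hj, h0⟩)).eq_or_lt with h2 | h2
        · simp [← h2]
        · simp [sign_pos h2]
    rw [signSum, inner_sum, Finset.sum_eq_zero_iff_of_nonneg hterm] at hua
    intro i hi h0
    have h1 := hua i hi
    rw [inner_smul_right] at h1
    have h2 := (mul_eq_zero.1 h1).resolve_right h0
    rcases (hnV i (hmem.2 ⟨hi, h0⟩)).eq_or_lt with h3 | h3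
    · exact h3.symm
    · rw [sign_pos h3] at h2
      simp at h2

/-- The decomposition of the zonotope along `u` and the normal `n` of a facet whose plane contains
all generators not orthogonal to `u`. -/
lemma exists_facet_decomposition (hg : ∀ i ∈ I, g i ≠ 0)
    {u n : E3} (hpos : ∀ i ∈ I, 0 ≤ ⟪u, g i⟫) (hn : n ≠ 0)
    (hV : ∀ i ∈ I, ⟪u, g i⟫ ≠ 0 → ⟪n, g i⟫ = 0) {p x y : E3} (hp : p ∈ I) (hup : ⟪u, g p⟫ ≠ 0)
    (hx : x ∈ I) (hy : y ∈ I) (hnx : ⟪n, g x⟫ = 0) (hny : ⟪n, g y⟫ = 0)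
    (hxy : g y ∉ Submodule.span ℝ {g x}) :
    ∃ G G' : Set E3, IsFaceOfDim 2 (zono c I g) G ∧ IsPolytope G' ∧
      (IsFaceOfDim 0 (zono c I g) (supportFace (zono c I g) u ∩ G) ∨
        IsFaceOfDim 1 (zono c I g) (supportFace (zono c I g) u ∩ G)) ∧
      G = G' + (supportFace (zono c I g) u ∩ G) ∧
      zono c I g = supportFace (zono c I g) u + G' := by
  classical
  obtain ⟨V, hVdef⟩ : ∃ V, V = I.filter fun i => ⟪u, g i⟫ ≠ 0 := ⟨_, rfl⟩
  obtain ⟨H, hHdef⟩ : ∃ H, H = I.filter fun i => ⟪u, g i⟫ = 0 := ⟨_, rfl⟩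
  obtain ⟨N, hNdef⟩ : ∃ N, N = I.filter fun i => ⟪n, g i⟫ = 0 := ⟨_, rfl⟩
  obtain ⟨K, hKdef⟩ : ∃ K, K = H.filter fun i => ⟪n, g i⟫ = 0 := ⟨_, rfl⟩
  have mV : ∀ {i}, i ∈ V ↔ i ∈ I ∧ ⟪u, g i⟫ ≠ 0 := by intro i; rw [hVdef, Finset.mem_filter]
  have mH : ∀ {i}, i ∈ H ↔ i ∈ I ∧ ⟪u, g i⟫ = 0 := by intro i; rw [hHdef, Finset.mem_filter]
  have mN : ∀ {i}, i ∈ N ↔ i ∈ I ∧ ⟪n, g i⟫ = 0 := by intro i; rw [hNdef, Finset.mem_filter]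
  have mK : ∀ {i}, i ∈ K ↔ i ∈ H ∧ ⟪n, g i⟫ = 0 := by intro i; rw [hKdef, Finset.mem_filter]
  have hHV : Disjoint H V := Finset.disjoint_left.2 fun i h1 h2 => (mV.1 h2).2 (mH.1 h1).2
  have hVK : Disjoint V K := Finset.disjoint_left.2 fun i h1 h2 => (mV.1 h1).2 (mH.1 (mK.1 h2).1).2
  have hHVI : H ∪ V = I := by
    ext i
    rw [Finset.mem_union, mH, mV]
    tauto
  have hVKN : V ∪ K = N := by
    ext i
    rw [Finset.mem_union, mV, mK, mH, mN]
    constructor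
    · rintro (⟨h1, h2⟩ | ⟨⟨h1, h2⟩, h3⟩)
      · exact ⟨h1, hV i h1 h2⟩
      · exact ⟨h1, h3⟩
    · rintro ⟨h1, h2⟩
      by_cases h3 : ⟪u, g i⟫ = 0
      · exact Or.inr ⟨⟨h1, h3⟩, h2⟩
      · exact Or.inl ⟨h1, h3⟩
  set w := signSum I g u with hw
  set a := signSum I g n with ha
  have hwV : w = ∑ j ∈ V, g j := by
    rw [hw, signSum, hVdef, Finset.sum_filter]
    refine Finset.sum_congr rfl fun j hj => ?_
    split_ifs with h0
    · rw [sign_pos (lt_of_le_of_ne (hpos j hj) (Ne.symm h0))]; simp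
    · rw [not_not] at h0; simp [h0]
  have haH : a = signSum H g n := by
    rw [ha, signSum, signSum, hHdef, Finset.sum_filter]
    refine Finset.sum_congr rfl fun j hj => ?_
    split_ifs with h0
    · rfl
    · rw [hV j hj h0]; simp
  have hnw : ⟪n, w⟫ = 0 := by
    rw [hwV, inner_sum]
    exact Finset.sum_eq_zero fun j hj => hV j (mV.1 hj).1 (mV.1 hj).2
  have hF : supportFace (zono c I g) u = zono (c + w) H g := by rw [supportFace_zono, hHdef]
  have hG : supportFace (zono c I g) n = zono (c + a) N g := by rw [supportFace_zono, hNdef]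
  have hFG : supportFace (zono c I g) u ∩ supportFace (zono c I g) n =
      zono (c + w + a) K g := by
    have h1 : zono (c + w + a) K g = supportFace (zono (c + w) H g) n := by
      rw [supportFace_zono, hKdef, haH]
    have h2 : c + w + a ∈ zono (c + w) H g := by rw [haH]; exact add_signSum_mem_zono n
    rw [h1, hF]
    ext z
    rw [Set.mem_inter_iff, mem_supportFace, mem_supportFace, ← hF]
    constructor
    · rintro ⟨h3, h4, h5⟩
      exact ⟨h3, fun y hy => h5 y hy.1⟩
    · rintro ⟨h3, h5⟩
      refine ⟨h3, h3.1, fun y hy => (inner_le_of_mem_zono hy n).trans ?_⟩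
      have h6 := h5 _ (hF ▸ h2)
      rwa [inner_add_right, inner_add_right, hnw, add_zero, ha, inner_signSum] at h6
  have hdim2 : Module.finrank ℝ (Submodule.span ℝ (g '' (N : Set E3))) = 2 :=
    finrank_span_eq_two hn (fun j hj => (mN.1 hj).2) (mN.2 ⟨hx, hnx⟩) (mN.2 ⟨hy, hny⟩) (hg x hx) hxy
  have hdimK : Module.finrank ℝ (Submodule.span ℝ (g '' (K : Set E3))) < 2 := by
    rw [← hdim2]
    exact finrank_span_lt (m := u)
      (fun j hj => ⟨mN.2 ⟨(mH.1 (mK.1 hj).1).1, (mK.1 hj).2⟩, (mH.1 (mK.1 hj).1).2⟩)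
      (mN.2 ⟨hp, hV p hp hup⟩) hup
  have hexp : IsExposed ℝ (zono c I g) (zono (c + w + a) K g) := by
    rw [← hFG]
    exact (isExposed_supportFace _ u).inter (isExposed_supportFace _ n)
  refine ⟨supportFace (zono c I g) n, zono (-w) V g, ⟨isExposed_supportFace _ n, ?_, ?_⟩,
    isPolytope_zono, ?_, ?_, ?_⟩
  · rw [hG]; exact ⟨_, center_mem_zono⟩
  · rw [hG, vectorSpan_zono, hdim2]
  · rw [hFG]
    have h1 : Module.finrank ℝ (Submodule.span ℝ (g '' (K : Set E3))) = 0 ∨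
        Module.finrank ℝ (Submodule.span ℝ (g '' (K : Set E3))) = 1 := by omega
    rcases h1 with h1 | h1
    · exact Or.inl ⟨hexp, ⟨_, center_mem_zono⟩, by rw [vectorSpan_zono, h1]⟩
    · exact Or.inr ⟨hexp, ⟨_, center_mem_zono⟩, by rw [vectorSpan_zono, h1]⟩
  · rw [hFG, hG, zono_add_zono hVK, hVKN]
    congr 1
    abel
  · rw [hF, zono_add_zono hHV, hHVI]
    congr 1
    abel

lemma segment_add_singleton (t x y : E3) :
    {t} + segment ℝ x y = segment ℝ (t + x) (t + y) := by
  rw [← convexHull_pair, ← convexHull_pair, ← convexHull_singleton (𝕜 := ℝ) t, ← convexHull_add]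
  congr 1
  rw [Set.singleton_add, Set.image_pair]

/-- The centre is distributed over the generators. -/
lemma zono_eq_sum_fin (hJ : I.Nonempty) {U : Submodule ℝ E3} (hc : c ∈ U)
    (hU : ∀ i ∈ I, g i ∈ U) (hg : ∀ i ∈ I, g i ≠ 0) :
    ∃ (k : ℕ) (a b : Fin k → E3), (∀ i, a i ∈ U ∧ b i ∈ U ∧ a i ≠ b i) ∧
      zono c I g = ∑ i, segment ℝ (a i) (b i) := by
  classical
  have hcard : (I.card : ℝ) ≠ 0 := Nat.cast_ne_zero.2 (Finset.card_ne_zero.2 hJ)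
  obtain ⟨t, ht⟩ : ∃ t : E3, t = (I.card : ℝ)⁻¹ • c := ⟨_, rfl⟩
  have htU : t ∈ U := ht ▸ U.smul_mem _ hc
  have hsum : ({c} : Set E3) = ∑ _j ∈ I, {t} := by
    have h1 : ∀ J : Finset E3, ∑ _j ∈ J, ({t} : Set E3) = {(J.card : ℝ) • t} := by
      intro J
      induction J using Finset.induction_on with
      | empty => simp [Set.singleton_zero]
      | insert j J hj ih =>
        rw [Finset.sum_insert hj, ih, Set.singleton_add_singleton, Finset.card_insert_of_notMem hj]
        congr 1
        push_cast
        module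
    rw [h1, ht, smul_smul, mul_inv_cancel₀ hcard, one_smul]
  refine ⟨I.card, fun k => t + -g (I.equivFin.symm k), fun k => t + g (I.equivFin.symm k),
    fun k => ?_, ?_⟩
  · have hk := (I.equivFin.symm k).2
    refine ⟨U.add_mem htU (U.neg_mem (hU _ hk)), U.add_mem htU (hU _ hk), fun h => ?_⟩
    have h1 := add_left_cancel h
    have h2 : (2 : ℝ) • g (I.equivFin.symm k) = 0 := by
      rw [two_smul]
      nth_rewrite 1 [← h1]
      exact neg_add_cancel _
    exact hg _ hk ((smul_eq_zero.1 h2).resolve_left two_ne_zero)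
  · rw [zono_eq_sum, hsum, ← Finset.sum_add_distrib, ← Finset.sum_coe_sort,
      ← Equiv.sum_comp I.equivFin.symm]
    exact Finset.sum_congr rfl fun k _ => segment_add_singleton _ _ _

/-- If each generator is orthogonal to `u` or to `n`, the zonotope is two-flat. The planes `u^⊥` and
`n^⊥` are different as some generator is not orthogonal to `u`. -/
lemma isTwoFlatZonotope_zono (hg : ∀ i ∈ I, g i ≠ 0)
    (hspan : ∀ y : E3, y ≠ 0 → ∃ i ∈ I, ⟪g i, y⟫ ≠ 0) {u n : E3} (hu : u ≠ 0) (hn : n ≠ 0)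
    (hV : ∀ i ∈ I, ⟪u, g i⟫ ≠ 0 → ⟪n, g i⟫ = 0) : IsTwoFlatZonotope (zono c I g) := by
  classical
  have : Fact (Module.finrank ℝ E3 = 2 + 1) := ⟨by simp⟩
  obtain ⟨H, hHdef⟩ : ∃ H, H = I.filter fun i => ⟪u, g i⟫ = 0 := ⟨_, rfl⟩
  obtain ⟨V, hVdef⟩ : ∃ V, V = I.filter fun i => ⟪u, g i⟫ ≠ 0 := ⟨_, rfl⟩
  have mV : ∀ {i}, i ∈ V ↔ i ∈ I ∧ ⟪u, g i⟫ ≠ 0 := by intro i; rw [hVdef, Finset.mem_filter]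
  have mH : ∀ {i}, i ∈ H ↔ i ∈ I ∧ ⟪u, g i⟫ = 0 := by intro i; rw [hHdef, Finset.mem_filter]
  have hHV : Disjoint H V := Finset.disjoint_left.2 fun i h1 h2 => (mV.1 h2).2 (mH.1 h1).2
  have hHVI : H ∪ V = I := by
    ext i
    rw [Finset.mem_union, mH, mV]
    tauto
  obtain ⟨p, hp, hup⟩ := hspan u hu
  obtain ⟨q, hq, hnq⟩ := hspan n hn
  rw [real_inner_comm] at hup hnq
  have huq : ⟪u, g q⟫ = 0 := by
    by_contra h
    exact hnq (hV q hq h)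
  have hnp := hV p hp hup
  -- split the centre into parts orthogonal to `u` and to `n`
  obtain ⟨c₁, c₂, hc, hc₁, hc₂⟩ : ∃ c₁ c₂, c = c₁ + c₂ ∧ ⟪u, c₁⟫ = 0 ∧ ⟪n, c₂⟫ = 0 := by
    refine ⟨c - (⟪u, c⟫ / ⟪u, g p⟫) • g p, (⟪u, c⟫ / ⟪u, g p⟫) • g p, by abel, ?_, ?_⟩
    · rw [inner_sub_right, inner_smul_right, div_mul_cancel₀ _ hup, sub_self]
    · rw [inner_smul_right, hnp, mul_zero]
  have hmem : ∀ {x y : E3}, y ∈ (Submodule.span ℝ {x})ᗮ ↔ ⟪x, y⟫ = 0 :=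
    Submodule.mem_orthogonal_singleton_iff_inner_right
  obtain ⟨k₁, a, b, hab, e1⟩ := zono_eq_sum_fin (c := c₁) (I := H) (g := g) ⟨q, mH.2 ⟨hq, huq⟩⟩
    (hmem.2 hc₁) (fun i hi => hmem.2 (mH.1 hi).2) fun i hi => hg i (mH.1 hi).1
  obtain ⟨k₂, a', b', hab', e2⟩ := zono_eq_sum_fin (c := c₂) (I := V) (g := g)
    ⟨p, mV.2 ⟨hp, hup⟩⟩ (hmem.2 hc₂) (fun i hi => hmem.2 (hV i (mV.1 hi).1 (mV.1 hi).2))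
    fun i hi => hg i (mV.1 hi).1
  refine ⟨(Submodule.span ℝ {u})ᗮ, (Submodule.span ℝ {n})ᗮ,
    Submodule.finrank_orthogonal_span_singleton (n := 2) hu,
    Submodule.finrank_orthogonal_span_singleton (n := 2) hn, fun h => hup ?_,
    k₁, k₂, a, b, a', b', hab, hab', ?_⟩
  · exact hmem.1 (h ▸ hmem.2 hnp)
  · rw [← e1, ← e2, zono_add_zono hHV, hHVI, hc]

/-- Up to the choice of signs of the generators, they have nonnegative product with `u`. -/
lemma exists_generators_nonneg {S : Finset E3} (hg : ∀ i ∈ I, g i ≠ 0)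
    (hspan : ∀ y : E3, y ≠ 0 → ∃ i ∈ I, ⟪g i, y⟫ ≠ 0)
    (h : ∀ x, supp S x = ⟪c, x⟫ + ∑ i ∈ I, |⟪g i, x⟫|) (u : E3) :
    ∃ g' : E3 → E3, (∀ i ∈ I, g' i ≠ 0) ∧ (∀ y : E3, y ≠ 0 → ∃ i ∈ I, ⟪g' i, y⟫ ≠ 0) ∧
      (∀ x, supp S x = ⟪c, x⟫ + ∑ i ∈ I, |⟪g' i, x⟫|) ∧ ∀ i ∈ I, 0 ≤ ⟪u, g' i⟫ := by
  classical
  have key : ∀ i, ∃ y, (y = g i ∨ y = -g i) ∧ 0 ≤ ⟪u, y⟫ := fun i => by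
    rcases le_total 0 ⟪u, g i⟫ with h | h
    · exact ⟨_, Or.inl rfl, h⟩
    · exact ⟨_, Or.inr rfl, by rw [inner_neg_right]; linarith⟩
  choose g' hg' hpos using key
  have habs : ∀ i x, |⟪g' i, x⟫| = |⟪g i, x⟫| := fun i x => by
    rcases hg' i with h | h <;> rw [h]
    rw [inner_neg_left, abs_neg]
  refine ⟨g', fun i hi h0 => ?_, fun y hy => ?_, fun x => ?_, fun i _ => hpos i⟩
  · rcases hg' i with h | h <;> rw [h] at h0
    · exact hg i hi h0
    · exact hg i hi (neg_eq_zero.1 h0)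
  · obtain ⟨i, hi, h1⟩ := hspan y hy
    exact ⟨i, hi, by rwa [← abs_ne_zero, habs, abs_ne_zero]⟩
  · simp only [habs]
    exact h x

end

end MultipleTiling

theorem mainTheorem2 (P : Set E3) (hP : IsPolytope P)
    (k : ℕ) (hk : 0 < k) (Λ : E3 → ℕ) (hΛ : IsMultipleTiling k P Λ)
    (l : Submodule ℝ E3) (hl : Module.finrank ℝ l = 1)
    (hframes : (l : Set E3) ⊆
      ⋂ (v : E3) (e : E3) (τ₁ : E3) (τ₂ : E3) (_ : IsFourLeggedFrame P v e τ₁ τ₂),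
        ((Submodule.span ℝ {e})ᗮ : Set E3) ∪ ((Submodule.span ℝ {τ₁})ᗮ : Set E3) ∪
          ((Submodule.span ℝ {τ₂})ᗮ : Set E3)) :
    IsTwoFlatZonotope P ∧
      ∀ u ∈ l, u ≠ 0 →
        ∃ G G' : Set E3, IsFaceOfDim 2 P G ∧ IsPolytope G' ∧
          (IsFaceOfDim 0 P (supportFace P u ∩ G) ∨ IsFaceOfDim 1 P (supportFace P u ∩ G)) ∧
          G = G' + (supportFace P u ∩ G) ∧
          P = supportFace P u + G' := by
  classical
  obtain ⟨S', hfin, -, rfl⟩ := hP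
  lift S' to Finset E3 using hfin with S
  have hS := MultipleTiling.nonempty_of_tiling hk hΛ
  obtain ⟨I, g, c, hg, hspan, hsupp⟩ := MultipleTiling.exists_supp_eq_sum_abs hk hΛ
  have key : ∀ u ∈ l, u ≠ 0 → ∃ g' : E3 → E3, ∃ n : E3,
      convexHull ℝ (S : Set E3) = MultipleTiling.zono c I g' ∧ (∀ i ∈ I, g' i ≠ 0) ∧
      (∀ y : E3, y ≠ 0 → ∃ i ∈ I, ⟪g' i, y⟫ ≠ 0) ∧ (∀ i ∈ I, 0 ≤ ⟪u, g' i⟫) ∧ n ≠ 0 ∧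
      (∀ i ∈ I, ⟪u, g' i⟫ ≠ 0 → ⟪n, g' i⟫ = 0) ∧
      ∃ x ∈ I, ∃ y ∈ I, ⟪n, g' x⟫ = 0 ∧ ⟪n, g' y⟫ = 0 ∧ g' y ∉ Submodule.span ℝ {g' x} := by
    intro u hu hu0
    obtain ⟨g', hg', hspan', hsupp', hpos⟩ :=
      MultipleTiling.exists_generators_nonneg hg hspan hsupp u
    have hP := MultipleTiling.convexHull_eq_zono hS hsupp'
    obtain ⟨n, hn, hV, hxy⟩ := MultipleTiling.exists_facet_normal (c := c) hg' hspan' hu0 hpos (by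
      intro v e τ₁ τ₂ h
      have h1 := hframes hu
      simp only [Set.mem_iInter] at h1
      rcases h1 v e τ₁ τ₂ (hP ▸ h) with (h2 | h2) | h2
      · left
        rw [real_inner_comm]
        exact Submodule.mem_orthogonal_singleton_iff_inner_right.1 h2
      · right; left
        rw [real_inner_comm]
        exact Submodule.mem_orthogonal_singleton_iff_inner_right.1 h2
      · right; right
        rw [real_inner_comm]
        exact Submodule.mem_orthogonal_singleton_iff_inner_right.1 h2)
    exact ⟨g', n, hP, hg', hspan', hpos, hn, hV, hxy⟩
  constructor
  · have : Nontrivial l := Module.finrank_pos_iff.1 (hl ▸ Nat.one_pos)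
    obtain ⟨u, hu0⟩ := exists_ne (0 : l)
    have hu0' : (u : E3) ≠ 0 := fun h => hu0 (Subtype.ext h)
    obtain ⟨g', n, hP, hg', hspan', -, hn, hV, -⟩ := key u u.2 hu0'
    rw [hP]
    exact MultipleTiling.isTwoFlatZonotope_zono hg' hspan' hu0' hn hV
  · intro u hu hu0
    obtain ⟨g', n, hP, hg', hspan', hpos, hn, hV, x, hx, y, hy, hnx, hny, hxy⟩ := key u hu hu0
    obtain ⟨p, hp, hup⟩ := hspan' u hu0
    rw [real_inner_comm] at hup
    rw [hP]
    exact MultipleTiling.exists_facet_decomposition hg' hpos hn hV hp hup hx hy hnx hny hxy
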